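/- Consider fully connected ReLU networks of depth $D\ge 2$ with weights $\mathcal W=(W_1,\dots,W_D)$, input dimension $N$, $H$ units in each of the $D-1$ hidden layers and $K$ output units (classes), where $N\le H$ and $K\le H$. Put $f^0(x)=x$, $g^d(x)=W_d f^{d-1}(x)$ for $1\le d\le D$, $f^d(x)=\max(0,g^d(x))$ entrywise for $1\le d<D$, and $f_{\mathcal W}(x)=f^D(x)=g^D(x)$. For $1\le d'\le d\le D$ let $J^{d'/d}(x)=\partial g^d/\partial g^{d'}$, i.e. the product of the activated portions of $W_{d'+1},\dots,W_d$ (weights leaving a unit with non-positive pre-activation are set to $0$), with $J^{d/d}=I$. Let $\mathcal L_\gamma(f_{\mathcal W}(x),y)=0$ if $f_{\mathcal W}(x)[y]\ge\max_{j\ne y}f_{\mathcal W}(x)[j]+\gamma$ and $1$ otherwise. $\|\cdot\|_2$ is the Euclidean norm of a vector and the spectral norm of a matrix, $\|\cdot\|_{2,\infty}$ the maximal Euclidean norm of a row, $\|\cdot\|_F$ the Frobenius norm, and $\|\mathcal W-\mathcal Z\|_F^2=\sum_{d=1}^D\|W_d-Z_d\|_F^2$. For a sample $S$ of $m\ge2$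 labelled points and weights $\mathcal W$ define $\alpha_d=\max(\max_{(x,y)\in S}\|f^d(x)\|_2,1)$ for $0\le d<D$, $\beta_d=\min_{(x,y)\in S}\min_h|g^d(x)[h]|$ for $1\le d<D$, and, for $1\le d'\le d\le D$, $\kappa_{d'/d}=\max(\max_{(x,y)\in S}\|J^{d'/d}(x)\|_{2,\infty},1)$ and $\psi_{d'/d}=\max(\max_{(x,y)\in S}\|J^{d'/d}(x)\|_2,1)$. Let $$\mathcal B_{\text{layer-}\ell_2}=\max_{1\le d<D}\frac{\sum_{d'=1}^d\kappa_{d'/d}\alpha_{d'-1}}{\alpha_d},\quad \mathcal B_{\text{preact}}=\max_{1\le d<D}\frac{\sum_{d'=1}^d\kappa_{d'/d}\alpha_{d'-1}}{\sqrt H\,\beta_d},\quad \mathcal B_{\text{output}}=\frac{\sum_{d=1}^D\kappa_{d/D}\alpha_{d-1}}{\sqrt H\,\gamma_{\text{class}}},$$ $$\mathcal B_{\text{jac-row-}\ell_2}=\max_{1\le d'<d\le D}\frac{\kappa_{d'/d-1}+\|W_d\|_{2,\infty}\sum_{d''=d'+1}^{d-1}\psi_{d''/d-1}\kappa_{d'/d''-1}}{\kappa_{d'/d}},$$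 $$\mathcal B_{\text{jac-spec}}=\max_{1\le d'<d\le D}\frac{\psi_{d'/d-1}+\|W_d\|_2\sum_{d''=d'+1}^{d-1}\psi_{d''/d-1}\psi_{d'/d''-1}}{\psi_{d'/d}}.$$ There are absolute constants $C,c>0$ such that, with $$\frac1{\sigma^\star}=c\,\sqrt H\,\sqrt{\ln(DH\sqrt m)}\;\max\{\mathcal B_{\text{layer-}\ell_2},\mathcal B_{\text{preact}},\mathcal B_{\text{output}},\mathcal B_{\text{jac-row-}\ell_2},\mathcal B_{\text{jac-spec}}\},$$ the following holds for all such $D,N,H,K,m$, every probability distribution $\mathcal D$ on $\mathbb R^N\times\{1,\dots,K\}$, every initialization $\mathcal Z=(Z_1,\dots,Z_D)$ fixed independently of the sample, every margin $\gamma_{\text{class}}>0$ and every $\delta>0$. With probability at least $1-\delta$ over $S\sim\mathcal D^m$, for every $\mathcal W$ with $\beta_d>0$ for all $1\le d<D$, $$\Pr_{(x,y)\sim\mathcal D}[\mathcal L_0(f_{\mathcal W}(x),y)=1]\le\frac1m\sum_{(x,y)\in S}\mathcal L_{\gamma_{\text{class}}}(f_{\mathcal W}(x),y)+C\,D\sqrt{\frac1{m-1}\Big(\frac{2\|\mathcal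 W-\mathcal Z\|_F^2}{(\sigma^\star)^2}+\ln\frac{Dm}{\delta}\Big)}.$$ -/

import Mathlib

open scoped Matrix

noncomputable section

namespace ReLUNet

/-- The weight matrices of a fully connected network with `D` layers of weights, where layer `d`
has `n d` units (`n 0` is the input dimension, `n D` the number of classes).
The entry at `i` is the matrix usually written `W_{i+1}`, which maps layer `i` to layer `i + 1`. -/
abbrev Params (D : ℕ) (n : ℕ → ℕ) : Type :=
  (i : Fin D) → Matrix (Fin (n (i + 1))) (Fin (n i)) ℝ

/-- A labelled data point `(x, y)`. -/
abbrev Point (D : ℕ) (n : ℕ → ℕ) : Type := (Fin (n 0) → ℝ) × Fin (n D)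

/-- Euclidean norm of a vector. -/
def l2Norm {k : ℕ} (v : Fin k → ℝ) : ℝ := ‖(WithLp.toLp 2 v : EuclideanSpace ℝ (Fin k))‖

/-- Spectral norm of a matrix (operator norm for the Euclidean norms). -/
def specNorm {k l : ℕ} (A : Matrix (Fin k) (Fin l) ℝ) : ℝ :=
  ‖(Matrix.toEuclideanLin A).toContinuousLinearMap‖

/-- The largest Euclidean norm of a row, `‖A‖_{2,∞}`. -/
def rowNorm {k l : ℕ} (A : Matrix (Fin k) (Fin l) ℝ) : ℝ := ⨆ h : Fin k, l2Norm (A h)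

/-- Squared Frobenius norm of a matrix. -/
def frobSq {k l : ℕ} (A : Matrix (Fin k) (Fin l) ℝ) : ℝ := ∑ h, ∑ j, A h j ^ 2

variable {D : ℕ} {n : ℕ → ℕ}

/-- The matrix mapping layer `d` to layer `d + 1` (only `d < D` is meaningful). -/
def weight (W : Params D n) (d : ℕ) : Matrix (Fin (n (d + 1))) (Fin (n d)) ℝ :=
  if h : d < D then W ⟨d, h⟩ else 0

/-- Output `f^d(x)` of layer `d`: `f^0 = x`, ReLU activation on the hidden layers `1, …, D - 1`,
linear activation on the output layer `D`. -/
def layerOut (W : Params D n) (x : Fin (n 0) → ℝ) : (d : ℕ) → Fin (n d) → ℝ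
  | 0 => x
  | d + 1 => fun h =>
      if d + 1 < D then max 0 ((weight W d *ᵥ layerOut W x d) h)
      else (weight W d *ᵥ layerOut W x d) h

/-- Pre-activation values `g^d(x) = W_d f^{d-1}(x)` of layer `d ≥ 1` (and `x` for `d = 0`). -/
def preAct (W : Params D n) (x : Fin (n 0) → ℝ) : (d : ℕ) → Fin (n d) → ℝ
  | 0 => x
  | d + 1 => weight W d *ᵥ layerOut W x d

/-- The network function `f(x) = W_D φ(W_{D-1} ⋯ φ(W_1 x))`. -/
def netOut (W : Params D n) (x : Fin (n 0) → ℝ) : Fin (n D) → ℝ := layerOut W x D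

/-- The Jacobian `∂g^{d'+k} / ∂g^{d'}` of the pre-activations of layer `d' + k` with respect to
those of layer `d' ≥ 1`, at the input `x`: the product of the activated portions of
`W_{d'+1}, …, W_{d'+k}`, in which the weights leaving an inactive unit are zeroed out. -/
def jac (W : Params D n) (x : Fin (n 0) → ℝ) (d' : ℕ) :
    (k : ℕ) → Matrix (Fin (n (d' + k))) (Fin (n d')) ℝ
  | 0 => (1 : Matrix (Fin (n d')) (Fin (n d')) ℝ)
  | k + 1 => weight W (d' + k) *
      Matrix.diagonal (fun h => if 0 < preAct W x (d' + k) h then (1 : ℝ) else 0) * jac W x d' k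

open Classical in
/-- The margin loss `L_γ(f_W(x), y)`: it is `0` when `f_W(x)[y] ≥ max_{j ≠ y} f_W(x)[j] + γ`, and
`1` otherwise. For `γ = 0` this is the 0-1 loss. -/
def marginLoss (γ : ℝ) (W : Params D n) (p : Point D n) : ℝ :=
  if ∀ j, j ≠ p.2 → netOut W p.1 j + γ ≤ netOut W p.1 p.2 then 0 else 1

/-- Test error: the probability that the 0-1 loss is `1` on a fresh data point. -/
def testError (μ : MeasureTheory.Measure (Point D n)) (W : Params D n) : ℝ :=
  μ.real {p | marginLoss 0 W p = 1}

variable {m : ℕ}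

/-- Margin-based training error: the average of `L_γ` over the sample. -/
def trainError (S : Fin m → Point D n) (γ : ℝ) (W : Params D n) : ℝ :=
  (∑ i, marginLoss γ W (S i)) / m

/-- `α_d = max (max_{x ∈ S} ‖f^d(x)‖₂) 1`. -/
def alphaB (S : Fin m → Point D n) (W : Params D n) (d : ℕ) : ℝ :=
  max (⨆ i : Fin m, l2Norm (layerOut W (S i).1 d)) 1

/-- `β_d = min_{x ∈ S} min_h |g^d(x)[h]|`. -/
def betaB (S : Fin m → Point D n) (W : Params D n) (d : ℕ) : ℝ :=
  ⨅ i : Fin m, ⨅ h : Fin (n d), |preAct W (S i).1 d h|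

/-- `κ_{d'/d} = max (max_{x ∈ S} ‖J^{d'/d}(x)‖_{2,∞}) 1`, for `d' ≤ d`. -/
def kappaB (S : Fin m → Point D n) (W : Params D n) (d' d : ℕ) : ℝ :=
  max (⨆ i : Fin m, rowNorm (jac W (S i).1 d' (d - d'))) 1

/-- `ψ_{d'/d} = max (max_{x ∈ S} ‖J^{d'/d}(x)‖₂) 1` (spectral norm), for `d' ≤ d`. -/
def psiB (S : Fin m → Point D n) (W : Params D n) (d' d : ℕ) : ℝ :=
  max (⨆ i : Fin m, specNorm (jac W (S i).1 d' (d - d'))) 1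

/-- `∑_{d'=1}^{d} κ_{d'/d} α_{d'-1}`. -/
def propSum (S : Fin m → Point D n) (W : Params D n) (d : ℕ) : ℝ :=
  ∑ d' ∈ Finset.Icc 1 d, kappaB S W d' d * alphaB S W (d' - 1)

/-- `B_{layer-ℓ₂}`. -/
def BLayer (S : Fin m → Point D n) (W : Params D n) : ℝ :=
  ⨆ d : Finset.Ico 1 D, propSum S W d / alphaB S W d

/-- `B_{preact}`, for hidden layers of width `H`. -/
def BPreact (H : ℕ) (S : Fin m → Point D n) (W : Params D n) : ℝ :=
  ⨆ d : Finset.Ico 1 D, propSum S W d / (√(H : ℝ) * betaB S W d)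

/-- `B_{output}`, for hidden layers of width `H` and margin `γ`. -/
def BOutput (H : ℕ) (γ : ℝ) (S : Fin m → Point D n) (W : Params D n) : ℝ :=
  propSum S W D / (√(H : ℝ) * γ)

/-- `B_{jac-row-ℓ₂}`: the maximum is over `1 ≤ d' < d ≤ D`; `weight W (d - 1)` is `W_d`. -/
def BJacRow (S : Fin m → Point D n) (W : Params D n) : ℝ :=
  ⨆ d : Finset.Icc 2 D, ⨆ d' : Finset.Ico 1 (d : ℕ),
    (kappaB S W d' (d - 1) + rowNorm (weight W (d - 1)) *
      ∑ d'' ∈ Finset.Ico ((d' : ℕ) + 1) d, psiB S W d'' (d - 1) * kappaB S W d' (d'' - 1)) /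
      kappaB S W d' d

/-- `B_{jac-spec}`: the maximum is over `1 ≤ d' < d ≤ D`; `weight W (d - 1)` is `W_d`. -/
def BJacSpec (S : Fin m → Point D n) (W : Params D n) : ℝ :=
  ⨆ d : Finset.Icc 2 D, ⨆ d' : Finset.Ico 1 (d : ℕ),
    (psiB S W d' (d - 1) + specNorm (weight W (d - 1)) *
      ∑ d'' ∈ Finset.Ico ((d' : ℕ) + 1) d, psiB S W d'' (d - 1) * psiB S W d' (d'' - 1)) /
      psiB S W d' d

/-- `√H · √(ln (D H √m))` times the maximum of the five `B` terms; `1 / σ⋆` is an absolute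
constant times this. -/
def invSigma (H : ℕ) (γ : ℝ) (S : Fin m → Point D n) (W : Params D n) : ℝ :=
  √(H : ℝ) * √(Real.log (D * H * √(m : ℝ))) *
    max (BLayer S W) (max (BPreact H S W) (max (BOutput H γ S W)
      (max (BJacRow S W) (BJacSpec S W))))

/-- `‖W - Z‖_F² = ∑_d ‖W_d - Z_d‖_F²`. -/
def distSq (W Z : Params D n) : ℝ := ∑ i, frobSq (W i - Z i)

end ReLUNet

end

/-! Compare W with a randomly moved network W' = W + σu, u standard Gaussian. The proof has a
deterministic half and a probabilistic half.

Resilience. The noise in layer e is independent of the layers below it, so tested against a fixed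
Jacobian row a and a vector v built from lower layers it has size about σ|a||v|. `NoiseOK` records
this, and `measure_not_noiseOK_le` shows that it rarely fails. Under `NoiseOK` an induction over the
layers (`closeness`) shows that W and W' have the same gates: while the gates below d agree, the
change of g^d is the sum over e of J^{e+1/d} ΔW_e f'^e, and Jacobians change by a similar sum. The
noise size 1/(64 √H B), with B the maximum of the five terms, keeps these changes well below β, α,
the Jacobian caps and the margin. The induction needs its a priori bounds for only one of the two
networks, so it runs in both directions. Hence thresholds θ exist for the layer norms,
pre-activations and Jacobian rows such that an error of W puts the point in `lossSet (γ / 2) θ W'`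
(`mem_lossSet_of_marginLoss_zero`), while a sample point in that set violates the γ-margin of W
(`marginLoss_of_mem_lossSet`). The generalization gap of W is thus at most the deviation of one set
attached to W' plus the probability of ill-behaved noise (`testError_le_of_noiseOK`).

Deviation. For fixed v, the loss sets of the networks Z + σv with rational σ and θ form a countable
class. For a given activation pattern the monitored quantities are polynomials in σ, so the class
cuts out only (DHm)^{O(D²)} patterns on 2m points (`covers_lossSet`), and the Vapnik–Chervonenkis
inequality applies. By Fubini, on most samples the set of v with a large deviation has Gaussian
measure at most e^{-k}/64, for every k at once. Now W + σu = Z + σ(u + (W - Z)/σ), and translating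
the Gaussian by c inflates tiny events by a factor of order exp(|c|²)
(`StdGauss.measure_translate_le`). With k about |W - Z|²/σ², some u is therefore good in all
respects (`exists_good_noise`).

The pattern count costs D² ln(DH√m). The distance term pays for it unless W lies within the noise
size of Z. In that case W' = Z serves: `NoiseOK` is then Cauchy–Schwarz, and with only θ varying the
count does not involve H. -/

noncomputable section

namespace ReLUNet

open Finset

/-! ### Euclidean norms of vectors and of matrix rows and columns -/

section Norm

variable {k l : ℕ}

lemma l2Norm_eq_sqrt (v : Fin k → ℝ) : l2Norm v = √(∑ i, v i ^ 2) := by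
  simp [l2Norm, EuclideanSpace.norm_eq]

lemma l2Norm_nonneg (v : Fin k → ℝ) : 0 ≤ l2Norm v := norm_nonneg _

lemma l2Norm_sq (v : Fin k → ℝ) : l2Norm v ^ 2 = ∑ i, v i ^ 2 := by
  rw [l2Norm_eq_sqrt, Real.sq_sqrt (by positivity)]

@[simp] lemma l2Norm_zero : l2Norm (0 : Fin k → ℝ) = 0 := by simp [l2Norm_eq_sqrt]

lemma l2Norm_add_le (u v : Fin k → ℝ) : l2Norm (u + v) ≤ l2Norm u + l2Norm v := by
  unfold l2Norm; rw [WithLp.toLp_add]; exact norm_add_le _ _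

lemma l2Norm_neg (v : Fin k → ℝ) : l2Norm (-v) = l2Norm v := by
  simp [l2Norm_eq_sqrt]

lemma l2Norm_sub_rev (u v : Fin k → ℝ) : l2Norm (u - v) = l2Norm (v - u) := by
  rw [← l2Norm_neg, neg_sub]

lemma l2Norm_le_add_sub (u v : Fin k → ℝ) : l2Norm u ≤ l2Norm v + l2Norm (u - v) := by
  simpa using l2Norm_add_le v (u - v)

lemma l2Norm_sum_le {ι : Type*} (s : Finset ι) (f : ι → Fin k → ℝ) :
    l2Norm (∑ i ∈ s, f i) ≤ ∑ i ∈ s, l2Norm (f i) := by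
  classical
  induction s using Finset.induction_on with
  | empty => simp
  | insert a s ha ih =>
    rw [sum_insert ha, sum_insert ha]
    exact (l2Norm_add_le _ _).trans (by gcongr)

lemma l2Norm_le_of_forall_sq_le {v : Fin k → ℝ} {b : ℝ} (hb : 0 ≤ b)
    (h : ∑ i, v i ^ 2 ≤ b ^ 2) : l2Norm v ≤ b := by
  rw [l2Norm_eq_sqrt]; exact Real.sqrt_le_left hb |>.2 h

lemma l2Norm_le_sqrt_mul {v : Fin k → ℝ} {b : ℝ} (hb : 0 ≤ b) (h : ∀ i, |v i| ≤ b) :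
    l2Norm v ≤ √(k : ℝ) * b := by
  refine l2Norm_le_of_forall_sq_le (by positivity) ?_
  rw [mul_pow, Real.sq_sqrt (by positivity)]
  calc ∑ i, v i ^ 2 ≤ ∑ _i : Fin k, b ^ 2 :=
        sum_le_sum fun i _ => sq_le_sq.2 ((h i).trans (le_abs_self b))
    _ = _ := by simp

lemma abs_dotProduct_le (u v : Fin k → ℝ) : |u ⬝ᵥ v| ≤ l2Norm u * l2Norm v := by
  have := abs_real_inner_le_norm (WithLp.toLp 2 u : EuclideanSpace ℝ (Fin k)) (WithLp.toLp 2 v)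
  rw [EuclideanSpace.inner_toLp_toLp] at this
  simpa [l2Norm, dotProduct_comm] using this

/-- Sum of the squared Euclidean norms of the columns equals that of the rows. -/
lemma sum_l2Norm_col_sq (A : Matrix (Fin k) (Fin l) ℝ) :
    ∑ j, l2Norm (fun i => A i j) ^ 2 = ∑ i, l2Norm (A i) ^ 2 := by
  simp only [l2Norm_sq]; exact sum_comm

/-- If every entry of `a ᵥ* (U * A)` is small compared with the norm of the corresponding column
of `A`, then the Euclidean norm is controlled by the Frobenius norm of `A`. -/
lemma l2Norm_le_of_col_bound {A : Matrix (Fin k) (Fin l) ℝ} {v : Fin l → ℝ} {b r : ℝ}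
    (hb : 0 ≤ b) (hr : 0 ≤ r) (hv : ∀ j, |v j| ≤ b * l2Norm (fun i => A i j))
    (hA : ∀ i, l2Norm (A i) ≤ r) : l2Norm v ≤ b * (√(k : ℝ) * r) := by
  refine l2Norm_le_of_forall_sq_le (by positivity) ?_
  calc ∑ j, v j ^ 2 ≤ ∑ j, b ^ 2 * l2Norm (fun i => A i j) ^ 2 := by
        refine sum_le_sum fun j _ => ?_
        rw [← mul_pow]
        exact sq_le_sq.2 ((hv j).trans (le_abs_self _))
    _ = b ^ 2 * ∑ i, l2Norm (A i) ^ 2 := by rw [← mul_sum, sum_l2Norm_col_sq]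
    _ ≤ b ^ 2 * ∑ _i : Fin k, r ^ 2 := by
        gcongr with i; · exact l2Norm_nonneg _
        · exact hA i
    _ = _ := by simp [mul_pow]

end Norm

/-! ### Products of gated weights over any commutative ring (later ℝ and ℝ[X]) -/

section Forward

variable {n : ℕ → ℕ} {R : Type*} [CommRing R]

/-- Product of the gated weight matrices from layer `d'` to layer `d`; it is zero for `d < d'`. -/
def fwd (M : (d : ℕ) → Matrix (Fin (n (d + 1))) (Fin (n d)) R) (a : (d : ℕ) → Fin (n d) → R)
    (d' : ℕ) : (d : ℕ) → Matrix (Fin (n d)) (Fin (n d')) R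
  -- Indices are compared as naturals because the types `Fin (n 0)` and `Fin (n d')` agree only when
  -- d' = 0; this spares all casts.
  | 0 => Matrix.of fun i j => if 0 = d' ∧ (i : ℕ) = j then 1 else 0
  | d + 1 => (Matrix.of fun (i : Fin (n (d + 1))) (j : Fin (n d')) =>
      if d + 1 = d' ∧ (i : ℕ) = j then 1 else 0) +
      M d * Matrix.diagonal (a d) * fwd M a d' d

variable (M M' : (d : ℕ) → Matrix (Fin (n (d + 1))) (Fin (n d)) R)
  (a a' : (d : ℕ) → Fin (n d) → R)

lemma fwd_of_lt {d' d : ℕ} (h : d < d') : fwd M a d' d = 0 := by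
  induction d with
  | zero => ext i j; simp [fwd]; omega
  | succ d ih =>
    rw [fwd, ih (by omega)]
    ext i j; simp; omega

lemma fwd_self (d : ℕ) : fwd M a d d = 1 := by
  cases d with
  | zero => ext i j; simp [fwd, Matrix.one_apply, Fin.ext_iff]
  | succ d =>
    rw [fwd, fwd_of_lt M a (Nat.lt_succ_self d)]
    ext i j; simp [Matrix.one_apply, Fin.ext_iff]

lemma fwd_succ {d' d : ℕ} (h : d' ≤ d) :
    fwd M a d' (d + 1) = M d * Matrix.diagonal (a d) * fwd M a d' d := by
  rw [fwd]
  have : (Matrix.of fun (i : Fin (n (d + 1))) (j : Fin (n d')) =>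
      if d + 1 = d' ∧ (i : ℕ) = j then (1 : R) else 0) = 0 := by
    ext i j; simp; omega
  rw [this, zero_add]

lemma fwd_congr {d' d : ℕ} (h : ∀ e, d' ≤ e → e < d → a e = a' e)
    (hM : ∀ e, d' ≤ e → e < d → M e = M' e) :
    fwd M a d' d = fwd M' a' d' d := by
  induction d with
  | zero => rfl
  | succ d ih =>
    rcases Nat.lt_or_ge d d' with hd | hd
    · simp only [fwd, fwd_of_lt M a hd, fwd_of_lt M' a' hd, Matrix.mul_zero]
    · rw [fwd_succ _ _ hd, fwd_succ _ _ hd, h d hd (by omega), hM d hd (by omega),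
        ih (fun e h1 h2 => h e h1 (by omega)) (fun e h1 h2 => hM e h1 (by omega))]

lemma fwd_map {S : Type*} [CommRing S] (f : R →+* S) (d' d : ℕ) :
    (fwd M a d' d).map f = fwd (fun e => (M e).map f) (fun e i => f (a e i)) d' d := by
  induction d with
  | zero => ext i j; simp [fwd, apply_ite f]
  | succ d ih =>
    have hdiag : (Matrix.diagonal (a d)).map f = Matrix.diagonal fun i => f (a d i) := by
      rw [Matrix.diagonal_map (map_zero f)]
    rw [fwd, fwd, Matrix.map_add _ (map_add f), Matrix.map_mul, Matrix.map_mul, ih, hdiag]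
    congr 1
    ext i j; simp [apply_ite f]

/-- Difference of two products of gated weight matrices with the same gates. -/
lemma fwd_sub_fwd (d' d : ℕ) :
    fwd M' a d' d - fwd M a d' d = ∑ e ∈ range d,
      fwd M a (e + 1) d * ((M' e - M e) * (Matrix.diagonal (a e) * fwd M' a d' e)) := by
  induction d with
  | zero => simp [fwd]
  | succ d ih =>
    have h1 : fwd M' a d' (d + 1) - fwd M a d' (d + 1) =
        M d * Matrix.diagonal (a d) * (fwd M' a d' d - fwd M a d' d) +
          (M' d - M d) * (Matrix.diagonal (a d) * fwd M' a d' d) := by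
      rw [fwd, fwd]
      simp only [Matrix.mul_sub, Matrix.sub_mul, Matrix.mul_assoc]
      abel
    rw [h1, ih, sum_range_succ, fwd_self, Matrix.one_mul, Matrix.mul_sum]
    congr 1
    refine sum_congr rfl fun e he => ?_
    rw [fwd_succ M a (by have := mem_range.1 he; omega), Matrix.mul_assoc, Matrix.mul_assoc,
      Matrix.mul_assoc]

/-- Solution of the gated linear recursion with inhomogeneity `s`. -/
lemma eq_sum_fwd_mulVec (u s : (d : ℕ) → Fin (n d) → R) (N : ℕ) (h0 : u 0 = 0)
    (hu : ∀ d, d < N → u (d + 1) = M d *ᵥ (a d * u d) + s (d + 1)) {d : ℕ} (hd : d ≤ N) :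
    u d = ∑ e ∈ range d, fwd M a (e + 1) d *ᵥ s (e + 1) := by
  induction d with
  | zero => simpa using h0
  | succ d ih =>
    have hdiag : a d * u d = Matrix.diagonal (a d) *ᵥ u d := by
      ext i; simp [Matrix.mulVec_diagonal]
    rw [hu d (by omega), sum_range_succ, fwd_self, Matrix.one_mulVec, hdiag, Matrix.mulVec_mulVec,
      ih (by omega), Matrix.mulVec_sum]
    congr 1
    refine sum_congr rfl fun e he => ?_
    rw [fwd_succ M a (by have := mem_range.1 he; omega), Matrix.mulVec_mulVec]

end Forward

/-! ### The network as a gated linear map -/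

section Net

variable {D : ℕ} {n : ℕ → ℕ}

/-- Gates of the network at the input `x`; the input layer has no gates. -/
def gates (W : Params D n) (x : Fin (n 0) → ℝ) : (d : ℕ) → Fin (n d) → ℝ
  | 0 => 1
  | d + 1 => fun h => if 0 < preAct W x (d + 1) h then 1 else 0

lemma gates_of_pos (W : Params D n) (x : Fin (n 0) → ℝ) {d : ℕ} (hd : 1 ≤ d) :
    gates W x d = fun h => if 0 < preAct W x d h then 1 else 0 := by
  obtain ⟨d, rfl⟩ : ∃ e, d = e + 1 := ⟨d - 1, by omega⟩
  rfl

lemma gates_nonneg (W : Params D n) (x : Fin (n 0) → ℝ) (d : ℕ) (h : Fin (n d)) :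
    0 ≤ gates W x d h := by
  cases d with
  | zero => simp [gates]
  | succ d => simp only [gates]; split_ifs <;> norm_num

lemma gates_le_one (W : Params D n) (x : Fin (n 0) → ℝ) (d : ℕ) (h : Fin (n d)) :
    gates W x d h ≤ 1 := by
  cases d with
  | zero => simp [gates]
  | succ d => simp only [gates]; split_ifs <;> norm_num

lemma layerOut_eq_gates_mul (W : Params D n) (x : Fin (n 0) → ℝ) {d : ℕ} (hd : d < D) :
    layerOut W x d = gates W x d * preAct W x d := by
  cases d with
  | zero => simp [layerOut, preAct, gates]
  | succ d =>
    ext h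
    change (if d + 1 < D then max 0 (preAct W x (d + 1) h) else preAct W x (d + 1) h) =
      (if 0 < preAct W x (d + 1) h then 1 else 0) * preAct W x (d + 1) h
    rw [if_pos hd]
    split_ifs with h1
    · rw [one_mul, max_eq_right h1.le]
    · rw [zero_mul, max_eq_left (not_lt.1 h1)]

lemma layerOut_last (W : Params D n) (x : Fin (n 0) → ℝ) : netOut W x = preAct W x D := by
  unfold netOut
  cases D with
  | zero => rfl
  | succ d => ext h; simp [layerOut, preAct]

lemma preAct_eq_fwd (W : Params D n) (x : Fin (n 0) → ℝ) {d : ℕ} (hd : d ≤ D) :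
    preAct W x d = fwd (weight W) (gates W x) 0 d *ᵥ x := by
  induction d with
  | zero => rw [fwd_self, Matrix.one_mulVec]; rfl
  | succ d ih =>
    have hdiag : gates W x d * preAct W x d = Matrix.diagonal (gates W x d) *ᵥ preAct W x d := by
      ext i; simp [Matrix.mulVec_diagonal]
    rw [fwd_succ _ _ (Nat.zero_le d), preAct, layerOut_eq_gates_mul W x (by omega), hdiag,
      ih (by omega), Matrix.mulVec_mulVec, Matrix.mulVec_mulVec, Matrix.mul_assoc]

lemma jac_eq_fwd (W : Params D n) (x : Fin (n 0) → ℝ) {d' : ℕ} (hd' : 1 ≤ d') (k : ℕ) :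
    jac W x d' k = fwd (weight W) (gates W x) d' (d' + k) := by
  induction k with
  | zero => rw [jac]; exact (fwd_self _ _ _).symm
  | succ k ih =>
    rw [jac, ih]
    have := fwd_succ (weight W) (gates W x) (d' := d') (d := d' + k) (by omega)
    rw [gates_of_pos W x (by omega : 1 ≤ d' + k)] at this
    exact this.symm

end Net

end ReLUNet
end

noncomputable section

namespace ReLUNet

open Finset

/-! ### A self-consistent system of caps for Jacobian rows -/

section RowCap

/-- Upper bounds for the row norms of the Jacobians, obtained from `ρ` by adding the accumulated
effect of weight perturbations of size `s`. -/
def rowCap (ρ : ℕ → ℕ → ℝ) (s : ℝ) (d' d : ℕ) : ℝ :=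
  if _h : d ≤ d' then 1
  else ρ d' d + s * ∑ e : Fin (d - d'), rowCap ρ s (d' + 1 + e) d * rowCap ρ s d' (d' + e)
termination_by d - d'
decreasing_by all_goals (have := e.2; omega)

variable {ρ κ : ℕ → ℕ → ℝ} {s : ℝ}

lemma rowCap_self (d : ℕ) : rowCap ρ s d d = 1 := by rw [rowCap]; simp

lemma rowCap_eq {d' d : ℕ} (h : d' < d) :
    rowCap ρ s d' d = ρ d' d + s * ∑ e ∈ Ico d' d, rowCap ρ s (e + 1) d * rowCap ρ s d' e := by
  rw [rowCap, dif_neg (by omega), sum_Ico_eq_sum_range,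
    Fin.sum_univ_eq_sum_range (fun e => rowCap ρ s (d' + 1 + e) d * rowCap ρ s d' (d' + e))]
  simp only [add_right_comm]

lemma rowCap_nonneg (hρ : ∀ d' d, 0 ≤ ρ d' d) (hs : 0 ≤ s) (d' d : ℕ) : 0 ≤ rowCap ρ s d' d := by
  induction hk : d - d' using Nat.strong_induction_on generalizing d' d with
  | _ k ih =>
    rcases Nat.lt_or_ge d' d with h | h
    · rw [rowCap_eq h]
      refine add_nonneg (hρ _ _) (mul_nonneg hs (sum_nonneg fun e he => ?_))
      have := mem_Ico.1 he
      exact mul_nonneg (ih _ (by omega) _ _ rfl) (ih _ (by omega) _ _ rfl)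
    · rw [rowCap]; simp [h]

lemma le_rowCap (hρ : ∀ d' d, 0 ≤ ρ d' d) (hs : 0 ≤ s) {d' d : ℕ} (h : d' < d) :
    ρ d' d ≤ rowCap ρ s d' d := by
  rw [rowCap_eq h]
  exact le_add_of_nonneg_right (mul_nonneg hs (sum_nonneg fun e _ =>
    mul_nonneg (rowCap_nonneg hρ hs _ _) (rowCap_nonneg hρ hs _ _)))

lemma rowCap_pos (hρ : ∀ d' d, 0 ≤ ρ d' d) (hs : 0 < s) (d' d : ℕ) : 0 < rowCap ρ s d' d := by
  induction hk : d - d' using Nat.strong_induction_on generalizing d' d with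
  | _ k ih =>
    rcases Nat.lt_or_ge d' d with h | h
    · rw [rowCap_eq h]
      refine add_pos_of_nonneg_of_pos (hρ _ _) (mul_pos hs (sum_pos (fun e he => ?_) ⟨d', by simp [h]⟩))
      have := mem_Ico.1 he
      exact mul_pos (ih _ (by omega) _ _ rfl) (ih _ (by omega) _ _ rfl)
    · rw [rowCap]; simp [h]

/-- The perturbation terms, weighted with `κ` on the right, stay below a quarter of `κ`. -/
lemma sum_rowCap_mul_le {D : ℕ} (hρ : ∀ d' d, 0 ≤ ρ d' d) (hs : 0 ≤ s)
    (hB : ∀ d' d, 1 ≤ d' → d' < d → d ≤ D →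
      s * (κ d' (d - 1) + ∑ e ∈ Ico d' (d - 1), ρ (e + 1) d * κ d' e) ≤ κ d' d / 8)
    {d' d : ℕ} (hd' : 1 ≤ d') (hdd : d' < d) (hd : d ≤ D) (hκ : ∀ d, 0 ≤ κ d' d) :
    s * ∑ e ∈ Ico d' d, rowCap ρ s (e + 1) d * κ d' e ≤ κ d' d / 4 := by
  induction d using Nat.strong_induction_on with
  | _ d ih =>
    set X := s * ∑ e ∈ Ico d' d, rowCap ρ s (e + 1) d * κ d' e with hX
    obtain ⟨k, rfl⟩ : ∃ k, d = k + 1 := ⟨d - 1, by omega⟩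
    -- Unfold each cap R(e+1, d) once and exchange the sums. Writing X_d for the quantity to bound,
    -- X_d = s(κ(d', d-1) + Σ ρκ) + s Σ_f R(f+1, d) X_f, where the bare κ(d', d-1) comes from the
    -- cap R(d, d) = 1. Inserting X_f ≤ κ/4 gives X ≤ κ/8 + X/4.
    have h1 : X = s * (κ d' k + ∑ e ∈ Ico d' k, ρ (e + 1) (k + 1) * κ d' e) +
        s * ∑ f ∈ Ico d' (k + 1), rowCap ρ s (f + 1) (k + 1) *
          (s * ∑ e ∈ Ico d' f, rowCap ρ s (e + 1) f * κ d' e) := by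
      have h2 : ∑ f ∈ Ico d' (k + 1), rowCap ρ s (f + 1) (k + 1) *
            (s * ∑ e ∈ Ico d' f, rowCap ρ s (e + 1) f * κ d' e) =
          ∑ e ∈ Ico d' k, (s * ∑ f ∈ Ico (e + 1) (k + 1),
            rowCap ρ s (f + 1) (k + 1) * rowCap ρ s (e + 1) f) * κ d' e := by
        have h3 := sum_Ico_Ico_comm' d' (k + 1) fun e f =>
          s * (rowCap ρ s (f + 1) (k + 1) * rowCap ρ s (e + 1) f * κ d' e)
        rw [sum_Ico_succ_top (by omega : d' ≤ k)] at h3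
        simp only [Ico_self, sum_empty, add_zero] at h3
        calc _ = ∑ f ∈ Ico d' (k + 1), ∑ e ∈ Ico d' f,
              s * (rowCap ρ s (f + 1) (k + 1) * rowCap ρ s (e + 1) f * κ d' e) := by
              refine sum_congr rfl fun f _ => ?_
              rw [mul_sum, mul_sum]
              exact sum_congr rfl fun e _ => by ring
          _ = _ := by
              rw [← h3]
              refine sum_congr rfl fun e _ => ?_
              rw [mul_sum, sum_mul]
              exact sum_congr rfl fun f _ => by ring
      rw [h2, hX, sum_Ico_succ_top (by omega : d' ≤ k), rowCap_self, ← mul_add, one_mul]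
      congr 1
      rw [add_comm, add_assoc, ← sum_add_distrib]
      congr 1
      refine sum_congr rfl fun e he => ?_
      have := mem_Ico.1 he
      rw [rowCap_eq (by omega : e + 1 < k + 1)]
      ring
    have h4 : s * ∑ f ∈ Ico d' (k + 1), rowCap ρ s (f + 1) (k + 1) *
          (s * ∑ e ∈ Ico d' f, rowCap ρ s (e + 1) f * κ d' e) ≤ X / 4 := by
      rw [hX, mul_div_assoc, sum_div]
      gcongr with f hf
      have := mem_Ico.1 hf
      rw [mul_div_assoc]
      refine mul_le_mul_of_nonneg_left ?_ (rowCap_nonneg hρ hs _ _)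
      rcases this.1.eq_or_lt with h | h
      · subst h; simpa using div_nonneg (hκ d') (by norm_num)
      · exact ih f (by omega) h (by omega)
    have h5 := hB d' (k + 1) hd' hdd hd
    simp only [Nat.add_sub_cancel] at h5
    have := hκ (k + 1)
    linarith

/-- By induction the caps R(d', e) inside the recursion are at most 2κ, so the added term is at most
twice the quantity of `sum_rowCap_mul_le`, that is κ/2. -/
lemma rowCap_le {D : ℕ} (hρ : ∀ d' d, 0 ≤ ρ d' d) (hs : 0 ≤ s)
    (hB : ∀ d' d, 1 ≤ d' → d' < d → d ≤ D →
      s * (κ d' (d - 1) + ∑ e ∈ Ico d' (d - 1), ρ (e + 1) d * κ d' e) ≤ κ d' d / 8)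
    (hρκ : ∀ d' d, ρ d' d ≤ κ d' d) (hκ : ∀ d' d, 1 ≤ κ d' d)
    {d' d : ℕ} (hd' : 1 ≤ d') (hdd : d' ≤ d) (hd : d ≤ D) :
    rowCap ρ s d' d ≤ 2 * κ d' d := by
  induction d using Nat.strong_induction_on with
  | _ d ih =>
    rcases hdd.eq_or_lt with h | h
    · subst h; rw [rowCap_self]; linarith [hκ d' d']
    · have h1 := sum_rowCap_mul_le hρ hs hB hd' h hd fun d => zero_le_one.trans (hκ d' d)
      rw [rowCap_eq h]
      have h2 : s * ∑ e ∈ Ico d' d, rowCap ρ s (e + 1) d * rowCap ρ s d' e ≤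
          2 * (s * ∑ e ∈ Ico d' d, rowCap ρ s (e + 1) d * κ d' e) := by
        rw [mul_left_comm, Finset.mul_sum _ _ (2 : ℝ)]
        refine mul_le_mul_of_nonneg_left (sum_le_sum fun e he => ?_) hs
        have := mem_Ico.1 he
        calc _ ≤ rowCap ρ s (e + 1) d * (2 * κ d' e) :=
              mul_le_mul_of_nonneg_left (ih e (by omega) this.1 (by omega))
                (rowCap_nonneg hρ hs _ _)
          _ = _ := by ring
      linarith [hρκ d' d, hκ d' d]

end RowCap

/-! ### Deterministic resilience of the network to well-behaved noise -/

section Perturbation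

variable {D : ℕ} {n : ℕ → ℕ}

/-- The perturbation `W' - W` acts on the relevant vectors as noise of size `ω` at the input `x`. -/
def NoiseOK (ω : ℝ) (W W' : Params D n) (x : Fin (n 0) → ℝ) : Prop :=
  ∀ e < D, ∀ d, e + 1 ≤ d → d ≤ D → ∀ h : Fin (n d),
    |fwd (weight W) (gates W x) (e + 1) d h ⬝ᵥ
        ((weight W' e - weight W e) *ᵥ layerOut W' x e)| ≤
      ω * (l2Norm (fwd (weight W) (gates W x) (e + 1) d h) * l2Norm (layerOut W' x e)) ∧
    ∀ d', 1 ≤ d' → d' ≤ e → ∀ j : Fin (n d'),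
      |fwd (weight W) (gates W x) (e + 1) d h ⬝ᵥ ((weight W' e - weight W e) *ᵥ
          fun i => (Matrix.diagonal (gates W x e) * fwd (weight W') (gates W x) d' e) i j)| ≤
        ω * (l2Norm (fwd (weight W) (gates W x) (e + 1) d h) *
          l2Norm fun i => (Matrix.diagonal (gates W x e) * fwd (weight W') (gates W x) d' e) i j)

/-- Bound for the change of the rows of the Jacobian. -/
def rowErr (ω : ℝ) (H : ℕ) (R : ℕ → ℕ → ℝ) (d' d : ℕ) : ℝ :=
  2 * ω * √(H : ℝ) * ∑ e ∈ Ico d' d, R (e + 1) d * R d' e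

lemma l2Norm_diagonal_mul_row_le {k l : ℕ} (g : Fin k → ℝ) (hg0 : ∀ i, 0 ≤ g i)
    (hg1 : ∀ i, g i ≤ 1) (A : Matrix (Fin k) (Fin l) ℝ) (i : Fin k) :
    l2Norm ((Matrix.diagonal g * A) i) ≤ l2Norm (A i) := by
  refine l2Norm_le_of_forall_sq_le (l2Norm_nonneg _) ?_
  rw [l2Norm_sq]
  refine sum_le_sum fun j _ => ?_
  rw [Matrix.diagonal_mul, mul_pow]
  exact mul_le_of_le_one_left (sq_nonneg _) (pow_le_one₀ (hg0 i) (hg1 i))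

lemma l2Norm_gates_mul_le (W : Params D n) (x : Fin (n 0) → ℝ) (d : ℕ) (v : Fin (n d) → ℝ) :
    l2Norm (gates W x d * v) ≤ l2Norm v := by
  refine l2Norm_le_of_forall_sq_le (l2Norm_nonneg _) ?_
  rw [l2Norm_sq]
  refine sum_le_sum fun j _ => ?_
  rw [Pi.mul_apply, mul_pow]
  exact mul_le_of_le_one_left (sq_nonneg _) (pow_le_one₀ (gates_nonneg W x d j) (gates_le_one W x d j))

/-- Telescoping over the layers expresses the change through rows of W, the noise, and gated
products of W'. The noise acts on each column of such a product, and `l2Norm_le_of_col_bound`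
reassembles the columns: at most H rows of norm 2R cost the factor √H · 2R. -/
lemma row_diff_le {H : ℕ} (hH : ∀ d, 1 ≤ d → d < D → n d = H) {ω : ℝ} (hω : 0 ≤ ω)
    {W W' : Params D n} {x : Fin (n 0) → ℝ} (hN : NoiseOK ω W W' x) {R : ℕ → ℕ → ℝ}
    (hR : ∀ d' d, 0 ≤ R d' d) {d' d : ℕ} (hd' : 1 ≤ d') (hd : d ≤ D)
    (h : Fin (n d))
    (h1 : ∀ e, d' ≤ e → e < d → l2Norm (fwd (weight W) (gates W x) (e + 1) d h) ≤ R (e + 1) d)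
    (h2 : ∀ e, d' ≤ e → e < d → ∀ i,
      l2Norm (fwd (weight W') (gates W x) d' e i) ≤ 2 * R d' e) :
    l2Norm (fwd (weight W') (gates W x) d' d h - fwd (weight W) (gates W x) d' d h) ≤
      rowErr ω H R d' d := by
  have hsub : fwd (weight W') (gates W x) d' d h - fwd (weight W) (gates W x) d' d h =
      ∑ e ∈ range d, fun j => fwd (weight W) (gates W x) (e + 1) d h ⬝ᵥ
        ((weight W' e - weight W e) *ᵥ
          fun i => (Matrix.diagonal (gates W x e) * fwd (weight W') (gates W x) d' e) i j) := by
    ext j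
    have := congrFun (congrFun (fwd_sub_fwd (weight W) (weight W') (gates W x) d' d) h) j
    rw [Matrix.sub_apply, Matrix.sum_apply] at this
    rw [Pi.sub_apply, this, Finset.sum_apply]
    rfl
  rw [hsub]
  refine (l2Norm_sum_le _ _).trans ?_
  have hsplit : ∑ e ∈ range d, l2Norm (fun j => fwd (weight W) (gates W x) (e + 1) d h ⬝ᵥ
        ((weight W' e - weight W e) *ᵥ
          fun i => (Matrix.diagonal (gates W x e) * fwd (weight W') (gates W x) d' e) i j)) =
      ∑ e ∈ Ico d' d, l2Norm (fun j => fwd (weight W) (gates W x) (e + 1) d h ⬝ᵥ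
        ((weight W' e - weight W e) *ᵥ
          fun i => (Matrix.diagonal (gates W x e) * fwd (weight W') (gates W x) d' e) i j)) := by
    -- Layers e < d' contribute nothing, since `fwd` vanishes there.
    symm
    refine sum_subset (fun e he => by simp at he ⊢; omega) fun e he hne => ?_
    have : e < d' := by simp at he hne; omega
    simp only [fwd_of_lt (weight W') (gates W x) this, Matrix.mul_zero, Matrix.zero_apply]
    convert l2Norm_zero using 2
    ext j
    change _ ⬝ᵥ (_ *ᵥ 0) = (0 : ℝ)
    simp
  rw [hsplit, rowErr, mul_sum]
  refine sum_le_sum fun e he => ?_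
  have he' := mem_Ico.1 he
  have hb := l2Norm_le_of_col_bound (A := Matrix.diagonal (gates W x e) *
    fwd (weight W') (gates W x) d' e) (v := fun j => fwd (weight W) (gates W x) (e + 1) d h ⬝ᵥ
        ((weight W' e - weight W e) *ᵥ
          fun i => (Matrix.diagonal (gates W x e) * fwd (weight W') (gates W x) d' e) i j))
    (b := ω * l2Norm (fwd (weight W) (gates W x) (e + 1) d h)) (r := 2 * R d' e)
    (mul_nonneg hω (l2Norm_nonneg _)) (by have := hR d' e; positivity)
    (fun j => by
      rw [mul_assoc]
      exact (hN e (by omega) d (by omega) hd h).2 d' hd' he'.1 j)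
    (fun i => (l2Norm_diagonal_mul_row_le _ (gates_nonneg W x e) (gates_le_one W x e) _ i).trans
      (h2 e he'.1 he'.2 i))
  refine hb.trans ?_
  have hn : (n e : ℝ) = H := by rw [hH e (by omega) (by omega)]
  rw [hn]
  have h3 := h1 e he'.1 he'.2
  have h4 := hR d' e
  calc _ ≤ ω * R (e + 1) d * (√(H : ℝ) * (2 * R d' e)) := by gcongr
    _ = _ := by ring

/-- With equal gates below d, the difference of pre-activations obeys the gated linear recursion of
W with source ΔW_e f'^e. Unlike the Jacobian estimate, this involves single vectors and no factor
√H. -/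
lemma preAct_diff_le {ω : ℝ} (hω : 0 ≤ ω)
    {W W' : Params D n} {x : Fin (n 0) → ℝ} (hN : NoiseOK ω W W' x) {R : ℕ → ℕ → ℝ} {α : ℕ → ℝ}
    {d : ℕ} (hd : d ≤ D) (h : Fin (n d))
    (h0 : ∀ e, e < d → layerOut W' x e - layerOut W x e =
      gates W x e * (preAct W' x e - preAct W x e))
    (h1 : ∀ e, e < d → l2Norm (fwd (weight W) (gates W x) (e + 1) d h) ≤ R (e + 1) d)
    (h2 : ∀ e, e < d → l2Norm (layerOut W' x e) ≤ 3 * α e) :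
    |preAct W' x d h - preAct W x d h| ≤ ω * ∑ e ∈ range d, R (e + 1) d * (3 * α e) := by
  have key := eq_sum_fwd_mulVec (weight W) (gates W x) (fun e => preAct W' x e - preAct W x e)
    -- The source is indexed by the layer it feeds; its value at 0 plays no role.
    (fun e => match e with
      | 0 => 0
      | e + 1 => (weight W' e - weight W e) *ᵥ layerOut W' x e) d (by simp [preAct])
    (fun e he => by
      change weight W' e *ᵥ layerOut W' x e - weight W e *ᵥ layerOut W x e = _
      change _ = _ + (weight W' e - weight W e) *ᵥ layerOut W' x e
      rw [← h0 e he, Matrix.mulVec_sub, Matrix.sub_mulVec]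
      abel) le_rfl
  have := congrFun key h
  simp only [Pi.sub_apply, Finset.sum_apply] at this
  rw [this, mul_sum]
  refine (abs_sum_le_sum_abs _ _).trans (sum_le_sum fun e he => ?_)
  have he' := mem_range.1 he
  refine ((hN e (by omega) d (by omega) hd h).1).trans ?_
  have h3 := h1 e he'
  have h4 := h2 e he'
  have h5 := l2Norm_nonneg (layerOut W' x e)
  have h6 := (l2Norm_nonneg _).trans h3
  gcongr

/-- Numerical compatibility of the caps `R` (Jacobian rows), `α` (layer outputs), `β`
(pre-activations) with the noise size `ω` and the resulting pre-activation changes `E`. -/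
structure Budget (D H : ℕ) (ω : ℝ) (R : ℕ → ℕ → ℝ) (α β E : ℕ → ℝ) : Prop where
  noise_nonneg : 0 ≤ ω
  cap_nonneg : ∀ d' d, 0 ≤ R d' d
  cap_self : ∀ d, R d d = 1
  rowErr_le : ∀ d' d, 1 ≤ d' → d' < d → d ≤ D → rowErr ω H R d' d ≤ R d' d
  sum_le : ∀ d ≤ D, ω * ∑ e ∈ range d, R (e + 1) d * (3 * α e) ≤ E d
  preact : ∀ d, 1 ≤ d → d < D → 8 * E d ≤ β d
  layer : ∀ d, 1 ≤ d → d < D → 8 * (√(H : ℝ) * E d) ≤ α d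
  preact_pos : ∀ d, 1 ≤ d → d < D → 0 < β d
  layer_nonneg : ∀ d, 0 ≤ α d

/-- A number larger in absolute value than its displacement keeps its sign; it does not matter on
which side of the displacement the size is known. -/
lemma gates_eq_of_abs_sub_le {W W' : Params D n} {x : Fin (n 0) → ℝ} {d : ℕ} (hd : 1 ≤ d)
    {ε : ℝ} (h : ∀ i, |preAct W' x d i - preAct W x d i| ≤ ε)
    (h' : ∀ i, ε < |preAct W x d i| ∨ ε < |preAct W' x d i|) : gates W' x d = gates W x d := by
  rw [gates_of_pos _ _ hd, gates_of_pos _ _ hd]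
  ext i
  have h1 := abs_le.1 (h i)
  have : (0 < preAct W' x d i) ↔ 0 < preAct W x d i := by
    rcases h' i with h2 | h2 <;> rcases lt_abs.1 h2 with h3 | h3 <;> constructor <;> intro <;>
      linarith
  simp only [this]

/-- Descending induction on d' at fixed d: the change of row (d', d) involves only rows (e+1, d) of
W with e ≥ d'. If only the row of W' is capped, the slack `rowErr` in that cap transfers it to W by
the triangle inequality. -/
lemma closeness_row {H : ℕ} (hH : ∀ d, 1 ≤ d → d < D → n d = H) {ω : ℝ} {R : ℕ → ℕ → ℝ}
    {α β E : ℕ → ℝ} (hb : Budget D H ω R α β E) {W W' : Params D n} {x : Fin (n 0) → ℝ}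
    (hN : NoiseOK ω W W' x) {d : ℕ} (hd : d ≤ D)
    (hgate : ∀ e, e < d → gates W' x e = gates W x e)
    (hJ : ∀ d', 1 ≤ d' → d' < d → ∀ h : Fin (n d),
      l2Norm (fwd (weight W) (gates W x) d' d h) ≤ R d' d ∨
      l2Norm (fwd (weight W') (gates W' x) d' d h) ≤ R d' d - rowErr ω H R d' d)
    (hprev : ∀ e, e < d → ∀ d', 1 ≤ d' → d' ≤ e → ∀ i,
      l2Norm (fwd (weight W') (gates W x) d' e i) ≤ 2 * R d' e) {d' : ℕ} (hd' : 1 ≤ d')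
    (hdd : d' ≤ d) (h : Fin (n d)) :
    l2Norm (fwd (weight W) (gates W x) d' d h) ≤ R d' d ∧ (d' < d →
      l2Norm (fwd (weight W') (gates W x) d' d h - fwd (weight W) (gates W x) d' d h) ≤
      rowErr ω H R d' d) := by
  induction hk : d - d' using Nat.strong_induction_on generalizing d' with
  | _ k ih =>
    rcases hdd.eq_or_lt with heq | hlt
    · subst heq
      refine ⟨?_, fun h => absurd h (lt_irrefl _)⟩
      rw [fwd_self, hb.cap_self]
      refine l2Norm_le_of_forall_sq_le zero_le_one ?_
      simp [Matrix.one_apply]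
    · have hdiff := row_diff_le hH hb.noise_nonneg hN hb.cap_nonneg hd' hd h
        (fun e he1 he2 => (ih (d - (e + 1)) (by omega) (by omega) (by omega) rfl).1)
        (fun e he1 he2 i => hprev e he2 d' hd' he1 i)
      refine ⟨?_, fun _ => hdiff⟩
      rcases hJ d' hd' hlt h with h1 | h1
      · exact h1
      · rw [fwd_congr _ (weight W') _ (gates W x) (fun e _ he => hgate e he) (fun _ _ _ => rfl)]
          at h1
        have := l2Norm_le_add_sub (fwd (weight W) (gates W x) d' d h)
          (fwd (weight W') (gates W x) d' d h)
        rw [l2Norm_sub_rev (fwd (weight W) (gates W x) d' d h)] at this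
        linarith

/-- Induction over layers: equal gates below d make the changes at layer d linear and small, and
small changes preserve the gates at d. Each a priori bound is a disjunction because on the sample it
is known for W, whereas at a fresh point it is known only for W', with constants tightened by one
perturbation. -/
theorem closeness {H : ℕ} (hH : ∀ d, 1 ≤ d → d < D → n d = H) {ω : ℝ} {R : ℕ → ℕ → ℝ}
    {α β E : ℕ → ℝ} (hb : Budget D H ω R α β E) {W W' : Params D n} {x : Fin (n 0) → ℝ}
    (hN : NoiseOK ω W W' x)
    (hJ : ∀ d' d, 1 ≤ d' → d' < d → d ≤ D → ∀ h : Fin (n d),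
      l2Norm (fwd (weight W) (gates W x) d' d h) ≤ R d' d ∨
      l2Norm (fwd (weight W') (gates W' x) d' d h) ≤ R d' d - rowErr ω H R d' d)
    (hf : ∀ d < D, l2Norm (layerOut W x d) ≤ 2 * α d ∨ l2Norm (layerOut W' x d) ≤ 15 / 8 * α d)
    (hg : ∀ d, 1 ≤ d → d < D → ∀ h, β d / 2 ≤ |preAct W x d h| ∨
      5 / 8 * β d ≤ |preAct W' x d h|) {d : ℕ} (hd : d ≤ D) :
    (∀ d', 1 ≤ d' → d' < d → ∀ h,
      l2Norm (fwd (weight W') (gates W' x) d' d h - fwd (weight W) (gates W x) d' d h) ≤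
        rowErr ω H R d' d) ∧
    (∀ d', 1 ≤ d' → d' ≤ d → ∀ h, l2Norm (fwd (weight W') (gates W x) d' d h) ≤ 2 * R d' d) ∧
    (∀ h, |preAct W' x d h - preAct W x d h| ≤ E d) ∧
    (d < D → gates W' x d = gates W x d ∧
      layerOut W' x d - layerOut W x d = gates W x d * (preAct W' x d - preAct W x d) ∧
      l2Norm (layerOut W' x d) ≤ 3 * α d ∧
      l2Norm (layerOut W' x d - layerOut W x d) ≤ α d / 8) := by
  induction d using Nat.strong_induction_on with
  | _ d ih =>
    have hgate : ∀ e, e < d → gates W' x e = gates W x e := fun e he =>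
      ((ih e he (by omega)).2.2.2 (by omega)).1
    have hrow := fun (d' : ℕ) (h1 : 1 ≤ d') (h2 : d' ≤ d) (h : Fin (n d)) =>
      closeness_row hH hb hN hd hgate (fun d' h1 h2 h => hJ d' d h1 h2 hd h)
        (fun e he d' h1 h2 i => (ih e he (by omega)).2.1 d' h1 h2 i) h1 h2 h
    have hpre : ∀ h, |preAct W' x d h - preAct W x d h| ≤ E d := fun h =>
      (preAct_diff_le (R := R) (α := α) hb.noise_nonneg hN hd h
        (fun e he => ((ih e he (by omega)).2.2.2 (by omega)).2.1)
        (fun e he => (hrow (e + 1) (by omega) (by omega) h).1)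
        (fun e he => ((ih e he (by omega)).2.2.2 (by omega)).2.2.1)).trans (hb.sum_le d hd)
    refine ⟨fun d' h1 h2 h => ?_, fun d' h1 h2 h => ?_, hpre, fun hdD => ?_⟩
    · rw [fwd_congr _ (weight W') _ (gates W x) (fun e _ he => hgate e he) (fun _ _ _ => rfl)]
      exact (hrow d' h1 h2.le h).2 h2
    · rcases h2.eq_or_lt with heq | hlt
      · subst heq
        have := (hrow d' h1 le_rfl h).1
        rw [fwd_self] at this ⊢
        linarith [hb.cap_nonneg d' d']
      · have h3 := hrow d' h1 h2 h
        have h4 := l2Norm_le_add_sub (fwd (weight W') (gates W x) d' d h)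
          (fwd (weight W) (gates W x) d' d h)
        linarith [hb.rowErr_le d' d h1 hlt hd, h3.1, h3.2 hlt]
    · rcases Nat.eq_zero_or_pos d with h0 | hpos
      · subst h0
        refine ⟨rfl, by simp [layerOut, preAct], ?_, ?_⟩
        · change l2Norm x ≤ _
          have h1 : l2Norm x ≤ 2 * α 0 ∨ l2Norm x ≤ 15 / 8 * α 0 := hf 0 hdD
          have := hb.layer_nonneg 0
          rcases h1 with h1 | h1 <;> linarith
        · have := hb.layer_nonneg 0
          simp only [layerOut, sub_self, l2Norm_zero]
          positivity
      · have hβ := hb.preact_pos d hpos hdD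
        have hE := hb.preact d hpos hdD
        have hg' : gates W' x d = gates W x d := gates_eq_of_abs_sub_le hpos hpre fun i => by
          rcases hg d hpos hdD i with h1 | h1
          · left; linarith
          · right; linarith
        have hdf : layerOut W' x d - layerOut W x d =
            gates W x d * (preAct W' x d - preAct W x d) := by
          rw [layerOut_eq_gates_mul _ _ hdD, layerOut_eq_gates_mul _ _ hdD, hg', mul_sub]
        have hdn : l2Norm (layerOut W' x d - layerOut W x d) ≤ α d / 8 := by
          rw [hdf]
          refine (l2Norm_gates_mul_le _ _ _ _).trans ?_
          rcases isEmpty_or_nonempty (Fin (n d)) with hemp | ⟨⟨i⟩⟩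
          · rw [l2Norm_eq_sqrt]
            simpa using div_nonneg (hb.layer_nonneg d) (by norm_num)
          · have h1 := l2Norm_le_sqrt_mul ((abs_nonneg _).trans (hpre i)) hpre
            have hn : (n d : ℝ) = H := by rw [hH d hpos hdD]
            rw [hn] at h1
            have h2 := hb.layer d hpos hdD
            have h3 : l2Norm (preAct W' x d - preAct W x d) ≤ √(H : ℝ) * E d := h1
            linarith
        refine ⟨hg', hdf, ?_, hdn⟩
        have h1 := l2Norm_le_add_sub (layerOut W' x d) (layerOut W x d)
        have := hb.layer_nonneg d
        rcases hf d hdD with h2 | h2 <;> linarith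

end Perturbation

end ReLUNet
end

noncomputable section

namespace ReLUNet

open Finset

/-! ### Row norms and spectral norms -/

section MatrixNorm

variable {k l j : ℕ}

lemma le_ciSup_finite {ι : Type*} [Finite ι] (f : ι → ℝ) (i : ι) : f i ≤ ⨆ i, f i :=
  le_ciSup (Set.finite_range f).bddAbove i

lemma l2Norm_row_le_rowNorm (A : Matrix (Fin k) (Fin l) ℝ) (h : Fin k) :
    l2Norm (A h) ≤ rowNorm A :=
  le_ciSup_finite (fun h => l2Norm (A h)) h

lemma rowNorm_nonneg (A : Matrix (Fin k) (Fin l) ℝ) : 0 ≤ rowNorm A :=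
  Real.iSup_nonneg fun _ => l2Norm_nonneg _

lemma specNorm_nonneg (A : Matrix (Fin k) (Fin l) ℝ) : 0 ≤ specNorm A := norm_nonneg _

lemma l2Norm_mulVec_le (A : Matrix (Fin k) (Fin l) ℝ) (v : Fin l → ℝ) :
    l2Norm (A *ᵥ v) ≤ specNorm A * l2Norm v := by
  have := (Matrix.toEuclideanLin A).toContinuousLinearMap.le_opNorm (WithLp.toLp 2 v)
  simpa [l2Norm, specNorm, Matrix.toLpLin_toLp] using this

/-- From |aA|² = a · A(aA), so the spectral norm of the transpose is not needed. -/
lemma l2Norm_vecMul_le (a : Fin k → ℝ) (A : Matrix (Fin k) (Fin l) ℝ) :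
    l2Norm (a ᵥ* A) ≤ l2Norm a * specNorm A := by
  have h1 : l2Norm (a ᵥ* A) ^ 2 ≤ l2Norm a * specNorm A * l2Norm (a ᵥ* A) := by
    calc l2Norm (a ᵥ* A) ^ 2 = (a ᵥ* A) ⬝ᵥ (a ᵥ* A) := by
          rw [l2Norm_sq]; simp [dotProduct, sq]
      _ = a ⬝ᵥ (A *ᵥ (a ᵥ* A)) := by rw [Matrix.dotProduct_mulVec]
      _ ≤ l2Norm a * l2Norm (A *ᵥ (a ᵥ* A)) := (le_abs_self _).trans (abs_dotProduct_le _ _)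
      _ ≤ l2Norm a * (specNorm A * l2Norm (a ᵥ* A)) :=
          mul_le_mul_of_nonneg_left (l2Norm_mulVec_le _ _) (l2Norm_nonneg _)
      _ = _ := by ring
  rcases (l2Norm_nonneg (a ᵥ* A)).eq_or_lt with h | h
  · rw [← h]; exact mul_nonneg (l2Norm_nonneg _) (specNorm_nonneg _)
  · nlinarith

lemma rowNorm_mul_diagonal_mul_le (B : Matrix (Fin k) (Fin l) ℝ) (g : Fin l → ℝ)
    (hg0 : ∀ i, 0 ≤ g i) (hg1 : ∀ i, g i ≤ 1) (A : Matrix (Fin l) (Fin j) ℝ) :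
    rowNorm (B * Matrix.diagonal g * A) ≤ rowNorm B * specNorm A := by
  refine Real.iSup_le (fun h => ?_) (mul_nonneg (rowNorm_nonneg _) (specNorm_nonneg _))
  have h1 : (B * Matrix.diagonal g * A) h = (B * Matrix.diagonal g) h ᵥ* A := rfl
  rw [h1]
  refine (l2Norm_vecMul_le _ _).trans (mul_le_mul_of_nonneg_right ?_ (specNorm_nonneg _))
  refine le_trans ?_ (l2Norm_row_le_rowNorm B h)
  refine l2Norm_le_of_forall_sq_le (l2Norm_nonneg _) ?_
  rw [l2Norm_sq]
  refine sum_le_sum fun i _ => ?_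
  rw [Matrix.mul_diagonal, mul_pow]
  exact mul_le_of_le_one_right (sq_nonneg _) (pow_le_one₀ (hg0 i) (hg1 i))

end MatrixNorm

/-! ### Sample quantities and the size of tolerable noise -/

section Sample

variable {D m : ℕ} {n : ℕ → ℕ} (S : Fin m → Point D n) (W : Params D n)

/-- Largest row norm of the Jacobian over the sample. -/
def rhoB (d' d : ℕ) : ℝ := ⨆ i : Fin m, rowNorm (jac W (S i).1 d' (d - d'))

lemma rhoB_nonneg (d' d : ℕ) : 0 ≤ rhoB S W d' d := Real.iSup_nonneg fun _ => rowNorm_nonneg _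

lemma rhoB_le_kappaB (d' d : ℕ) : rhoB S W d' d ≤ kappaB S W d' d := le_max_left _ _

lemma one_le_kappaB (d' d : ℕ) : 1 ≤ kappaB S W d' d := le_max_right _ _

lemma one_le_alphaB (d : ℕ) : 1 ≤ alphaB S W d := le_max_right _ _

lemma one_le_psiB (d' d : ℕ) : 1 ≤ psiB S W d' d := le_max_right _ _

/-- `jac` lives at layer d' + (d - d') and `fwd` at layer d; the arbitrary F carries any norm across
this equality of indices without casts. -/
lemma jac_sub_eq (x : Fin (n 0) → ℝ) {d' d : ℕ} (hd' : 1 ≤ d') (h : d' ≤ d)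
    {β : Type*} (F : (d : ℕ) → Matrix (Fin (n d)) (Fin (n d')) ℝ → β) :
    F (d' + (d - d')) (jac W x d' (d - d')) = F d (fwd (weight W) (gates W x) d' d) := by
  obtain ⟨k, rfl⟩ : ∃ k, d = d' + k := ⟨d - d', by omega⟩
  rw [Nat.add_sub_cancel_left, jac_eq_fwd W x hd']

lemma rowNorm_jac_eq (x : Fin (n 0) → ℝ) {d' d : ℕ} (hd' : 1 ≤ d') (h : d' ≤ d) :
    rowNorm (jac W x d' (d - d')) = rowNorm (fwd (weight W) (gates W x) d' d) :=
  jac_sub_eq W x hd' h fun _ A => rowNorm A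

lemma specNorm_jac_eq (x : Fin (n 0) → ℝ) {d' d : ℕ} (hd' : 1 ≤ d') (h : d' ≤ d) :
    specNorm (jac W x d' (d - d')) = specNorm (fwd (weight W) (gates W x) d' d) :=
  jac_sub_eq W x hd' h fun _ A => specNorm A

lemma l2Norm_fwd_le_rhoB (i : Fin m) {d' d : ℕ} (hd' : 1 ≤ d') (h : d' ≤ d) (j : Fin (n d)) :
    l2Norm (fwd (weight W) (gates W (S i).1) d' d j) ≤ rhoB S W d' d := by
  refine (l2Norm_row_le_rowNorm _ j).trans ?_
  rw [← rowNorm_jac_eq W _ hd' h]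
  exact le_ciSup_finite (fun i => rowNorm (jac W (S i).1 d' (d - d'))) i

lemma l2Norm_layerOut_le_alphaB (i : Fin m) (d : ℕ) :
    l2Norm (layerOut W (S i).1 d) ≤ alphaB S W d :=
  (le_ciSup_finite (fun i => l2Norm (layerOut W (S i).1 d)) i).trans (le_max_left _ _)

lemma betaB_le (i : Fin m) (d : ℕ) (h : Fin (n d)) : betaB S W d ≤ |preAct W (S i).1 d h| :=
  (ciInf_le (Set.finite_range _).bddBelow i).trans (ciInf_le (Set.finite_range _).bddBelow h)

/-- Splits off the last layer of the Jacobian. The analogue for `kappaB` could fail, because of its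
maximum with 1; hence the caps start from `rhoB`. -/
lemma rhoB_le_mul {d' d : ℕ} (hd' : 1 ≤ d') (h : d' ≤ d) :
    rhoB S W d' (d + 1) ≤ rowNorm (weight W d) * psiB S W d' d := by
  refine Real.iSup_le (fun i => ?_)
    (mul_nonneg (rowNorm_nonneg _) (zero_le_one.trans (one_le_psiB S W _ _)))
  rw [rowNorm_jac_eq W _ hd' (by omega), fwd_succ _ _ h]
  refine (rowNorm_mul_diagonal_mul_le _ _ (gates_nonneg _ _ _) (gates_le_one _ _ _) _).trans
    (mul_le_mul_of_nonneg_left ?_ (rowNorm_nonneg _))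
  rw [← specNorm_jac_eq W _ hd' h]
  exact (le_ciSup_finite (fun i => specNorm (jac W (S i).1 d' (d - d'))) i).trans (le_max_left _ _)

lemma propSum_eq (d : ℕ) :
    propSum S W d = ∑ e ∈ range d, kappaB S W (e + 1) d * alphaB S W e := by
  rw [propSum, ← Finset.Ico_add_one_right_eq_Icc, sum_Ico_eq_sum_range]
  refine sum_congr (by simp) fun e _ => ?_
  rw [add_comm 1 e, Nat.add_sub_cancel]

lemma propSum_pos {d : ℕ} (hd : 1 ≤ d) : 0 < propSum S W d := by
  rw [propSum_eq]
  refine sum_pos (fun e _ => mul_pos (zero_lt_one.trans_le (one_le_kappaB S W _ _))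
    (zero_lt_one.trans_le (one_le_alphaB S W _))) ⟨0, by simp; omega⟩

/-- The maximum of the terms controlling the layer outputs, pre-activations, output and Jacobian
rows. -/
def maxB (H : ℕ) (γ : ℝ) : ℝ :=
  max (BLayer S W) (max (BPreact H S W) (max (BOutput H γ S W)
      (max (BJacRow S W) (BJacSpec S W))))

lemma propSum_le_maxB_mul_alphaB (H : ℕ) (γ : ℝ) {d : ℕ} (h1 : 1 ≤ d) (h2 : d < D) :
    propSum S W d ≤ maxB S W H γ * alphaB S W d := by
  rw [← div_le_iff₀ (zero_lt_one.trans_le (one_le_alphaB S W d))]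
  exact (le_ciSup_finite (fun d : Finset.Ico 1 D => propSum S W d / alphaB S W d)
    ⟨d, by simp [h1, h2]⟩).trans (le_max_left _ _)

lemma propSum_le_maxB_mul_betaB {H : ℕ} (hH : 0 < H) (γ : ℝ) {d : ℕ} (h1 : 1 ≤ d) (h2 : d < D)
    (hβ : 0 < betaB S W d) :
    propSum S W d ≤ maxB S W H γ * (√(H : ℝ) * betaB S W d) := by
  rw [← div_le_iff₀ (by positivity)]
  exact (le_ciSup_finite (fun d : Finset.Ico 1 D => propSum S W d / (√(H : ℝ) * betaB S W d))
    ⟨d, by simp [h1, h2]⟩).trans ((le_max_left _ _).trans (le_max_right _ _))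

lemma BOutput_le_maxB (H : ℕ) (γ : ℝ) : BOutput H γ S W ≤ maxB S W H γ :=
  (le_max_left _ _).trans ((le_max_right _ _).trans (le_max_right _ _))

lemma propSum_le_maxB_mul_margin {H : ℕ} (hH : 0 < H) {γ : ℝ} (hγ : 0 < γ) :
    propSum S W D ≤ maxB S W H γ * (√(H : ℝ) * γ) := by
  rw [← div_le_iff₀ (by positivity)]
  exact BOutput_le_maxB S W H γ

lemma maxB_pos {H : ℕ} (hH : 0 < H) {γ : ℝ} (hγ : 0 < γ) (hD : 1 ≤ D) : 0 < maxB S W H γ :=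
  lt_of_lt_of_le (div_pos (propSum_pos S W hD) (by positivity)) (BOutput_le_maxB S W H γ)

/-- The form of `BJacRow` consumed by the cap recursion, with e = d'' - 1 and ρ(e+1, d) estimated by
‖W_d‖_{2,∞} ψ. -/
lemma kappaB_add_sum_le (H : ℕ) (γ : ℝ) {d' d : ℕ} (h1 : 1 ≤ d') (h2 : d' < d) (h3 : d ≤ D) :
    kappaB S W d' (d - 1) + ∑ e ∈ Ico d' (d - 1), rhoB S W (e + 1) d * kappaB S W d' e ≤
      maxB S W H γ * kappaB S W d' d := by
  obtain ⟨k, rfl⟩ : ∃ k, d = k + 1 := ⟨d - 1, by omega⟩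
  rw [← div_le_iff₀ (zero_lt_one.trans_le (one_le_kappaB S W _ _))]
  have h4 : (kappaB S W d' (k + 1 - 1) + rowNorm (weight W (k + 1 - 1)) *
      ∑ d'' ∈ Finset.Ico (d' + 1) (k + 1),
        psiB S W d'' (k + 1 - 1) * kappaB S W d' (d'' - 1)) /
      kappaB S W d' (k + 1) ≤ BJacRow S W := by
    refine le_trans ?_ (le_ciSup_finite (fun d : Finset.Icc 2 D => ⨆ d' : Finset.Ico 1 (d : ℕ),
      (kappaB S W d' (d - 1) + rowNorm (weight W (d - 1)) *
      ∑ d'' ∈ Finset.Ico ((d' : ℕ) + 1) d, psiB S W d'' (d - 1) * kappaB S W d' (d'' - 1)) /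
      kappaB S W d' d) ⟨k + 1, by simp; omega⟩)
    exact le_ciSup_finite (fun d' : Finset.Ico 1 (k + 1) =>
      (kappaB S W d' (k + 1 - 1) + rowNorm (weight W (k + 1 - 1)) *
      ∑ d'' ∈ Finset.Ico ((d' : ℕ) + 1) (k + 1),
        psiB S W d'' (k + 1 - 1) * kappaB S W d' (d'' - 1)) /
      kappaB S W d' (k + 1)) ⟨d', by simp; omega⟩
  refine le_trans (div_le_div_of_nonneg_right ?_ (zero_le_one.trans (one_le_kappaB S W _ _)))
    (h4.trans ((le_max_left _ _).trans ((le_max_right _ _).trans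
      ((le_max_right _ _).trans (le_max_right _ _)))))
  simp only [Nat.add_sub_cancel]
  rw [← sum_Ico_add' (fun d'' => psiB S W d'' k * kappaB S W d' (d'' - 1)) d' k 1, mul_sum]
  simp only [Nat.add_sub_cancel]
  refine add_le_add le_rfl (sum_le_sum fun e he => ?_)
  have := mem_Ico.1 he
  rw [← mul_assoc]
  exact mul_le_mul_of_nonneg_right (rhoB_le_mul S W (by omega) (by omega))
    (zero_le_one.trans (one_le_kappaB S W _ _))

/-- Size of weight perturbations to which the network is resilient on the sample. -/
def noiseSize (H : ℕ) (γ : ℝ) : ℝ := 1 / (64 * √(H : ℝ) * maxB S W H γ)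

/-- Caps for the Jacobian row norms that leave room for weight perturbations. -/
def capR (H : ℕ) (γ : ℝ) : ℕ → ℕ → ℝ :=
  rowCap (rhoB S W) (8 * noiseSize S W H γ * √(H : ℝ))

lemma noiseSize_pos {H : ℕ} (hH : 0 < H) {γ : ℝ} (hγ : 0 < γ) (hD : 1 ≤ D) :
    0 < noiseSize S W H γ := by
  have := maxB_pos S W hH hγ hD
  unfold noiseSize; positivity

/-- The constant 64 makes s · B = 1/8 for the cap parameter s = 8ω√H, as `rowCap_le` requires, and
gives 8 · 6/64 ≤ 1 for the pre-activation, layer and output budgets. -/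
lemma noiseSize_mul {H : ℕ} (hH : 0 < H) {γ : ℝ} (hγ : 0 < γ) (hD : 1 ≤ D) :
    noiseSize S W H γ * √(H : ℝ) * maxB S W H γ = 1 / 64 := by
  have := maxB_pos S W hH hγ hD
  have h2 : 0 < √(H : ℝ) := by positivity
  unfold noiseSize; field_simp

/-- The excess of the cap over the sample value is four errors: one is used in moving from W to W',
one in moving back, and the remaining two separate the thresholds. -/
lemma capR_eq_add_rowErr (H : ℕ) (γ : ℝ) {d' d : ℕ} (h : d' < d) :
    capR S W H γ d' d = rhoB S W d' d +
      4 * rowErr (noiseSize S W H γ) H (capR S W H γ) d' d := by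
  rw [capR, rowCap_eq h, rowErr]; ring

lemma capR_le {H : ℕ} (hH : 0 < H) {γ : ℝ} (hγ : 0 < γ) {d' d : ℕ} (h1 : 1 ≤ d') (h2 : d' ≤ d)
    (h3 : d ≤ D) : capR S W H γ d' d ≤ 2 * kappaB S W d' d := by
  have hω := noiseSize_pos S W hH hγ (by omega)
  refine rowCap_le (D := D) (rhoB_nonneg S W) (by positivity) (fun d' d h1 h2 h3 => ?_)
    (rhoB_le_kappaB S W) (one_le_kappaB S W) h1 h2 h3
  refine (mul_le_mul_of_nonneg_left (kappaB_add_sum_le S W H γ h1 h2 h3) (by positivity)).trans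
    (le_of_eq ?_)
  linear_combination 8 * kappaB S W d' d * noiseSize_mul S W hH hγ (by omega : 1 ≤ D)

/-- Strict positivity leaves an interval in which a rational threshold can be chosen. -/
lemma rowErr_capR_pos {H : ℕ} (hH : 0 < H) {γ : ℝ} (hγ : 0 < γ) (hD : 1 ≤ D) {d' d : ℕ}
    (h : d' < d) : 0 < rowErr (noiseSize S W H γ) H (capR S W H γ) d' d := by
  have hω := noiseSize_pos S W hH hγ hD
  have hs : 0 < 8 * noiseSize S W H γ * √(H : ℝ) := by positivity
  unfold rowErr
  refine mul_pos (by positivity) (sum_pos (fun e _ => ?_) ⟨d', by simp [h]⟩)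
  exact mul_pos (rowCap_pos (rhoB_nonneg S W) hs _ _) (rowCap_pos (rhoB_nonneg S W) hs _ _)

/-- Bound on the change of the pre-activations. -/
def preErr (H : ℕ) (γ : ℝ) (d : ℕ) : ℝ := 6 * noiseSize S W H γ * propSum S W d

lemma preErr_output_le {H : ℕ} (hH : 0 < H) {γ : ℝ} (hγ : 0 < γ) (hD : 1 ≤ D) :
    8 * preErr S W H γ D ≤ γ := by
  have h1 := propSum_le_maxB_mul_margin S W hH hγ
  have hω := noiseSize_pos S W hH hγ hD
  have h2 := noiseSize_mul S W hH hγ hD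
  have h3 := mul_le_mul_of_nonneg_left h1 hω.le
  have h4 : noiseSize S W H γ * (maxB S W H γ * (√(H : ℝ) * γ)) = 1 / 64 * γ := by
    rw [← h2]; ring
  unfold preErr; linarith

lemma budget {H : ℕ} (hH : 0 < H) {γ : ℝ} (hγ : 0 < γ) (hD : 1 ≤ D)
    (hβ : ∀ d, 1 ≤ d → d < D → 0 < betaB S W d) :
    Budget D H (noiseSize S W H γ) (capR S W H γ) (alphaB S W) (betaB S W) (preErr S W H γ) where
  noise_nonneg := (noiseSize_pos S W hH hγ hD).le
  cap_nonneg := rowCap_nonneg (rhoB_nonneg S W) (by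
    have := noiseSize_pos S W hH hγ hD; positivity)
  cap_self := rowCap_self
  rowErr_le d' d h1 h2 h3 := by
    have := rowErr_capR_pos S W hH hγ hD h2
    have h4 := capR_eq_add_rowErr S W H γ h2
    linarith [rhoB_nonneg S W d' d]
  sum_le d hd := by
    have hω := noiseSize_pos S W hH hγ hD
    rw [preErr, propSum_eq, mul_sum, mul_sum]
    refine sum_le_sum fun e he => ?_
    have h1 := capR_le S W hH hγ (by omega : 1 ≤ e + 1) (by simpa using he) hd
    have h2 := one_le_alphaB S W e
    -- The 6 in `preErr` is 2 from `capR_le` times 3 from the cap on perturbed layer outputs.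
    calc _ ≤ noiseSize S W H γ * (2 * kappaB S W (e + 1) d * (3 * alphaB S W e)) := by gcongr
      _ = _ := by ring
  preact d h1 h2 := by
    have h3 := propSum_le_maxB_mul_betaB S W hH γ h1 h2 (hβ d h1 h2)
    have hω := noiseSize_pos S W hH hγ hD
    have h4 := noiseSize_mul S W hH hγ hD
    have h5 := mul_le_mul_of_nonneg_left h3 hω.le
    have h6 : noiseSize S W H γ * (maxB S W H γ * (√(H : ℝ) * betaB S W d)) =
      1 / 64 * betaB S W d := by rw [← h4]; ring
    have := hβ d h1 h2
    unfold preErr; linarith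
  layer d h1 h2 := by
    have h3 := propSum_le_maxB_mul_alphaB S W H γ h1 h2
    have hω := noiseSize_pos S W hH hγ hD
    have h4 := noiseSize_mul S W hH hγ hD
    have h5 := mul_le_mul_of_nonneg_left h3 (mul_nonneg hω.le (Real.sqrt_nonneg H))
    have h6 : noiseSize S W H γ * √(H : ℝ) * (maxB S W H γ * alphaB S W d) =
      1 / 64 * alphaB S W d := by rw [← h4]; ring
    have := one_le_alphaB S W d
    unfold preErr; linarith
  preact_pos := hβ
  layer_nonneg d := zero_le_one.trans (one_le_alphaB S W d)

end Sample

end ReLUNet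
end

noncomputable section

namespace ReLUNet

open Finset

/-! ### Monitored quantities, squared so as to be polynomial in the weights for fixed gates, and the
loss sets -/

section Stat

variable {D : ℕ} {n : ℕ → ℕ}

/-- Indices of the monitored quantities: layer outputs, pre-activations, Jacobians. -/
abbrev StatIdx (D : ℕ) : Type := Fin D ⊕ Fin D ⊕ (Fin (D + 1) × Fin (D + 1))

/-- Components of a monitored quantity. -/
abbrev StatRow (n : ℕ → ℕ) : StatIdx D → Type
  | .inl _ => Unit
  | .inr (.inl d) => Fin (n d)
  | .inr (.inr p) => Fin (n p.2)

instance (j : StatIdx D) : Fintype (StatRow n j) := by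
  rcases j with d | d | p <;> simp only [StatRow] <;> infer_instance

/-- The monitored quantities: squared norms of layer outputs, negated squares of pre-activations,
squared norms of rows of Jacobians. -/
def stat {R : Type*} [CommRing R] (M : (d : ℕ) → Matrix (Fin (n (d + 1))) (Fin (n d)) R)
    (a : (d : ℕ) → Fin (n d) → R) (x : Fin (n 0) → R) : (j : StatIdx D) → StatRow n j → R
  | .inl d, _ => ∑ i, (a d i * (fwd M a 0 d *ᵥ x) i) ^ 2
  | .inr (.inl d), h => -((fwd M a 0 d *ᵥ x) h) ^ 2
  | .inr (.inr p), h => if 1 ≤ (p.1 : ℕ) ∧ (p.1 : ℕ) < p.2 then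
      ∑ i, (fwd M a p.1 p.2 h i) ^ 2 else 0

/-- The monitored quantities of a network. -/
def netStat (W : Params D n) (x : Fin (n 0) → ℝ) (j : StatIdx D) (h : StatRow n j) : ℝ :=
  stat (weight W) (gates W x) x j h

lemma netStat_layer (W : Params D n) (x : Fin (n 0) → ℝ) (d : Fin D) (h : Unit) :
    netStat W x (.inl d) h = l2Norm (layerOut W x d) ^ 2 := by
  rw [l2Norm_sq, layerOut_eq_gates_mul W x d.2, preAct_eq_fwd W x d.2.le]
  rfl

lemma netStat_preAct (W : Params D n) (x : Fin (n 0) → ℝ) (d : Fin D) (h : Fin (n d)) :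
    netStat W x (.inr (.inl d)) h = -|preAct W x d h| ^ 2 := by
  rw [sq_abs, preAct_eq_fwd W x d.2.le]
  rfl

lemma netStat_jac (W : Params D n) (x : Fin (n 0) → ℝ) (p : Fin (D + 1) × Fin (D + 1))
    (h : Fin (n p.2)) : netStat W x (.inr (.inr p)) h =
      if 1 ≤ (p.1 : ℕ) ∧ (p.1 : ℕ) < p.2 then
        l2Norm (fwd (weight W) (gates W x) p.1 p.2 h) ^ 2 else 0 := by
  rw [l2Norm_sq]; rfl

/-- The points at which some monitored quantity exceeds its threshold or the margin `γ` is
violated. -/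
def lossSet (γ : ℝ) (θ : StatIdx D → ℚ) (W : Params D n) : Set (Point D n) :=
  {p | (∃ j h, (θ j : ℝ) < netStat W p.1 j h) ∨ ∃ j, j ≠ p.2 ∧ netOut W p.1 p.2 < netOut W p.1 j + γ}

lemma marginLoss_eq_one_iff (γ : ℝ) (W : Params D n) (p : Point D n) :
    marginLoss γ W p = 1 ↔ ∃ j, j ≠ p.2 ∧ netOut W p.1 p.2 < netOut W p.1 j + γ := by
  unfold marginLoss
  split_ifs with h
  · simp only [zero_ne_one, false_iff]; push Not; exact h
  · simp only [true_iff]; push Not at h; exact h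

lemma marginLoss_nonneg (γ : ℝ) (W : Params D n) (p : Point D n) : 0 ≤ marginLoss γ W p := by
  unfold marginLoss; split_ifs <;> norm_num

variable {m : ℕ}

/-- Thresholds lying between what the sample forces and what the resilience analysis allows. -/
structure Separating (S : Fin m → Point D n) (W : Params D n) (H : ℕ) (γ : ℝ)
    (θ : StatIdx D → ℚ) : Prop where
  layer_lower : ∀ d : Fin D, (9 / 8 * alphaB S W d) ^ 2 ≤ θ (.inl d)
  layer_upper : ∀ d : Fin D, θ (.inl d) ≤ (15 / 8 * alphaB S W d) ^ 2
  preact_zero : ∀ d : Fin D, (d : ℕ) = 0 → θ (.inr (.inl d)) = 0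
  preact_lower : ∀ d : Fin D, 1 ≤ (d : ℕ) → -(7 / 8 * betaB S W d) ^ 2 ≤ θ (.inr (.inl d))
  preact_upper : ∀ d : Fin D, 1 ≤ (d : ℕ) → θ (.inr (.inl d)) ≤ -(5 / 8 * betaB S W d) ^ 2
  jac_zero : ∀ p : Fin (D + 1) × Fin (D + 1), ¬(1 ≤ (p.1 : ℕ) ∧ (p.1 : ℕ) < p.2) →
    θ (.inr (.inr p)) = 0
  jac_lower : ∀ p : Fin (D + 1) × Fin (D + 1), 1 ≤ (p.1 : ℕ) → (p.1 : ℕ) < p.2 →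
    (rhoB S W p.1 p.2 + rowErr (noiseSize S W H γ) H (capR S W H γ) p.1 p.2) ^ 2 ≤
      θ (.inr (.inr p))
  jac_upper : ∀ p : Fin (D + 1) × Fin (D + 1), 1 ≤ (p.1 : ℕ) → (p.1 : ℕ) < p.2 →
    θ (.inr (.inr p)) ≤
      (capR S W H γ p.1 p.2 - rowErr (noiseSize S W H γ) H (capR S W H γ) p.1 p.2) ^ 2

/-- The thresholds are rational so that the loss sets form a countable class for the uniform
deviation bound. -/
lemma exists_separating (S : Fin m → Point D n) (W : Params D n) {H : ℕ} (hH : 0 < H) {γ : ℝ}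
    (hγ : 0 < γ) (hD : 1 ≤ D) (hβ : ∀ d, 1 ≤ d → d < D → 0 < betaB S W d) :
    ∃ θ : StatIdx D → ℚ, Separating S W H γ θ := by
  have h1 : ∀ d : Fin D, ∃ q : ℚ, (9 / 8 * alphaB S W d) ^ 2 ≤ q ∧
      (q : ℝ) ≤ (15 / 8 * alphaB S W d) ^ 2 := fun d => by
    have := one_le_alphaB S W d
    obtain ⟨q, hq1, hq2⟩ := exists_rat_btwn
      (by nlinarith : (9 / 8 * alphaB S W d) ^ 2 < (15 / 8 * alphaB S W d) ^ 2)
    exact ⟨q, hq1.le, hq2.le⟩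
  have h2 : ∀ d : Fin D, ∃ q : ℚ, ((d : ℕ) = 0 → q = 0) ∧ (1 ≤ (d : ℕ) →
      -(7 / 8 * betaB S W d) ^ 2 ≤ q ∧ (q : ℝ) ≤ -(5 / 8 * betaB S W d) ^ 2) := fun d => by
    rcases Nat.eq_zero_or_pos (d : ℕ) with h | h
    · exact ⟨0, fun _ => rfl, fun h' => by omega⟩
    · have := hβ d h d.2
      obtain ⟨q, hq1, hq2⟩ := exists_rat_btwn
        (by nlinarith : -(7 / 8 * betaB S W d) ^ 2 < -(5 / 8 * betaB S W d) ^ 2)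
      exact ⟨q, fun h' => by omega, fun _ => ⟨hq1.le, hq2.le⟩⟩
  have h3 : ∀ p : Fin (D + 1) × Fin (D + 1), ∃ q : ℚ,
      (¬(1 ≤ (p.1 : ℕ) ∧ (p.1 : ℕ) < p.2) → q = 0) ∧ (1 ≤ (p.1 : ℕ) → (p.1 : ℕ) < p.2 →
      (rhoB S W p.1 p.2 + rowErr (noiseSize S W H γ) H (capR S W H γ) p.1 p.2) ^ 2 ≤ q ∧ (q : ℝ) ≤
      (capR S W H γ p.1 p.2 - rowErr (noiseSize S W H γ) H (capR S W H γ) p.1 p.2) ^ 2) :=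
    fun p => by
    by_cases h : 1 ≤ (p.1 : ℕ) ∧ (p.1 : ℕ) < p.2
    · have h4 := rowErr_capR_pos S W hH hγ hD h.2
      have h5 := rhoB_nonneg S W p.1 p.2
      rw [capR_eq_add_rowErr S W H γ h.2]
      obtain ⟨q, hq1, hq2⟩ := exists_rat_btwn (show
        (rhoB S W p.1 p.2 + rowErr (noiseSize S W H γ) H (capR S W H γ) p.1 p.2) ^ 2 <
        (rhoB S W p.1 p.2 + 4 * rowErr (noiseSize S W H γ) H (capR S W H γ) p.1 p.2 -
          rowErr (noiseSize S W H γ) H (capR S W H γ) p.1 p.2) ^ 2 by nlinarith)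
      exact ⟨q, fun h' => absurd h h', fun _ _ => ⟨hq1.le, hq2.le⟩⟩
    · exact ⟨0, fun _ => rfl, fun h1 h2 => absurd ⟨h1, h2⟩ h⟩
  choose q1 hq1 using h1
  choose q2 hq2 using h2
  choose q3 hq3 using h3
  exact ⟨fun | .inl d => q1 d | .inr (.inl d) => q2 d | .inr (.inr p) => q3 p,
    fun d => (hq1 d).1, fun d => (hq1 d).2, fun d => (hq2 d).1, fun d h => ((hq2 d).2 h).1,
    fun d h => ((hq2 d).2 h).2, fun p => (hq3 p).1, fun p h h' => ((hq3 p).2 h h').1,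
    fun p h h' => ((hq3 p).2 h h').2⟩

variable {S : Fin m → Point D n} {W W' : Params D n} {H : ℕ} {γ : ℝ} {θ : StatIdx D → ℚ}

/-- Used once with margins 0 to γ/2 and once with γ/2 to γ; each passage costs twice the output
error, at most γ/4. -/
lemma margin_transfer {V V' : Fin (n D) → ℝ} {ε γ₁ γ₂ : ℝ} (h : ∀ j, |V' j - V j| ≤ ε)
    (hγ : γ₁ + 2 * ε ≤ γ₂) {y : Fin (n D)} (hm : ∃ j, j ≠ y ∧ V y < V j + γ₁) :
    ∃ j, j ≠ y ∧ V' y < V' j + γ₂ := by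
  obtain ⟨j, hj, hlt⟩ := hm
  refine ⟨j, hj, ?_⟩
  have h1 := abs_le.1 (h j)
  have h2 := abs_le.1 (h y)
  linarith

/-- Off the loss set of the perturbed network, the original network classifies correctly. -/
theorem mem_lossSet_of_marginLoss_zero (hW : ∀ d, 1 ≤ d → d < D → n d = H) (hH : 0 < H)
    (hγ : 0 < γ) (hD : 1 ≤ D) (hβ : ∀ d, 1 ≤ d → d < D → 0 < betaB S W d)
    (hθ : Separating S W H γ θ) {p : Point D n} (hN : NoiseOK (noiseSize S W H γ) W W' p.1)
    (hp : marginLoss 0 W p = 1) : p ∈ lossSet (γ / 2) θ W' := by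
  by_contra hcon
  simp only [lossSet, Set.mem_ofPred_eq, not_or, not_exists, not_lt] at hcon
  obtain ⟨hstat, hmargin⟩ := hcon
  have hb := budget S W hH hγ hD hβ
  -- Nothing is known about W at a fresh point, so every a priori bound comes from W' respecting the
  -- upper thresholds.
  have hclose := (closeness hW hb hN (fun d' d h1 h2 h3 h => Or.inr ?_)
    (fun d hd => Or.inr ?_) (fun d h1 h2 h => Or.inr ?_) le_rfl).2.2.1
  · obtain ⟨j, hj, hlt⟩ := margin_transfer (γ₁ := 0) (γ₂ := γ / 2)
      (V := preAct W p.1 D) (V' := preAct W' p.1 D) hclose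
      (by have := preErr_output_le S W hH hγ hD; linarith)
      (by simpa only [layerOut_last] using (marginLoss_eq_one_iff 0 W p).1 hp)
    refine hmargin j ⟨hj, ?_⟩
    simpa only [layerOut_last] using hlt
  · have h4 := hstat (.inr (.inr (⟨d', by omega⟩, ⟨d, by omega⟩))) h
    rw [netStat_jac, if_pos ⟨h1, h2⟩] at h4
    have h5 := h4.trans (hθ.jac_upper _ h1 h2)
    have h6 := capR_eq_add_rowErr S W H γ h2
    have h7 := rowErr_capR_pos S W hH hγ hD h2
    have h8 := rhoB_nonneg S W d' d
    exact le_of_sq_le_sq h5 (sub_nonneg.2 (by linarith))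
  · have h4 := hstat (.inl ⟨d, hd⟩) ()
    rw [netStat_layer] at h4
    have := one_le_alphaB S W d
    exact le_of_sq_le_sq (h4.trans (hθ.layer_upper _)) (mul_nonneg (by norm_num) (by linarith))
  · have h4 := hstat (.inr (.inl ⟨d, h2⟩)) h
    rw [netStat_preAct] at h4
    have h5 := h4.trans (hθ.preact_upper ⟨d, h2⟩ h1)
    exact le_of_sq_le_sq (neg_le_neg_iff.1 h5) (abs_nonneg _)

/-- On the sample, the loss of the perturbed network is dominated by the margin loss. -/
theorem marginLoss_of_mem_lossSet (hW : ∀ d, 1 ≤ d → d < D → n d = H) (hH : 0 < H)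
    (hγ : 0 < γ) (hD : 1 ≤ D) (hβ : ∀ d, 1 ≤ d → d < D → 0 < betaB S W d)
    (hθ : Separating S W H γ θ) {i : Fin m} (hN : NoiseOK (noiseSize S W H γ) W W' (S i).1)
    (hp : S i ∈ lossSet (γ / 2) θ W') : marginLoss γ W (S i) = 1 := by
  have hb := budget S W hH hγ hD hβ
  have hω := noiseSize_pos S W hH hγ hD
  -- On the sample the bounds hold for W by definition of ρ, α and β.
  have hclose := fun (d : ℕ) (hd : d ≤ D) => closeness hW hb hN
    (fun d' d h1 h2 h3 h => Or.inl ((l2Norm_fwd_le_rhoB S W i h1 h2.le h).trans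
      (le_rowCap (rhoB_nonneg S W) (by positivity) h2)))
    (fun d hd => Or.inl (by
      have h1 := l2Norm_layerOut_le_alphaB S W i d
      have h2 := one_le_alphaB S W d
      linarith))
    (fun d h1 h2 h => Or.inl (by
      have h3 := betaB_le S W i d h
      have := hβ d h1 h2
      linarith)) hd
  rw [marginLoss_eq_one_iff]
  rcases hp with ⟨j, h, hlt⟩ | hmargin
  · exfalso
    refine absurd hlt (not_lt.2 ?_)
    rcases j with d | d | p
    · rw [netStat_layer]
      refine le_trans ?_ (hθ.layer_lower d)
      refine pow_le_pow_left₀ (l2Norm_nonneg _) ?_ 2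
      have h1 := ((hclose d d.2.le).2.2.2 d.2).2.2.2
      have h2 := l2Norm_le_add_sub (layerOut W' (S i).1 d) (layerOut W (S i).1 d)
      have h3 := l2Norm_layerOut_le_alphaB S W i d
      linarith
    · rw [netStat_preAct]
      rcases Nat.eq_zero_or_pos (d : ℕ) with h0 | hpos
      · rw [hθ.preact_zero d h0]; simpa using sq_nonneg _
      · refine le_trans ?_ (hθ.preact_lower d hpos)
        have hβd := hβ d hpos d.2
        refine neg_le_neg (pow_le_pow_left₀ (by positivity) ?_ 2)
        have h1 := (hclose d d.2.le).2.2.1 h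
        have h2 := hb.preact d hpos d.2
        have h3 := betaB_le S W i d h
        have h4 := abs_sub_abs_le_abs_sub (preAct W (S i).1 d h) (preAct W' (S i).1 d h)
        rw [abs_sub_comm] at h4
        linarith
    · rw [netStat_jac]
      split_ifs with hv
      · refine le_trans ?_ (hθ.jac_lower p hv.1 hv.2)
        refine pow_le_pow_left₀ (l2Norm_nonneg _) ?_ 2
        have h1 := (hclose p.2 (by omega)).1 p.1 hv.1 hv.2 h
        have h2 := l2Norm_le_add_sub (fwd (weight W') (gates W' (S i).1) p.1 p.2 h)
          (fwd (weight W) (gates W (S i).1) p.1 p.2 h)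
        have h3 := l2Norm_fwd_le_rhoB S W i hv.1 hv.2.le h
        linarith
      · rw [hθ.jac_zero p hv, Rat.cast_zero]
  · refine margin_transfer (V := netOut W' (S i).1) (V' := netOut W (S i).1) (fun j => ?_) ?_ hmargin
      (ε := preErr S W H γ D)
    · rw [abs_sub_comm, layerOut_last, layerOut_last]; exact (hclose D le_rfl).2.2.1 j
    · have := preErr_output_le S W hH hγ hD; linarith

end Stat

end ReLUNet
end

noncomputable section

/-! ### Vapnik–Chervonenkis inequality by exponential symmetrization -/

namespace UniformDeviation

open Finset MeasureTheory

variable {X T : Type*} {m : ℕ}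

/-- Indicator of a set as a real number. -/
def ind (A : Set X) (x : X) : ℝ := A.indicator 1 x

lemma ind_nonneg (A : Set X) (x : X) : 0 ≤ ind A x :=
  Set.indicator_nonneg (fun _ _ => zero_le_one) x

lemma ind_le_one (A : Set X) (x : X) : ind A x ≤ 1 :=
  Set.indicator_le_self' (s := A) (f := (1 : X → ℝ)) (fun _ _ => zero_le_one) x

/-- Fraction of the sample lying in a set. -/
def emp (A : Set X) (S : Fin m → X) : ℝ := (∑ i, ind A (S i)) / m

/-- Exchange the two components of the selected coordinates. -/
def swapAt (b : Fin m → Bool) (Z : Fin m → X × X) : Fin m → X × X :=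
  fun i => if b i then (Z i).swap else Z i

/-- Exponential of the difference between the number of hits in the second and first components. -/
def expDiff (ε : ℝ) (A : Set X) (Z : Fin m → X × X) : ℝ :=
  Real.exp (ε * ∑ i, (ind A (Z i).2 - ind A (Z i).1))

/-- The pair of sample points as one family. -/
def joint (Z : Fin m → X × X) : Fin m ⊕ Fin m → X :=
  Sum.elim (fun i => (Z i).1) (fun i => (Z i).2)

lemma expDiff_swapAt (ε : ℝ) (A : Set X) (b : Fin m → Bool) (Z : Fin m → X × X) :
    expDiff ε A (swapAt b Z) = ∏ i, Real.exp ((if b i then -ε else ε) *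
      (ind (joint Z ⁻¹' A) (.inr i) - ind (joint Z ⁻¹' A) (.inl i))) := by
  rw [expDiff, mul_sum, Real.exp_sum]
  refine prod_congr rfl fun i _ => congrArg Real.exp ?_
  have h1 : ind (joint Z ⁻¹' A) (.inr i) = ind A (Z i).2 := rfl
  have h2 : ind (joint Z ⁻¹' A) (.inl i) = ind A (Z i).1 := rfl
  rw [h1, h2, swapAt]
  split_ifs
  · simp only [Prod.fst_swap, Prod.snd_swap]; ring
  · rfl

/-- The sum over all swaps factorizes over coordinates; each factor is 2 cosh(εz) with |z| ≤ 1, at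
most 2 exp(ε²/2). -/
lemma sum_swaps_le (ε : ℝ) (P : Set (Fin m ⊕ Fin m)) :
    ∑ b : Fin m → Bool, ∏ i, Real.exp ((if b i then -ε else ε) *
      (ind P (.inr i) - ind P (.inl i))) ≤ 2 ^ m * Real.exp (m * ε ^ 2 / 2) := by
  have h := Finset.sum_prod_piFinset (univ : Finset Bool) fun (i : Fin m) (b : Bool) =>
    Real.exp ((if b then -ε else ε) * (ind P (.inr i) - ind P (.inl i)))
  rw [Fintype.piFinset_univ] at h
  rw [h]
  calc _ ≤ ∏ _i : Fin m, 2 * Real.exp (ε ^ 2 / 2) := by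
        refine prod_le_prod (fun i _ => sum_nonneg fun _ _ => (Real.exp_pos _).le) fun i _ => ?_
        set z := ind P (.inr i) - ind P (.inl i)
        have hz : z ^ 2 ≤ 1 := by
          rw [sq_le_one_iff_abs_le_one, abs_le]
          have h1 := ind_nonneg P (.inr i)
          have h2 := ind_nonneg P (.inl i)
          have h3 := ind_le_one P (.inr i)
          have h4 := ind_le_one P (.inl i)
          constructor <;> simp only [z] <;> linarith
        have h5 := Real.cosh_le_exp_half_sq (ε * z)
        rw [Real.cosh_eq] at h5
        have h6 : Real.exp ((ε * z) ^ 2 / 2) ≤ Real.exp (ε ^ 2 / 2) := by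
          apply Real.exp_le_exp.2
          rw [mul_pow]
          nlinarith [sq_nonneg ε]
        simp only [Fintype.sum_bool, if_true, Bool.false_eq_true, if_false, neg_mul]
        linarith
    _ = _ := by
        rw [prod_const, card_univ, Fintype.card_fin, mul_pow, ← Real.exp_nat_mul]
        congr 2; ring

variable [MeasurableSpace X] (μ : Measure X) [IsProbabilityMeasure μ]

lemma measurable_ind {A : Set X} (hA : MeasurableSet A) : Measurable (ind A) :=
  measurable_one.indicator hA

lemma measurable_expDiff (ε : ℝ) {A : Set X} (hA : MeasurableSet A) :
    Measurable (expDiff (m := m) ε A) := by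
  have := measurable_ind hA
  unfold expDiff
  fun_prop

lemma measurePreserving_swapAt (b : Fin m → Bool) :
    MeasurePreserving (swapAt b) (Measure.pi fun _ : Fin m => μ.prod μ)
      (Measure.pi fun _ : Fin m => μ.prod μ) := by
  refine measurePreserving_pi _ _ (f := fun i z => if b i then Prod.swap z else z) fun i => ?_
  split_ifs
  · exact Measure.measurePreserving_swap
  · exact MeasurePreserving.id _

/-- The law of the paired sample is invariant under each of the 2^m swaps, so the integrand may be
averaged over them. At fixed points the supremum over t is at most a sum over the G patterns, to
which `sum_swaps_le` applies. -/
lemma lintegral_iSup_expDiff_le [Countable T] {A : T → Set X} (hA : ∀ t, MeasurableSet (A t))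
    {G : ℕ} (hG : ∀ z : Fin m ⊕ Fin m → X, ∃ F : Finset (Set (Fin m ⊕ Fin m)),
      #F ≤ G ∧ ∀ t, z ⁻¹' A t ∈ F) (ε : ℝ) :
    ∫⁻ Z, ⨆ t, ENNReal.ofReal (expDiff ε (A t) Z) ∂(Measure.pi fun _ : Fin m => μ.prod μ) ≤
      ENNReal.ofReal (G * Real.exp (m * ε ^ 2 / 2)) := by
  set Φ : (Fin m → X × X) → ENNReal := fun Z => ⨆ t, ENNReal.ofReal (expDiff ε (A t) Z) with hΦ
  have hΦm : Measurable Φ := Measurable.iSup fun t => (measurable_expDiff ε (hA t)).ennreal_ofReal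
  have hpt : ∀ Z, ∑ b, Φ (swapAt b Z) ≤
      ENNReal.ofReal (2 ^ m * (G * Real.exp (m * ε ^ 2 / 2))) := fun Z => by
    obtain ⟨F, hF, hmem⟩ := hG (joint Z)
    set g : Set (Fin m ⊕ Fin m) → (Fin m → Bool) → ℝ := fun P b =>
      ∏ i, Real.exp ((if b i then -ε else ε) * (ind P (.inr i) - ind P (.inl i)))
    have hg : ∀ P b, 0 ≤ g P b := fun P b => prod_nonneg fun _ _ => (Real.exp_pos _).le
    calc ∑ b, Φ (swapAt b Z) ≤ ∑ b, ∑ P ∈ F, ENNReal.ofReal (g P b) := by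
          refine sum_le_sum fun b _ => iSup_le fun t => ?_
          rw [expDiff_swapAt]
          exact single_le_sum (f := fun P => ENNReal.ofReal (g P b)) (fun _ _ => zero_le) (hmem t)
      _ = ∑ P ∈ F, ENNReal.ofReal (∑ b, g P b) := by
          rw [sum_comm]
          exact sum_congr rfl fun P _ => (ENNReal.ofReal_sum_of_nonneg fun b _ => hg P b).symm
      _ ≤ ∑ P ∈ F, ENNReal.ofReal (2 ^ m * Real.exp (m * ε ^ 2 / 2)) :=
          sum_le_sum fun P _ => ENNReal.ofReal_le_ofReal (sum_swaps_le ε P)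
      _ = ENNReal.ofReal (#F * (2 ^ m * Real.exp (m * ε ^ 2 / 2))) := by
          rw [sum_const, nsmul_eq_mul, ENNReal.ofReal_mul (p := (#F : ℝ)) (by positivity),
            ENNReal.ofReal_natCast]
      _ ≤ _ := by
          apply ENNReal.ofReal_le_ofReal
          rw [mul_left_comm]
          gcongr
  have hsum : (2 ^ m : ENNReal) * ∫⁻ Z, Φ Z ∂(Measure.pi fun _ : Fin m => μ.prod μ) ≤
      2 ^ m * ENNReal.ofReal (G * Real.exp (m * ε ^ 2 / 2)) := by
    calc _ = ∑ b : Fin m → Bool,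
          ∫⁻ Z, Φ (swapAt b Z) ∂(Measure.pi fun _ : Fin m => μ.prod μ) := by
          rw [sum_congr rfl fun b _ => (measurePreserving_swapAt μ b).lintegral_comp hΦm]
          simp
      _ = ∫⁻ Z, ∑ b, Φ (swapAt b Z) ∂(Measure.pi fun _ : Fin m => μ.prod μ) :=
          (lintegral_finsetSum _ fun b _ =>
            hΦm.comp (measurePreserving_swapAt μ b).measurable).symm
      _ ≤ ∫⁻ _, ENNReal.ofReal (2 ^ m * (G * Real.exp (m * ε ^ 2 / 2)))
            ∂(Measure.pi fun _ : Fin m => μ.prod μ) := lintegral_mono hpt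
      _ = _ := by
          rw [lintegral_const, measure_univ, mul_one, ENNReal.ofReal_mul (by positivity)]
          congr 1
          rw [ENNReal.ofReal_pow (by norm_num)]; norm_num
  exact (ENNReal.mul_le_mul_iff_right (by simp) (by simp)).1 hsum

/-- Jensen in the second (ghost) sample S', whose expected number of hits is m μ(A). -/
lemma exp_mul_sub_le_lintegral {A : Set X} (hA : MeasurableSet A) (ε : ℝ) (S : Fin m → X) :
    ENNReal.ofReal (Real.exp (ε * (m * μ.real A - ∑ i, ind A (S i)))) ≤
      ∫⁻ S', ENNReal.ofReal (expDiff ε A fun i => (S i, S' i)) ∂(Measure.pi fun _ : Fin m => μ) := by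
  set P := Measure.pi fun _ : Fin m => μ
  have hind := measurable_ind hA
  have hint : ∀ i, Integrable (fun S' : Fin m → X => ind A (S' i)) P := fun i =>
    Integrable.of_bound (hind.comp (measurable_pi_apply i)).aestronglyMeasurable 1
      (.of_forall fun S' => by
        rw [Real.norm_eq_abs, abs_of_nonneg (ind_nonneg _ _)]; exact ind_le_one _ _)
  have hmean : ∀ i, ∫ S', ind A (S' i) ∂P = μ.real A := fun i => by
    have hmap : P.map (fun S' => S' i) = μ := (measurePreserving_eval (fun _ : Fin m => μ) i).map_eq
    rw [← integral_map (φ := fun S' : Fin m → X => S' i) (measurable_pi_apply i).aemeasurable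
      hind.aestronglyMeasurable, hmap]
    exact integral_indicator_one hA
  set f : (Fin m → X) → ℝ := fun S' => ε * ∑ i, (ind A (S' i) - ind A (S i))
  have hfint : Integrable f P :=
    (integrable_finsetSum _ fun i _ => (hint i).sub (integrable_const _)).const_mul ε
  have hfmean : ∫ S', f S' ∂P = ε * (m * μ.real A - ∑ i, ind A (S i)) := by
    simp only [f]
    have hsubint : ∀ i, Integrable (fun S' : Fin m → X => ind A (S' i) - ind A (S i)) P := fun i =>
      (hint i).sub (integrable_const (ind A (S i)))
    rw [integral_const_mul, integral_finsetSum _ fun i _ => hsubint i]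
    congr 1
    rw [sum_congr rfl fun i _ => integral_sub (hint i) (integrable_const (ind A (S i)))]
    simp only [hmean, integral_const, smul_eq_mul, sum_sub_distrib]
    simp
  have hfm : Measurable f := by fun_prop
  have hbound : ∀ S', |f S'| ≤ |ε| * m := fun S' => by
    simp only [f, abs_mul]
    gcongr
    calc _ ≤ ∑ i, |ind A (S' i) - ind A (S i)| := abs_sum_le_sum_abs _ _
      _ ≤ ∑ _i : Fin m, 1 := sum_le_sum fun i _ => by
          rw [abs_le]
          constructor <;> linarith [ind_nonneg A (S i), ind_le_one A (S i), ind_nonneg A (S' i),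
            ind_le_one A (S' i)]
      _ = m := by simp
  have heint : Integrable (fun S' => Real.exp (f S')) P :=
    Integrable.of_bound (Real.measurable_exp.comp hfm).aestronglyMeasurable
      (Real.exp (|ε| * m)) (.of_forall fun S' => by
        rw [Real.norm_eq_abs, abs_of_pos (Real.exp_pos _)]
        exact Real.exp_le_exp.2 ((le_abs_self _).trans (hbound S')))
  change _ ≤ ∫⁻ S', ENNReal.ofReal (Real.exp (f S')) ∂P
  rw [← ofReal_integral_eq_lintegral_ofReal heint (.of_forall fun _ => (Real.exp_pos _).le),
    ← hfmean]
  refine ENNReal.ofReal_le_ofReal ?_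
  have hjensen := convexOn_exp.map_integral_le (μ := P) (f := f) Real.continuous_exp.continuousOn
    isClosed_univ (.of_forall fun _ => Set.mem_univ _) hfint heint
  exact hjensen

/-- **Vapnik–Chervonenkis inequality**, one-sided: uniform deviation of means from empirical means
over a countable class that realizes at most `G` patterns on `2m` points. -/
theorem measure_exists_deviation_le [Countable T] {A : T → Set X}
    (hA : ∀ t, MeasurableSet (A t)) (hm : 0 < m) {G : ℕ}
    (hG : ∀ z : Fin m ⊕ Fin m → X, ∃ F : Finset (Set (Fin m ⊕ Fin m)),
      #F ≤ G ∧ ∀ t, z ⁻¹' A t ∈ F) {ε : ℝ} (hε : 0 ≤ ε) :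
    (Measure.pi fun _ : Fin m => μ) {S | ∃ t, ε < μ.real (A t) - emp (A t) S} ≤
      ENNReal.ofReal (G * Real.exp (-(m * ε ^ 2 / 2))) := by
  set P := Measure.pi fun _ : Fin m => μ
  set Ψ : (Fin m → X) × (Fin m → X) → ENNReal := fun p =>
    ⨆ t, ENNReal.ofReal (expDiff ε (A t) fun i => (p.1 i, p.2 i))
  have hΨm : Measurable Ψ := Measurable.iSup fun t =>
    ((measurable_expDiff ε (hA t)).comp (by fun_prop)).ennreal_ofReal
  -- The exponential parameter is taken equal to the deviation ε: a deviating S has ghost integral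
  -- at least exp(mε²), against a total of G exp(mε²/2), and Markov gives the difference of
  -- exponents.
  have hsub : {S | ∃ t, ε < μ.real (A t) - emp (A t) S} ⊆
      {S | ENNReal.ofReal (Real.exp (m * ε ^ 2)) ≤ ∫⁻ S', Ψ (S, S') ∂P} := by
    rintro S ⟨t, ht⟩
    refine le_trans (ENNReal.ofReal_le_ofReal (Real.exp_le_exp.2 ?_))
      ((exp_mul_sub_le_lintegral μ (hA t) ε S).trans (lintegral_mono fun S' =>
        le_iSup (fun t => ENNReal.ofReal (expDiff ε (A t) fun i => (S i, S' i))) t))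
    have hm' : (0 : ℝ) < m := by exact_mod_cast hm
    have h1 : (m : ℝ) * ε ≤ m * μ.real (A t) - ∑ i, ind (A t) (S i) := by
      have : (m : ℝ) * (μ.real (A t) - emp (A t) S) = m * μ.real (A t) - ∑ i, ind (A t) (S i) := by
        unfold emp; field_simp
      rw [← this]; gcongr
    nlinarith
  have htot : ∫⁻ S, ∫⁻ S', Ψ (S, S') ∂P ∂P ≤ ENNReal.ofReal (G * Real.exp (m * ε ^ 2 / 2)) := by
    rw [lintegral_lintegral (f := fun S S' => Ψ (S, S')) hΨm.aemeasurable]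
    have hmp := measurePreserving_arrowProdEquivProdArrow X X (Fin m) (fun _ => μ) (fun _ => μ)
    rw [← hmp.lintegral_comp hΨm]
    exact lintegral_iSup_expDiff_le μ hA hG ε
  calc _ ≤ P {S | ENNReal.ofReal (Real.exp (m * ε ^ 2)) ≤ ∫⁻ S', Ψ (S, S') ∂P} :=
        measure_mono hsub
    _ ≤ (∫⁻ S, ∫⁻ S', Ψ (S, S') ∂P ∂P) / ENNReal.ofReal (Real.exp (m * ε ^ 2)) :=
        meas_ge_le_lintegral_div hΨm.lintegral_prod_right'.aemeasurable (by simp [Real.exp_pos])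
          ENNReal.ofReal_ne_top
    _ ≤ ENNReal.ofReal (G * Real.exp (m * ε ^ 2 / 2)) / ENNReal.ofReal (Real.exp (m * ε ^ 2)) := by
        gcongr
    _ = _ := by
        rw [← ENNReal.ofReal_div_of_pos (Real.exp_pos _), mul_div_assoc, ← Real.exp_sub]
        congr 3; ring

end UniformDeviation

end

noncomputable section

/-! ### Gaussian tails and translations -/

namespace StdGauss

open Finset MeasureTheory ProbabilityTheory
open scoped NNReal ENNReal

variable {ι : Type*}

/-- Standard Gaussian measure on a finite product of lines. -/
def law (ι : Type*) [Fintype ι] : Measure (ι → ℝ) := Measure.pi fun _ => gaussianReal 0 1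

variable [Fintype ι]

instance : IsProbabilityMeasure (law ι) := by unfold law; infer_instance

lemma hasSubgaussianMGF_id : HasSubgaussianMGF (fun x : ℝ => x) 1 (gaussianReal 0 1) where
  integrable_exp_mul := integrable_exp_mul_gaussianReal
  mgf_le t := by rw [mgf_fun_id_gaussianReal]; simp

lemma hasSubgaussianMGF_linear (c : ι → ℝ) :
    HasSubgaussianMGF (fun y : ι → ℝ => ∑ k, c k * y k) (∑ k, (c k ^ 2).toNNReal) (law ι) := by
  refine HasSubgaussianMGF.sum_of_iIndepFun
    (iIndepFun_pi (X := fun k (x : ℝ) => c k * x) fun k => by fun_prop) fun k _ => ?_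
  have h1 : HasSubgaussianMGF (fun y : ι → ℝ => y k) 1 (law ι) := by
    refine HasSubgaussianMGF.of_map (μ := law ι) (Y := fun y : ι → ℝ => y k)
      (X := fun x : ℝ => x) (measurable_pi_apply k).aemeasurable ?_
    rw [show (law ι).map (fun y => y k) = gaussianReal 0 1 from
      (measurePreserving_eval (fun _ : ι => gaussianReal 0 1) k).map_eq]
    exact hasSubgaussianMGF_id
  have h2 : (⟨c k ^ 2, sq_nonneg (c k)⟩ : ℝ≥0) * 1 = (c k ^ 2).toNNReal := by
    rw [mul_one]; exact (Real.toNNReal_of_nonneg (sq_nonneg _)).symm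
  rw [← h2]
  exact h1.const_mul (c k)

lemma measure_abs_linear_gt_le (c : ι → ℝ) {τ : ℝ} (hτ : 0 ≤ τ) :
    law ι {y | τ * √(∑ k, c k ^ 2) < |∑ k, c k * y k|} ≤
      ENNReal.ofReal (2 * Real.exp (-τ ^ 2 / 2)) := by
  set V := ∑ k, c k ^ 2 with hV
  have hV0 : 0 ≤ V := by positivity
  rcases hV0.eq_or_lt with h0 | hpos
  · have hc : ∀ k, c k = 0 := fun k => by
      have := (sum_eq_zero_iff_of_nonneg fun k _ => sq_nonneg (c k)).1 h0.symm k (mem_univ k)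
      simpa using this
    have : {y : ι → ℝ | τ * √V < |∑ k, c k * y k|} = ∅ := by
      ext y; simp [hc, ← h0]
    rw [this]; simp
  · have key : ∀ c' : ι → ℝ, (∑ k, c' k ^ 2 = V) →
        law ι {y | τ * √V ≤ ∑ k, c' k * y k} ≤ ENNReal.ofReal (Real.exp (-τ ^ 2 / 2)) := by
      intro c' hc'
      have h1 := (hasSubgaussianMGF_linear c').measure_ge_le (ε := τ * √V) (by positivity)
      have h2 : ((∑ k, (c' k ^ 2).toNNReal : ℝ≥0) : ℝ) = V := by
        rw [NNReal.coe_sum, ← hc']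
        exact sum_congr rfl fun k _ => Real.coe_toNNReal _ (sq_nonneg _)
      rw [h2, mul_pow, Real.sq_sqrt hV0] at h1
      rw [← ofReal_measureReal]
      refine ENNReal.ofReal_le_ofReal (h1.trans (le_of_eq ?_))
      congr 1; field_simp
    have hsub : {y : ι → ℝ | τ * √V < |∑ k, c k * y k|} ⊆
        {y | τ * √V ≤ ∑ k, c k * y k} ∪ {y | τ * √V ≤ ∑ k, (-c k) * y k} := by
      intro y hy
      rcases lt_abs.1 (show τ * √V < |∑ k, c k * y k| from hy) with h | h
      · exact Or.inl h.le
      · right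
        simpa [sum_neg_distrib] using h.le
    calc _ ≤ _ := measure_mono hsub
      _ ≤ _ := measure_union_le _ _
      _ ≤ ENNReal.ofReal (Real.exp (-τ ^ 2 / 2)) + ENNReal.ofReal (Real.exp (-τ ^ 2 / 2)) :=
          add_le_add (key c rfl) (key (fun k => -c k) (by simp [hV]))
      _ = _ := by rw [← ENNReal.ofReal_add (by positivity) (by positivity), two_mul]

/-- Tail bound for a linear form whose coefficients depend only on the other coordinates. -/
theorem measure_abs_predictable_gt_le [DecidableEq ι] (s : Finset ι) {c : (ι → ℝ) → ι → ℝ}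
    (hc : Measurable c) (hcs : ∀ u y, c (Function.updateFinset u s y) = c u) {τ : ℝ} (hτ : 0 ≤ τ) :
    law ι {u | τ * √(∑ k ∈ s, c u k ^ 2) < |∑ k ∈ s, c u k * u k|} ≤
      ENNReal.ofReal (2 * Real.exp (-τ ^ 2 / 2)) := by
  have hck : ∀ k, Measurable fun u => c u k := fun k => (measurable_pi_apply k).comp hc
  have hA : MeasurableSet {u | τ * √(∑ k ∈ s, c u k ^ 2) < |∑ k ∈ s, c u k * u k|} :=
    measurableSet_lt (by fun_prop) (by fun_prop)
  set A := {u | τ * √(∑ k ∈ s, c u k ^ 2) < |∑ k ∈ s, c u k * u k|}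
  set f : (ι → ℝ) → ℝ≥0∞ := A.indicator 1 with hf
  have hfm : Measurable f := measurable_one.indicator hA
  -- The coordinates in s are integrated first with the others frozen. The coefficients are then
  -- constants, and the tail of a fixed linear form applies.
  rw [← lintegral_indicator_one hA, law, lintegral_eq_lmarginal_univ (fun _ : ι => (0 : ℝ)),
    ← Finset.union_compl s, union_comm, lmarginal_union _ _ hfm disjoint_compl_left]
  have hbound : (∫⋯∫⁻_s, f ∂fun _ : ι => gaussianReal 0 1) ≤
      fun _ => ENNReal.ofReal (2 * Real.exp (-τ ^ 2 / 2)) := fun u => by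
    have h1 : ∀ y : s → ℝ, f (Function.updateFinset u s y) =
        Set.indicator {y : s → ℝ | τ * √(∑ k : s, c u k ^ 2) < |∑ k : s, c u k * y k|} 1 y :=
      fun y => by
      have h2 : Function.updateFinset u s y ∈ A ↔
          y ∈ {y : s → ℝ | τ * √(∑ k : s, c u k ^ 2) < |∑ k : s, c u k * y k|} := by
        change τ * √(∑ k ∈ s, c (Function.updateFinset u s y) k ^ 2) <
          |∑ k ∈ s, c (Function.updateFinset u s y) k * Function.updateFinset u s y k| ↔
          τ * √(∑ k : s, c u k ^ 2) < |∑ k : s, c u k * y k|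
        rw [hcs, ← sum_coe_sort s fun k => c u k ^ 2,
          ← sum_coe_sort s fun k => c u k * Function.updateFinset u s y k]
        simp [Function.updateFinset]
      by_cases h : Function.updateFinset u s y ∈ A
      · rw [hf, Set.indicator_of_mem h, Set.indicator_of_mem (h2.1 h)]; rfl
      · rw [hf, Set.indicator_of_notMem h, Set.indicator_of_notMem fun h' => h (h2.2 h')]
    rw [lmarginal, lintegral_congr h1, lintegral_indicator_one]
    · exact measure_abs_linear_gt_le (fun k : s => c u k) hτ
    · exact measurableSet_lt (by fun_prop) (by fun_prop)
  refine (lmarginal_mono hbound _).trans ?_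
  rw [lmarginal, lintegral_const, measure_univ, mul_one]

lemma gaussianReal_eq_withDensity (c : ℝ) {s : Set ℝ} (hs : MeasurableSet s) :
    ∫⁻ x in s, ENNReal.ofReal (Real.exp (c * x - c ^ 2 / 2)) ∂gaussianReal 0 1 =
      gaussianReal c 1 s := by
  rw [gaussianReal_apply c one_ne_zero, gaussianReal_of_var_ne_zero 0 one_ne_zero,
    restrict_withDensity hs, lintegral_withDensity_eq_lintegral_mul _ (measurable_gaussianPDF 0 1)
      (by fun_prop)]
  refine lintegral_congr fun x => ?_
  rw [Pi.mul_apply, gaussianPDF, gaussianPDF, ← ENNReal.ofReal_mul (gaussianPDFReal_nonneg _ _ _)]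
  congr 1
  rw [gaussianPDFReal, gaussianPDFReal, mul_assoc, ← Real.exp_add]
  congr 2
  simp; ring

lemma lintegral_prod_coord (f : ι → ℝ → ℝ≥0∞) (hf : ∀ k, Measurable (f k)) :
    ∫⁻ v, ∏ k, f k (v k) ∂law ι = ∏ k, ∫⁻ x, f k x ∂gaussianReal 0 1 := by
  have hind : iIndepFun (fun k (v : ι → ℝ) => f k (v k)) (law ι) :=
    iIndepFun_pi (X := f) fun k => (hf k).aemeasurable
  rw [lintegral_prod_eq_prod_lintegral_of_indepFun univ _ hind
    fun k => (hf k).comp (measurable_pi_apply k)]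
  refine prod_congr rfl fun k _ => ?_
  exact (measurePreserving_eval (fun _ : ι => gaussianReal 0 1) k).lintegral_comp (hf k)

/-- Density of the translated Gaussian measure. -/
def shiftDensity (c : ι → ℝ) (v : ι → ℝ) : ℝ≥0∞ :=
  ∏ k, ENNReal.ofReal (Real.exp (c k * v k - c k ^ 2 / 2))

lemma measurable_shiftDensity (c : ι → ℝ) : Measurable (shiftDensity c) := by
  unfold shiftDensity; fun_prop

lemma pi_gaussianReal_eq_withDensity (c : ι → ℝ) :
    (Measure.pi fun k => gaussianReal (c k) 1) = (law ι).withDensity (shiftDensity c) := by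
  refine Measure.pi_eq fun s hs => ?_
  rw [withDensity_apply _ (MeasurableSet.univ_pi hs), ← lintegral_indicator (MeasurableSet.univ_pi hs)]
  have h1 : ∀ v, (Set.univ.pi s).indicator (shiftDensity c) v =
      ∏ k, (s k).indicator (fun x => ENNReal.ofReal (Real.exp (c k * x - c k ^ 2 / 2))) (v k) :=
    fun v => by
    by_cases h : v ∈ Set.univ.pi s
    · rw [Set.indicator_of_mem h, shiftDensity]
      refine prod_congr rfl fun k _ => ?_
      rw [Set.indicator_of_mem (h k (Set.mem_univ k))]
    · rw [Set.indicator_of_notMem h]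
      obtain ⟨k, hk⟩ : ∃ k, v k ∉ s k := by simpa [Set.mem_univ_pi] using h
      exact (prod_eq_zero (mem_univ k) (Set.indicator_of_notMem hk _)).symm
  rw [lintegral_congr h1, lintegral_prod_coord _ fun k => Measurable.indicator (by fun_prop) (hs k)]
  refine prod_congr rfl fun k _ => ?_
  rw [lintegral_indicator (hs k), gaussianReal_eq_withDensity _ (hs k)]

/-- Per coordinate, E exp(2cx - c²) = exp(2c² - c²) = exp(c²). -/
lemma lintegral_shiftDensity_sq (c : ι → ℝ) :
    ∫⁻ v, shiftDensity c v ^ 2 ∂law ι = ENNReal.ofReal (Real.exp (∑ k, c k ^ 2)) := by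
  have h1 : ∀ v, shiftDensity c v ^ 2 =
      ∏ k, (ENNReal.ofReal (Real.exp (c k * v k - c k ^ 2 / 2))) ^ 2 := fun v => by
    rw [shiftDensity, prod_pow]
  rw [lintegral_congr h1, lintegral_prod_coord
    (fun k x => (ENNReal.ofReal (Real.exp (c k * x - c k ^ 2 / 2))) ^ 2) fun k => by fun_prop,
    Real.exp_sum, ENNReal.ofReal_prod_of_nonneg fun k _ => (Real.exp_pos _).le]
  refine prod_congr rfl fun k _ => ?_
  have h2 : ∀ x, (ENNReal.ofReal (Real.exp (c k * x - c k ^ 2 / 2))) ^ 2 =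
      ENNReal.ofReal (Real.exp (-c k ^ 2)) * ENNReal.ofReal (Real.exp (2 * c k * x)) := fun x => by
    rw [← ENNReal.ofReal_pow (Real.exp_pos _).le, ← ENNReal.ofReal_mul (Real.exp_pos _).le,
      ← Real.exp_nat_mul, ← Real.exp_add]
    congr 2; push_cast; ring
  rw [lintegral_congr h2, lintegral_const_mul _ (by fun_prop),
    ← ofReal_integral_eq_lintegral_ofReal (integrable_exp_mul_gaussianReal _)
      (.of_forall fun _ => (Real.exp_pos _).le), ← ENNReal.ofReal_mul (Real.exp_pos _).le]
  congr 1
  have h3 := congrFun (mgf_fun_id_gaussianReal (μ := 0) (v := 1)) (2 * c k)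
  rw [mgf] at h3
  rw [h3, ← Real.exp_add]
  congr 1; simp; ring

/-- Events that are very unlikely under the Gaussian measure remain unlikely after translation. -/
theorem measure_translate_le {B : Set (ι → ℝ)} (hB : MeasurableSet B) {c : ι → ℝ} {V : ℝ}
    (hc : ∑ k, c k ^ 2 ≤ V) :
    law ι {u | u + c ∈ B} ≤ ENNReal.ofReal (8 * Real.exp V) * law ι B + ENNReal.ofReal (1 / 8) := by
  have hmp : MeasurePreserving (fun u : ι → ℝ => u + c) (law ι)
      (Measure.pi fun k => gaussianReal (c k) 1) := by
    refine measurePreserving_pi (fun _ : ι => gaussianReal 0 1) (fun k => gaussianReal (c k) 1)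
      (f := fun k x => x + c k) fun k => ⟨by fun_prop, ?_⟩
    rw [gaussianReal_map_add_const, zero_add]
  have h1 : law ι {u | u + c ∈ B} = ∫⁻ v in B, shiftDensity c v ∂law ι := by
    rw [show {u | u + c ∈ B} = (fun u : ι → ℝ => u + c) ⁻¹' B from rfl,
      hmp.measure_preimage hB.nullMeasurableSet, pi_gaussianReal_eq_withDensity,
      withDensity_apply _ hB]
  set b := ENNReal.ofReal (8 * Real.exp V) with hb
  have hb0 : b ≠ 0 := by rw [hb]; simp [Real.exp_pos]
  have hbt : b ≠ ∞ := ENNReal.ofReal_ne_top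
  -- Either the density is at most b, or it is at most its square over b. By the second moment the
  -- square part integrates to at most 1/8 for b = 8 exp V.
  have hpt : ∀ v, shiftDensity c v ≤ b + shiftDensity c v ^ 2 / b := fun v => by
    rcases le_total (shiftDensity c v) b with h | h
    · exact h.trans le_self_add
    · refine le_trans ?_ le_add_self
      rw [ENNReal.le_div_iff_mul_le (Or.inl hb0) (Or.inl hbt), sq]
      gcongr
  calc law ι {u | u + c ∈ B} ≤ ∫⁻ v in B, (b + shiftDensity c v ^ 2 / b) ∂law ι :=
        h1 ▸ lintegral_mono hpt
    _ = b * law ι B + ∫⁻ v in B, shiftDensity c v ^ 2 / b ∂law ι := by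
        rw [lintegral_add_left measurable_const, setLIntegral_const]
    _ ≤ b * law ι B + ∫⁻ v, shiftDensity c v ^ 2 / b ∂law ι := by
        gcongr; exact Measure.restrict_le_self
    _ = b * law ι B + ENNReal.ofReal (Real.exp (∑ k, c k ^ 2)) / b := by
        simp only [div_eq_mul_inv]
        rw [lintegral_mul_const _ ((measurable_shiftDensity c).pow_const 2),
          lintegral_shiftDensity_sq]
    _ ≤ _ := by
        gcongr
        rw [hb, ← ENNReal.ofReal_div_of_pos (by positivity)]
        refine ENNReal.ofReal_le_ofReal ?_
        rw [div_le_div_iff₀ (by positivity) (by norm_num)]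
        have := Real.exp_le_exp.2 hc
        linarith

end StdGauss

end

noncomputable section

namespace ReLUNet

open Finset MeasureTheory

/-! ### Joint measurability in weights and inputs -/

section Measurability

variable {D : ℕ} {n : ℕ → ℕ} {Ω : Type*} [MeasurableSpace Ω] {Wf : Ω → Params D n}
  {xf : Ω → Fin (n 0) → ℝ}

lemma measurable_weight (hW : ∀ i h j, Measurable fun ω => Wf ω i h j) (d : ℕ)
    (h : Fin (n (d + 1))) (j : Fin (n d)) : Measurable fun ω => weight (Wf ω) d h j := by
  unfold weight
  by_cases hd : d < D
  · simpa only [dif_pos hd] using hW ⟨d, hd⟩ h j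
  · simp only [dif_neg hd, Matrix.zero_apply]; exact measurable_const

lemma measurable_layerOut (hW : ∀ i h j, Measurable fun ω => Wf ω i h j) (hx : Measurable xf)
    (d : ℕ) (h : Fin (n d)) : Measurable fun ω => layerOut (Wf ω) (xf ω) d h := by
  induction d with
  | zero => exact (measurable_pi_apply h).comp hx
  | succ d ih =>
    have h1 : Measurable fun ω => (weight (Wf ω) d *ᵥ layerOut (Wf ω) (xf ω) d) h := by
      simp only [Matrix.mulVec, dotProduct]
      exact Finset.measurable_fun_sum _ fun j _ => (measurable_weight hW d h j).mul (ih j)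
    simp only [layerOut]
    by_cases hd : d + 1 < D
    · simp only [if_pos hd]; exact measurable_const.max h1
    · simp only [if_neg hd]; exact h1

lemma measurable_preAct (hW : ∀ i h j, Measurable fun ω => Wf ω i h j) (hx : Measurable xf)
    (d : ℕ) (h : Fin (n d)) : Measurable fun ω => preAct (Wf ω) (xf ω) d h := by
  cases d with
  | zero => exact (measurable_pi_apply h).comp hx
  | succ d =>
    simp only [preAct, Matrix.mulVec, dotProduct]
    exact Finset.measurable_fun_sum _ fun j _ =>
      (measurable_weight hW d h j).mul (measurable_layerOut hW hx d j)

lemma measurable_gates (hW : ∀ i h j, Measurable fun ω => Wf ω i h j) (hx : Measurable xf)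
    (d : ℕ) (h : Fin (n d)) : Measurable fun ω => gates (Wf ω) (xf ω) d h := by
  cases d with
  | zero => exact measurable_const
  | succ d =>
    exact Measurable.ite (measurableSet_lt measurable_const (measurable_preAct hW hx (d + 1) h))
      measurable_const measurable_const

lemma measurable_fwd (hW : ∀ i h j, Measurable fun ω => Wf ω i h j)
    {a : Ω → (d : ℕ) → Fin (n d) → ℝ} (ha : ∀ d h, Measurable fun ω => a ω d h) (d' d : ℕ)
    (h : Fin (n d)) (j : Fin (n d')) :
    Measurable fun ω => fwd (weight (Wf ω)) (a ω) d' d h j := by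
  induction d with
  | zero => exact measurable_const
  | succ d ih =>
    have h1 : ∀ ω, fwd (weight (Wf ω)) (a ω) d' (d + 1) h j =
        (if d + 1 = d' ∧ (h : ℕ) = j then 1 else 0) +
          ∑ k, weight (Wf ω) d h k * a ω d k * fwd (weight (Wf ω)) (a ω) d' d k j := fun ω => by
      rw [fwd, Matrix.add_apply, Matrix.of_apply, Matrix.mul_apply]
      simp only [Matrix.mul_diagonal]
    simp only [h1]
    exact measurable_const.add (Finset.measurable_fun_sum _ fun k _ =>
      ((measurable_weight hW d h k).mul (ha d k)).mul (ih k))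

lemma measurable_l2Norm {k : ℕ} {v : Ω → Fin k → ℝ} (hv : ∀ i, Measurable fun ω => v ω i) :
    Measurable fun ω => l2Norm (v ω) := by
  simp only [l2Norm_eq_sqrt]
  exact (Finset.measurable_fun_sum _ fun i _ => (hv i).pow_const 2).sqrt

lemma measurable_dotProduct {k : ℕ} {v w : Ω → Fin k → ℝ} (hv : ∀ i, Measurable fun ω => v ω i)
    (hw : ∀ i, Measurable fun ω => w ω i) : Measurable fun ω => v ω ⬝ᵥ w ω := by
  simp only [dotProduct]
  exact Finset.measurable_fun_sum _ fun i _ => (hv i).mul (hw i)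

lemma measurable_mulVec {k l : ℕ} {A : Ω → Matrix (Fin k) (Fin l) ℝ} {w : Ω → Fin l → ℝ}
    (hA : ∀ i j, Measurable fun ω => A ω i j)
    (hw : ∀ i, Measurable fun ω => w ω i) (i : Fin k) : Measurable fun ω => (A ω *ᵥ w ω) i :=
  measurable_dotProduct (hA i) hw

lemma measurable_netStat (hW : ∀ i h j, Measurable fun ω => Wf ω i h j) (hx : Measurable xf)
    (j : StatIdx D) (h : StatRow n j) : Measurable fun ω => netStat (Wf ω) (xf ω) j h := by
  have hg := measurable_gates hW hx
  have hxi : ∀ i, Measurable fun ω => xf ω i := fun i => (measurable_pi_apply i).comp hx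
  rcases j with d | d | p
  · simp only [netStat, stat]
    exact Finset.measurable_fun_sum _ fun i _ => ((hg d i).mul
      (measurable_mulVec (fun i j => measurable_fwd hW hg 0 d i j) hxi i)).pow_const 2
  · simp only [netStat, stat]
    exact ((measurable_mulVec (fun i j => measurable_fwd hW hg 0 d i j) hxi h).pow_const 2).neg
  · simp only [netStat, stat]
    split_ifs
    · exact Finset.measurable_fun_sum _ fun i _ => (measurable_fwd hW hg _ _ h i).pow_const 2
    · exact measurable_const

lemma measurableSet_noiseOK {ε : ℝ} {Wf' : Ω → Params D n}
    (hW : ∀ i h j, Measurable fun ω => Wf ω i h j)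
    (hW' : ∀ i h j, Measurable fun ω => Wf' ω i h j) (hx : Measurable xf) :
    MeasurableSet {ω | NoiseOK ε (Wf ω) (Wf' ω) (xf ω)} := by
  have hg := measurable_gates hW hx
  have hΔ : ∀ e i j, Measurable fun ω => (weight (Wf' ω) e - weight (Wf ω) e) i j :=
    fun e i j => (measurable_weight hW' e i j).sub (measurable_weight hW e i j)
  simp only [NoiseOK, Set.ofPred_forall, Set.ofPred_and]
  refine MeasurableSet.iInter fun e => .iInter fun _ => .iInter fun d => .iInter fun _ =>
    .iInter fun _ => .iInter fun h => .inter ?_ (.iInter fun d' => .iInter fun _ =>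
      .iInter fun _ => .iInter fun j => ?_)
  · have hr := fun i => measurable_fwd hW hg (e + 1) d h i
    have hv := fun i => measurable_layerOut hW' hx e i
    exact measurableSet_le (measurable_dotProduct hr (measurable_mulVec (hΔ e) hv)).abs
      (((measurable_l2Norm hr).mul (measurable_l2Norm hv)).const_mul _)
  · have hr := fun i => measurable_fwd hW hg (e + 1) d h i
    have hv : ∀ i, Measurable fun ω =>
        (Matrix.diagonal (gates (Wf ω) (xf ω) e) * fwd (weight (Wf' ω)) (gates (Wf ω) (xf ω)) d' e)
          i j := fun i => by
      simp only [Matrix.diagonal_mul]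
      exact (hg e i).mul (measurable_fwd hW' hg d' e i j)
    exact measurableSet_le (measurable_dotProduct hr (measurable_mulVec (hΔ e) hv)).abs
      (((measurable_l2Norm hr).mul (measurable_l2Norm hv)).const_mul _)

lemma measurableSet_lossSet {yf : Ω → Fin (n D)} (γ : ℝ) (θ : StatIdx D → ℚ)
    (hW : ∀ i h j, Measurable fun ω => Wf ω i h j) (hx : Measurable xf) (hy : Measurable yf) :
    MeasurableSet {ω | (xf ω, yf ω) ∈ lossSet γ θ (Wf ω)} := by
  have h1 : {ω | (xf ω, yf ω) ∈ lossSet γ θ (Wf ω)} =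
      (⋃ j, ⋃ h, {ω | (θ j : ℝ) < netStat (Wf ω) (xf ω) j h}) ∪
      ⋃ y, (yf ⁻¹' {y} ∩ ⋃ j, ({_ω | j ≠ y} ∩
        {ω | netOut (Wf ω) (xf ω) y < netOut (Wf ω) (xf ω) j + γ})) := by
    ext ω
    simp [lossSet]
  rw [h1]
  have ho : ∀ j, Measurable fun ω => netOut (Wf ω) (xf ω) j := fun j => measurable_layerOut hW hx D j
  refine .union (.iUnion fun j => .iUnion fun h => measurableSet_lt measurable_const
    (measurable_netStat hW hx j h)) (.iUnion fun y => .inter (hy (measurableSet_singleton y))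
    (.iUnion fun j => .inter (.const _) (measurableSet_lt (ho y) ((ho j).add_const _))))

end Measurability

/-! ### Gaussian perturbation of the weights -/

section Noise

variable {D : ℕ} {n : ℕ → ℕ}

/-- Positions of the entries of the weight matrices. -/
abbrev NoiseIdx (D : ℕ) (n : ℕ → ℕ) : Type := Σ i : Fin D, Fin (n (i + 1)) × Fin (n i)

/-- Add `σ` times the noise `u` to the weights. -/
def perturb (W : Params D n) (σ : ℝ) (u : NoiseIdx D n → ℝ) : Params D n :=
  fun i => Matrix.of fun h j => W i h j + σ * u ⟨i, (h, j)⟩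

lemma weight_perturb_sub (W : Params D n) (σ : ℝ) (u : NoiseIdx D n → ℝ) (e : Fin D) :
    weight (perturb W σ u) e - weight W e = Matrix.of fun h j => σ * u ⟨e, (h, j)⟩ := by
  ext h j
  simp [weight, perturb]

lemma weight_perturb_congr (W : Params D n) (σ : ℝ) {u u' : NoiseIdx D n → ℝ} {e : ℕ}
    (h : ∀ k : NoiseIdx D n, (k.1 : ℕ) = e → u k = u' k) :
    weight (perturb W σ u) e = weight (perturb W σ u') e := by
  unfold weight
  split_ifs with he
  · ext i j; simp [perturb, h ⟨⟨e, he⟩, (i, j)⟩ rfl]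
  · rfl

lemma layerOut_congr {W W' : Params D n} (x : Fin (n 0) → ℝ) {d : ℕ}
    (h : ∀ e < d, weight W e = weight W' e) : layerOut W x d = layerOut W' x d := by
  induction d with
  | zero => rfl
  | succ d ih =>
    ext i
    simp only [layerOut]
    rw [h d (by omega), ih fun e he => h e (by omega)]

/-- Given the noise below layer e, the tested quantity is a linear form in the noise of layer e with
coefficients row_h v_j, of standard deviation σ|row||v|. The data `row` and `v` are given for every
layer so that coefficients can be written at `k.1` without casting along `k.1 = e`. -/
lemma measure_layer_noise_gt_le (W : Params D n) {σ τ ω : ℝ} (hσ : 0 ≤ σ) (hτ : 0 ≤ τ)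
    (hω : σ * τ ≤ ω) (e : Fin D) (row : (i : Fin D) → Fin (n (i + 1)) → ℝ)
    (v : (NoiseIdx D n → ℝ) → (i : Fin D) → Fin (n i) → ℝ)
    (hv : ∀ i j, Measurable fun u => v u i j)
    (hdep : ∀ u u', (∀ k : NoiseIdx D n, k.1 < e → u k = u' k) → v u e = v u' e) :
    StdGauss.law (NoiseIdx D n) {u | ω * (l2Norm (row e) * l2Norm (v u e)) <
      |row e ⬝ᵥ ((weight (perturb W σ u) e - weight W e) *ᵥ v u e)|} ≤
      ENNReal.ofReal (2 * Real.exp (-τ ^ 2 / 2)) := by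
  classical
  set s : Finset (NoiseIdx D n) := univ.map (Function.Embedding.sigmaMk e)
  set c : (NoiseIdx D n → ℝ) → NoiseIdx D n → ℝ := fun u k =>
    if k.1 = e then row k.1 k.2.1 * v u k.1 k.2.2 else 0 with hc
  have hcm : Measurable c := measurable_pi_lambda _ fun k => by
    simp only [hc]
    split_ifs
    · exact (hv _ _).const_mul _
    · exact measurable_const
  have hcs : ∀ u y, c (Function.updateFinset u s y) = c u := fun u y => by
    ext k
    simp only [hc]
    split_ifs with hk
    · obtain ⟨i, h, j⟩ := k
      simp only at hk
      subst hk
      rw [hdep (Function.updateFinset u s y) u fun k hk => ?_]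
      rw [Function.updateFinset, dif_neg]
      simp only [s, mem_map, mem_univ, true_and, not_exists]
      rintro p rfl
      exact lt_irrefl _ hk
    · rfl
  refine (measure_mono fun u hu => ?_).trans
    (StdGauss.measure_abs_predictable_gt_le s hcm hcs hτ)
  have hsum : ∀ F : NoiseIdx D n → ℝ, ∑ k ∈ s, F k = ∑ h, ∑ j, F ⟨e, (h, j)⟩ := fun F => by
    rw [sum_map, ← univ_product_univ, sum_product]; rfl
  have hlin : row e ⬝ᵥ ((weight (perturb W σ u) e - weight W e) *ᵥ v u e) =
      σ * ∑ k ∈ s, c u k * u k := by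
    rw [weight_perturb_sub, hsum, mul_sum]
    simp only [dotProduct, Matrix.mulVec, Matrix.of_apply, hc, if_true]
    refine sum_congr rfl fun h _ => ?_
    rw [mul_sum, mul_sum]
    exact sum_congr rfl fun j _ => by ring
  have hnorm : √(∑ k ∈ s, c u k ^ 2) = l2Norm (row e) * l2Norm (v u e) := by
    rw [hsum, l2Norm_eq_sqrt, l2Norm_eq_sqrt, ← Real.sqrt_mul (by positivity), sum_mul_sum]
    simp only [hc, if_true, mul_pow]
  change ω * (l2Norm (row e) * l2Norm (v u e)) < _ at hu
  change τ * √(∑ k ∈ s, c u k ^ 2) < |∑ k ∈ s, c u k * u k|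
  rw [hlin, abs_mul, abs_of_nonneg hσ] at hu
  rw [hnorm]
  by_contra hcon
  push Not at hcon
  have h1 := mul_le_mul_of_nonneg_left hcon hσ
  have h2 := mul_le_mul_of_nonneg_right hω
    (mul_nonneg (l2Norm_nonneg (row e)) (l2Norm_nonneg (v u e)))
  linarith

lemma measurable_perturb (W : Params D n) (σ : ℝ) (i : Fin D) (h : Fin (n (i + 1)))
    (j : Fin (n i)) : Measurable fun u : NoiseIdx D n → ℝ => perturb W σ u i h j := by
  simp only [perturb, Matrix.of_apply]; fun_prop

/-- Gaussian weight noise is well behaved with high probability. -/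
theorem measure_not_noiseOK_le {H : ℕ} (hH : ∀ d, 1 ≤ d → d ≤ D → n d ≤ H) (W : Params D n)
    {σ τ ω : ℝ} (hσ : 0 ≤ σ) (hτ : 0 ≤ τ) (hω : σ * τ ≤ ω) (x : Fin (n 0) → ℝ) :
    StdGauss.law (NoiseIdx D n) {u | ¬ NoiseOK ω W (perturb W σ u) x} ≤
      (D * (D * (H * (1 + D * H))) : ℕ) * ENNReal.ofReal (2 * Real.exp (-τ ^ 2 / 2)) := by
  set q := ENNReal.ofReal (2 * Real.exp (-τ ^ 2 / 2))
  -- The indices d and d' in `Fin D` stand for layers d + 1 and d' + 1, so the input width does not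
  -- enter the union bound.
  set A : (e d : Fin D) → Fin (n (d + 1)) → Set (NoiseIdx D n → ℝ) := fun e d h =>
    {u | ω * (l2Norm (fwd (weight W) (gates W x) (e + 1) (d + 1) h) *
        l2Norm (layerOut (perturb W σ u) x e)) <
      |fwd (weight W) (gates W x) (e + 1) (d + 1) h ⬝ᵥ
        ((weight (perturb W σ u) e - weight W e) *ᵥ layerOut (perturb W σ u) x e)|}
  set B : (e d : Fin D) → Fin (n (d + 1)) → (d' : Fin D) → Fin (n (d' + 1)) →
      Set (NoiseIdx D n → ℝ) := fun e d h d' j =>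
    {u | ω * (l2Norm (fwd (weight W) (gates W x) (e + 1) (d + 1) h) * l2Norm fun i =>
        (Matrix.diagonal (gates W x e) *
          fwd (weight (perturb W σ u)) (gates W x) (d' + 1) e) i j) <
      |fwd (weight W) (gates W x) (e + 1) (d + 1) h ⬝ᵥ
        ((weight (perturb W σ u) e - weight W e) *ᵥ fun i =>
        (Matrix.diagonal (gates W x e) *
          fwd (weight (perturb W σ u)) (gates W x) (d' + 1) e) i j)|}
  have hA : ∀ e d h, StdGauss.law (NoiseIdx D n) (A e d h) ≤ q := fun e d h =>
    measure_layer_noise_gt_le W hσ hτ hω e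
      (fun i => fwd (weight W) (gates W x) (i + 1) (d + 1) h)
      (fun u i => layerOut (perturb W σ u) x i)
      (fun i j => measurable_layerOut (measurable_perturb W σ) measurable_const i j)
      (fun u u' huu => layerOut_congr x fun e' he' => weight_perturb_congr W σ fun k hk =>
        huu k (Fin.lt_def.2 (by omega)))
  have hB : ∀ e d h d' j, StdGauss.law (NoiseIdx D n) (B e d h d' j) ≤ q := fun e d h d' j =>
    measure_layer_noise_gt_le W hσ hτ hω e
      (fun i => fwd (weight W) (gates W x) (i + 1) (d + 1) h)
      (fun u i k => (Matrix.diagonal (gates W x i) *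
          fwd (weight (perturb W σ u)) (gates W x) (d' + 1) i) k j)
      (fun i k => by
        simp only [Matrix.diagonal_mul]
        exact (measurable_fwd (a := fun _ => gates W x) (measurable_perturb W σ)
          (fun _ _ => measurable_const) _ _ k j).const_mul _)
      (fun u u' huu => by
        ext k
        rw [fwd_congr (weight (perturb W σ u)) (weight (perturb W σ u')) _ (gates W x)
          (fun _ _ _ => rfl) fun e' _ he' => weight_perturb_congr W σ fun k hk =>
            huu k (Fin.lt_def.2 (by omega))])
  have hsub : {u | ¬ NoiseOK ω W (perturb W σ u) x} ⊆
      ⋃ e : Fin D, ⋃ d : Fin D, ⋃ h : Fin (n (d + 1)),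
        (A e d h ∪ ⋃ d' : Fin D, ⋃ j : Fin (n (d' + 1)), B e d h d' j) := by
    intro u hu
    by_contra hcon
    refine hu fun e he d hed hd h => ?_
    obtain ⟨d, rfl⟩ : ∃ k, d = k + 1 := ⟨d - 1, by omega⟩
    simp only [Set.mem_iUnion, Set.mem_union, not_exists, not_or] at hcon
    have h1 := hcon ⟨e, he⟩ ⟨d, by omega⟩ h
    refine ⟨not_lt.1 h1.1, fun d' hd' hd'e j => ?_⟩
    obtain ⟨d', rfl⟩ : ∃ k, d' = k + 1 := ⟨d' - 1, by omega⟩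
    exact not_lt.1 (h1.2 ⟨d', by omega⟩ j)
  have hcard : ∀ d : Fin D, ∀ r : ENNReal, ∑ _h : Fin (n (d + 1)), r ≤ H * r := fun d r => by
    rw [sum_const, card_univ, Fintype.card_fin, nsmul_eq_mul]
    gcongr
    exact hH _ (by omega) (by omega)
  calc _ ≤ _ := measure_mono hsub
    _ ≤ ∑ e : Fin D, ∑ d : Fin D, ∑ h : Fin (n (d + 1)),
        (q + ∑ d' : Fin D, ∑ j : Fin (n (d' + 1)), q) := by
        refine (measure_iUnion_fintype_le _ _).trans (sum_le_sum fun e _ => ?_)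
        refine (measure_iUnion_fintype_le _ _).trans (sum_le_sum fun d _ => ?_)
        refine (measure_iUnion_fintype_le _ _).trans (sum_le_sum fun h _ => ?_)
        refine (measure_union_le _ _).trans (add_le_add (hA e d h) ?_)
        refine (measure_iUnion_fintype_le _ _).trans (sum_le_sum fun d' _ => ?_)
        exact (measure_iUnion_fintype_le _ _).trans (sum_le_sum fun j _ => hB e d h d' j)
    _ ≤ ∑ _e : Fin D, ∑ _d : Fin D, H * (q + ∑ _d' : Fin D, H * q) := by
        refine sum_le_sum fun e _ => sum_le_sum fun d _ => (hcard d _).trans ?_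
        gcongr with d' _
        exact hcard d' q
    _ = _ := by
        simp only [sum_const, card_univ, Fintype.card_fin, nsmul_eq_mul]
        push_cast; ring

end Noise

end ReLUNet
end

noncomputable section

namespace ReLUNet

open Finset Polynomial

/-! ### Counting values of a function -/

section Covers

variable {A B C : Type*}

/-- On `s`, the function `f` takes at most `N` values. -/
def Covers (f : A → B) (s : Set A) (N : ℕ) : Prop := ∃ F : Finset B, #F ≤ N ∧ ∀ a ∈ s, f a ∈ F

lemma Covers.bind {f : A → B} {g : A → C} {s : Set A} {N₁ N₂ : ℕ} (hf : Covers f s N₁)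
    (hg : ∀ b, Covers g {a ∈ s | f a = b} N₂) : Covers g s (N₁ * N₂) := by
  classical
  obtain ⟨F, hF, hFs⟩ := hf
  choose G hG hGs using hg
  exact ⟨F.biUnion G, (card_biUnion_le_card_mul _ _ _ fun b _ => hG b).trans
    (Nat.mul_le_mul_right _ hF),
    fun a ha => mem_biUnion.2 ⟨f a, hFs a ha, hGs _ a ⟨ha, rfl⟩⟩⟩

lemma Covers.of_determined {f : A → B} {g : A → C} {s : Set A} {N : ℕ} (hf : Covers f s N)
    (h : ∀ a ∈ s, ∀ a' ∈ s, f a = f a' → g a = g a') : Covers g s N := by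
  classical
  have h1 := hf.bind (g := g) (N₂ := 1) fun b => by
    by_cases hb : ∃ a ∈ s, f a = b
    · obtain ⟨a, ha, rfl⟩ := hb
      exact ⟨{g a}, by simp, fun a' ha' => by simp [h a' ha'.1 a ha ha'.2]⟩
    · exact ⟨∅, by simp, fun a ha => absurd ⟨a, ha⟩ hb⟩
  rwa [mul_one] at h1

end Covers

/-! ### Sign patterns of polynomials on the line -/

section Signs

variable {K : Type*} [Fintype K]

lemma eval_pos_of_no_root {P : ℝ[X]} {s t : ℝ} (h : ∀ r ∈ Set.uIcc s t, P.eval r ≠ 0)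
    (hs : 0 < P.eval s) : 0 < P.eval t := by
  by_contra ht
  push Not at ht
  obtain ⟨r, hr, hr0⟩ := intermediate_value_uIcc (P.continuous.continuousOn (s := Set.uIcc s t))
    (show (0 : ℝ) ∈ Set.uIcc (P.eval s) (P.eval t) by
      rw [Set.uIcc_of_ge (by linarith)]; exact ⟨ht, hs.le⟩)
  exact h r hr hr0

/-- A finite family of polynomials has few sign patterns along the real line. -/
lemma covers_signs (P : K → ℝ[X]) {N : ℕ} (hP : ∀ k, (P k).natDegree ≤ N) :
    Covers (fun σ : ℝ => {k | 0 < (P k).eval σ}) Set.univ (2 * (Fintype.card K * N) + 1) := by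
  classical
  set R : Finset ℝ := univ.biUnion fun k => (P k).roots.toFinset
  have hR : #R ≤ Fintype.card K * N := card_biUnion_le_card_mul _ _ _ fun k _ =>
    (Multiset.toFinset_card_le _).trans ((P k).card_roots'.trans (hP k))
  set lt : ℝ → Finset ℝ := fun σ => R.filter (· < σ)
  set le : ℝ → Finset ℝ := fun σ => R.filter (· ≤ σ)
  -- The number of roots below σ plus the number not above σ labels every root and every gap between
  -- roots, with 2#R + 1 possible labels.
  have h1 : Covers (fun σ => #(lt σ) + #(le σ)) Set.univ (2 * (Fintype.card K * N) + 1) :=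
    ⟨range (2 * #R + 1), by rw [card_range]; omega, fun σ _ => mem_range.2 (by
      have h1 : #(lt σ) ≤ #R := card_filter_le _ _
      have h2 : #(le σ) ≤ #R := card_filter_le _ _
      dsimp only
      omega)⟩
  have key : ∀ s t, s < t → #(lt s) + #(le s) = #(lt t) + #(le t) →
      ∀ k, P k ≠ 0 → ∀ r ∈ Set.uIcc s t, (P k).eval r ≠ 0 := by
    intro s t hst h k hk r hr h0
    rw [Set.uIcc_of_le hst.le] at hr
    have hmono : lt s ⊆ lt t := monotone_filter_right _ fun a _ ha => lt_trans ha hst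
    have hmono' : le s ⊆ le t := monotone_filter_right _ fun a _ ha => le_trans ha hst.le
    have hsub : lt s ⊆ le s := monotone_filter_right _ fun a _ ha => le_of_lt ha
    have hsub' : le s ⊆ lt t := monotone_filter_right _ fun a _ ha => lt_of_le_of_lt ha hst
    have hsub'' : lt t ⊆ le t := monotone_filter_right _ fun a _ ha => le_of_lt ha
    have heq : lt s = le t := eq_of_subset_of_card_le (hmono.trans hsub'') (by
      have := card_le_card hmono
      have := card_le_card hmono'
      have := card_le_card hsub
      have := card_le_card hsub'
      omega)
    have hmem : r ∈ le t := mem_filter.2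
      ⟨mem_biUnion.2 ⟨k, mem_univ _, by simp [hk, h0]⟩, hr.2⟩
    rw [← heq] at hmem
    exact absurd (mem_filter.1 hmem).2 (not_lt.2 hr.1)
  have key' : ∀ s t, s < t → #(lt s) + #(le s) = #(lt t) + #(le t) →
      {k | 0 < (P k).eval s} = {k | 0 < (P k).eval t} := by
    intro s t hst h
    ext k
    by_cases hk : P k = 0
    · simp [hk]
    · have h2 := key s t hst h k hk
      exact ⟨eval_pos_of_no_root h2, eval_pos_of_no_root (by rwa [Set.uIcc_comm])⟩
  refine h1.of_determined fun s _ t _ h => ?_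
  rcases lt_trichotomy s t with hst | rfl | hst
  · exact key' s t hst h
  · rfl
  · exact (key' t s hst h.symm).symm

end Signs

/-! ### Networks along a line Z + σv as polynomials in σ -/

section Polynomials

variable {D : ℕ} {n : ℕ → ℕ}

/-- The weights `Z + σ v` as polynomials in `σ`. -/
def polyWeight (Z : Params D n) (v : NoiseIdx D n → ℝ) (d : ℕ) :
    Matrix (Fin (n (d + 1))) (Fin (n d)) ℝ[X] :=
  Matrix.of fun h j => if hd : d < D then C (Z ⟨d, hd⟩ h j) + X * C (v ⟨⟨d, hd⟩, (h, j)⟩) else 0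

lemma map_polyWeight (Z : Params D n) (v : NoiseIdx D n → ℝ) (σ : ℝ) (d : ℕ) :
    (polyWeight Z v d).map (evalRingHom σ) = weight (perturb Z σ v) d := by
  ext h j
  simp only [polyWeight, weight, perturb, Matrix.map_apply, Matrix.of_apply]
  split_ifs
  · simp [mul_comm (v _)]
  · simp

lemma natDegree_polyWeight_le (Z : Params D n) (v : NoiseIdx D n → ℝ) (d : ℕ)
    (h : Fin (n (d + 1))) (j : Fin (n d)) : (polyWeight Z v d h j).natDegree ≤ 1 := by
  simp only [polyWeight, Matrix.of_apply]
  split_ifs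
  · refine (natDegree_add_le _ _).trans (max_le (by simp) ?_)
    exact natDegree_mul_le.trans (by simp)
  · simp

lemma natDegree_fwd_le {M : (d : ℕ) → Matrix (Fin (n (d + 1))) (Fin (n d)) ℝ[X]}
    (hM : ∀ d h j, (M d h j).natDegree ≤ 1) (g : (d : ℕ) → Fin (n d) → ℝ) (d' d : ℕ)
    (h : Fin (n d)) (j : Fin (n d')) :
    (fwd M (fun e i => C (g e i)) d' d h j).natDegree ≤ d := by
  induction d with
  | zero => simp only [fwd, Matrix.of_apply]; split_ifs <;> simp
  | succ d ih =>
    rw [fwd, Matrix.add_apply, Matrix.of_apply, Matrix.mul_apply]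
    refine (natDegree_add_le _ _).trans (max_le (by split_ifs <;> simp) ?_)
    refine natDegree_sum_le_of_forall_le _ _ fun k _ => ?_
    rw [Matrix.mul_diagonal]
    refine natDegree_mul_le.trans ?_
    have h1 : (M d h k * (C (g d k) : ℝ[X])).natDegree ≤ 1 :=
      natDegree_mul_le.trans (by rw [natDegree_C]; exact hM d h k)
    have h2 := ih k
    omega

lemma natDegree_fwd_mulVec_le {M : (d : ℕ) → Matrix (Fin (n (d + 1))) (Fin (n d)) ℝ[X]}
    (hM : ∀ d h j, (M d h j).natDegree ≤ 1) (g : (d : ℕ) → Fin (n d) → ℝ) (d : ℕ)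
    (x : Fin (n 0) → ℝ) (h : Fin (n d)) :
    ((fwd M (fun e i => C (g e i)) 0 d *ᵥ fun i => C (x i)) h).natDegree ≤ d := by
  simp only [Matrix.mulVec, dotProduct]
  refine natDegree_sum_le_of_forall_le _ _ fun k _ => natDegree_mul_le.trans ?_
  rw [natDegree_C]
  exact natDegree_fwd_le hM g 0 d h k

lemma natDegree_stat_le {M : (d : ℕ) → Matrix (Fin (n (d + 1))) (Fin (n d)) ℝ[X]}
    (hM : ∀ d h j, (M d h j).natDegree ≤ 1) (g : (d : ℕ) → Fin (n d) → ℝ)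
    (x : Fin (n 0) → ℝ) (j : StatIdx D) (h : StatRow n j) :
    (stat M (fun e i => C (g e i)) (fun i => C (x i)) j h).natDegree ≤ 2 * D := by
  rcases j with d | d | p <;> simp only [stat]
  · refine natDegree_sum_le_of_forall_le _ _ fun k _ => natDegree_pow_le.trans ?_
    have h1 := natDegree_fwd_mulVec_le hM g d x k
    have h2 : (C (g d k) * (fwd M (fun e i => C (g e i)) 0 d *ᵥ fun i => C (x i)) k).natDegree ≤ d :=
      natDegree_mul_le.trans (by rw [natDegree_C]; omega)
    have := d.2
    omega
  · rw [natDegree_neg]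
    refine natDegree_pow_le.trans ?_
    have h1 := natDegree_fwd_mulVec_le hM g d x h
    have := d.2
    omega
  · split_ifs
    · refine natDegree_sum_le_of_forall_le _ _ fun k _ => natDegree_pow_le.trans ?_
      have h1 := natDegree_fwd_le hM g p.1 p.2 h k
      have := p.2.2
      omega
    · simp

lemma map_fwd_mulVec {R S : Type*} [CommRing R] [CommRing S] (f : R →+* S)
    (M : (d : ℕ) → Matrix (Fin (n (d + 1))) (Fin (n d)) R) (a : (d : ℕ) → Fin (n d) → R)
    (x : Fin (n 0) → R) (d : ℕ) (h : Fin (n d)) :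
    f ((fwd M a 0 d *ᵥ x) h) =
      (fwd (fun e => (M e).map f) (fun e i => f (a e i)) 0 d *ᵥ fun i => f (x i)) h := by
  rw [← fwd_map, RingHom.map_mulVec]; rfl

lemma map_stat {R S : Type*} [CommRing R] [CommRing S] (f : R →+* S)
    (M : (d : ℕ) → Matrix (Fin (n (d + 1))) (Fin (n d)) R) (a : (d : ℕ) → Fin (n d) → R)
    (x : Fin (n 0) → R) (j : StatIdx D) (h : StatRow n j) :
    f (stat M a x j h) =
      stat (fun e => (M e).map f) (fun e i => f (a e i)) (fun i => f (x i)) j h := by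
  rcases j with d | d | p <;> simp only [stat]
  · simp only [map_sum, map_pow, map_mul, map_fwd_mulVec]
  · simp only [map_neg, map_pow, map_fwd_mulVec]
  · rw [apply_ite f]
    simp only [map_sum, map_pow, map_zero, ← fwd_map, Matrix.map_apply]

lemma stat_congr {R : Type*} [CommRing R] (M : (d : ℕ) → Matrix (Fin (n (d + 1))) (Fin (n d)) R)
    {a a' : (d : ℕ) → Fin (n d) → R} (h : ∀ d < D, a d = a' d) (x : Fin (n 0) → R)
    (j : StatIdx D) (k : StatRow n j) : stat M a x j k = stat M a' x j k := by
  rcases j with d | d | p <;> simp only [stat]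
  · rw [h d d.2, fwd_congr M M a a' (fun e _ he => h e (by omega)) fun _ _ _ => rfl]
  · rw [fwd_congr M M a a' (fun e _ he => h e (by omega)) fun _ _ _ => rfl]
  · rw [fwd_congr M M a a' (fun e _ he => h e (by omega)) fun _ _ _ => rfl]

/-- Given the activation pattern, the pre-activations of `Z + σ v` are polynomials in `σ`. -/
lemma preAct_perturb_eq_eval (Z : Params D n) (v : NoiseIdx D n → ℝ) (σ : ℝ) (x : Fin (n 0) → ℝ)
    {d : ℕ} (hd : d ≤ D) {g : (e : ℕ) → Fin (n e) → ℝ}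
    (hg : ∀ e < d, gates (perturb Z σ v) x e = g e) (h : Fin (n d)) :
    preAct (perturb Z σ v) x d h =
      ((fwd (polyWeight Z v) (fun e i => C (g e i)) 0 d *ᵥ fun i => C (x i)) h).eval σ := by
  rw [preAct_eq_fwd _ _ hd, ← coe_evalRingHom, map_fwd_mulVec]
  simp only [map_polyWeight]
  simp only [coe_evalRingHom, eval_C]
  rw [fwd_congr _ _ (gates (perturb Z σ v) x) g (fun e _ he => hg e he) fun _ _ _ => rfl]

lemma netStat_perturb_eq_eval (Z : Params D n) (v : NoiseIdx D n → ℝ) (σ : ℝ) (x : Fin (n 0) → ℝ)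
    {g : (e : ℕ) → Fin (n e) → ℝ} (hg : ∀ e < D, gates (perturb Z σ v) x e = g e) (j : StatIdx D)
    (h : StatRow n j) : netStat (perturb Z σ v) x j h =
      (stat (polyWeight Z v) (fun e i => C (g e i)) (fun i => C (x i)) j h).eval σ := by
  rw [netStat, ← coe_evalRingHom, map_stat]
  simp only [map_polyWeight]
  simp only [coe_evalRingHom, eval_C]
  exact stat_congr _ hg _ _ _

end Polynomials

/-! ### Counting activation and loss patterns -/

section Patterns

variable {D : ℕ} {n : ℕ → ℕ} {ι : Type*} [Fintype ι]

/-- Activation patterns of the first `d` layers along the line `Z + σ v`. -/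
lemma covers_gates {H : ℕ} (hH : ∀ d, 1 ≤ d → d ≤ D → n d ≤ H) (Z : Params D n)
    (v : NoiseIdx D n → ℝ) (x : ι → Fin (n 0) → ℝ) {d : ℕ} (hd : d ≤ D) :
    Covers (fun σ : ℝ => fun (i : ι) (e : ℕ) => if e ≤ d then gates (perturb Z σ v) (x i) e else 0)
      Set.univ ((2 * (Fintype.card ι * H * D) + 1) ^ d) := by
  classical
  induction d with
  | zero =>
    refine ⟨{fun i e => if e ≤ 0 then 1 else 0}, by simp, fun σ _ => mem_singleton.2 ?_⟩
    funext i e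
    dsimp only
    split_ifs with he
    · obtain rfl : e = 0 := by omega
      rfl
    · rfl
  | succ d ih =>
    rw [pow_succ]
    refine (ih (by omega)).bind fun g => ?_
    -- Once the gates up to layer d are fixed to g, the next pre-activations at all points are
    -- polynomials in σ, and their signs are the next gates.
    set P : ι × Fin (n (d + 1)) → ℝ[X] := fun p =>
      (fwd (polyWeight Z v) (fun e i => C (g p.1 e i)) 0 (d + 1) *ᵥ fun i => C (x p.1 i)) p.2
    obtain ⟨F, hF, hFs⟩ := covers_signs P (N := D) fun p =>
      (natDegree_fwd_mulVec_le (natDegree_polyWeight_le Z v) (g p.1) (d + 1) (x p.1) p.2).trans hd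
    have h1 : Covers (fun σ : ℝ => {p | 0 < (P p).eval σ}) {σ | σ ∈ Set.univ ∧
        (fun (i : ι) (e : ℕ) => if e ≤ d then gates (perturb Z σ v) (x i) e else 0) = g}
        (2 * (Fintype.card ι * H * D) + 1) := by
      refine ⟨F, hF.trans ?_, fun σ _ => hFs σ (Set.mem_univ σ)⟩
      rw [Fintype.card_prod, Fintype.card_fin]
      gcongr
      exact hH _ (by omega) hd
    refine h1.of_determined fun σ hσ σ' hσ' h => ?_
    have hold : ∀ σ ∈ {σ | σ ∈ Set.univ ∧
        (fun (i : ι) (e : ℕ) => if e ≤ d then gates (perturb Z σ v) (x i) e else 0) = g},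
        ∀ i, ∀ e ≤ d, gates (perturb Z σ v) (x i) e = g i e := fun σ hσ i e he => by
      rw [← hσ.2]; simp [he]
    have hnew : ∀ σ ∈ {σ | σ ∈ Set.univ ∧
        (fun (i : ι) (e : ℕ) => if e ≤ d then gates (perturb Z σ v) (x i) e else 0) = g},
        ∀ i k, gates (perturb Z σ v) (x i) (d + 1) k = if (i, k) ∈ {p | 0 < (P p).eval σ} then 1 else 0 :=
      fun σ hσ i k => by
      simp only [gates, Set.mem_ofPred_eq, P]
      rw [preAct_perturb_eq_eval Z v σ (x i) hd fun e he => hold σ hσ i e (by omega)]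
    funext i e
    split_ifs with he
    · rcases Nat.lt_or_ge d e with hlt | hle
      · obtain rfl : e = d + 1 := by omega
        funext k
        rw [hnew σ hσ, hnew σ' hσ']
        simp only [h]
      · rw [hold σ hσ i e hle, hold σ' hσ' i e hle]
    · rfl

/-- For each statistic, the sample indices below a threshold form an initial segment of the order by
largest component. Identical comparisons for W and W' make these segments nested, so equal
cardinality makes them equal; the thresholds matter only through these counts. -/
lemma preimage_lossSet_eq (z : ι → Point D n) {γ : ℝ} {θ θ' : StatIdx D → ℚ} {W W' : Params D n}
    (hcmp : ∀ j i i' h h', netStat W (z i).1 j h < netStat W (z i').1 j h' →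
      netStat W' (z i).1 j h < netStat W' (z i').1 j h')
    (hmargin : ∀ i k, 0 < netOut W (z i).1 k + γ - netOut W (z i).1 (z i).2 ↔
      0 < netOut W' (z i).1 k + γ - netOut W' (z i).1 (z i).2)
    (hcard : ∀ j, {i | ∀ h, netStat W (z i).1 j h ≤ θ j}.ncard =
      {i | ∀ h, netStat W' (z i).1 j h ≤ θ' j}.ncard) :
    z ⁻¹' lossSet γ θ W = z ⁻¹' lossSet γ θ' W' := by
  have h1 : ∀ j, {i | ∀ h, netStat W (z i).1 j h ≤ θ j} =
      {i | ∀ h, netStat W' (z i).1 j h ≤ θ' j} := fun j => by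
    by_cases hsub : {i | ∀ h, netStat W (z i).1 j h ≤ θ j} ⊆
        {i | ∀ h, netStat W' (z i).1 j h ≤ θ' j}
    · exact Set.eq_of_subset_of_ncard_le hsub (hcard j).ge (Set.toFinite _)
    · refine (Set.eq_of_subset_of_ncard_le (fun i' hi' h' => ?_) (hcard j).le (Set.toFinite _)).symm
      obtain ⟨i, hi, hi2⟩ := Set.not_subset.1 hsub
      simp only [Set.mem_ofPred_eq, not_forall, not_le] at hi hi2 hi'
      obtain ⟨h, hh⟩ := hi2
      by_contra hlt
      push Not at hlt
      have := hcmp j i i' h h' ((hi h).trans_lt hlt)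
      linarith [hi' h']
  ext i
  have h2 : ∀ (W : Params D n) (θ : StatIdx D → ℚ), i ∈ z ⁻¹' lossSet γ θ W ↔
      (∃ j, i ∉ {i | ∀ h, netStat W (z i).1 j h ≤ θ j}) ∨
      ∃ k, k ≠ (z i).2 ∧ 0 < netOut W (z i).1 k + γ - netOut W (z i).1 (z i).2 := fun W θ => by
    simp only [lossSet, Set.mem_preimage, Set.mem_ofPred_eq, not_forall, not_le, sub_pos]
  rw [h2, h2]
  simp only [h1, hmargin]

lemma covers_threshold_cards {A : Type*} (f : A → StatIdx D → Set ι) (s : Set A) :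
    Covers (fun a j => (f a j).ncard) s
      ((Fintype.card ι + 1) ^ Fintype.card (StatIdx D)) := by
  classical
  refine ⟨Fintype.piFinset fun _ => range (Fintype.card ι + 1), by simp, fun a _ => ?_⟩
  rw [Fintype.mem_piFinset]
  intro j
  rw [mem_range, Nat.lt_succ_iff, ← Nat.card_eq_fintype_card]
  exact Set.ncard_le_card _

/-- With the network fixed only the thresholds vary, so the count is free of the width H. -/
lemma covers_lossSet_fixed (W : Params D n) (γ : ℝ) (z : ι → Point D n) :
    Covers (fun θ : StatIdx D → ℚ => z ⁻¹' lossSet γ θ W) Set.univ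
      ((Fintype.card ι + 1) ^ Fintype.card (StatIdx D)) :=
  (covers_threshold_cards (fun θ j => {i | ∀ h, netStat W (z i).1 j h ≤ θ j}) _).of_determined
    fun _ _ _ _ h => preimage_lossSet_eq z (fun _ _ _ _ _ h => h) (fun _ _ => Iff.rfl)
      fun j => congrFun h j

/-- The number of loss patterns on `M` points along a line in weight space. -/
def patternBound (D H M : ℕ) : ℕ :=
  (2 * (M * H * D) + 1) ^ D *
    ((2 * (((2 * D + (D + 1) ^ 2) * (M * H) ^ 2 + M * H) * (2 * D)) + 1) *
      (M + 1) ^ (2 * D + (D + 1) ^ 2))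

lemma card_statIdx (D : ℕ) : Fintype.card (StatIdx D) = 2 * D + (D + 1) ^ 2 := by
  simp only [Fintype.card_sum, Fintype.card_prod, Fintype.card_fin]; ring

lemma card_statRow_le {H : ℕ} (hH : ∀ d, d ≤ D → n d ≤ H) (hH1 : 1 ≤ H) (j : StatIdx D) :
    Fintype.card (StatRow n j) ≤ H := by
  rcases j with d | d | p
  · exact (Fintype.card_unit).trans_le hH1
  · exact (Fintype.card_fin _).trans_le (hH _ d.2.le)
  · exact (Fintype.card_fin _).trans_le (hH _ (by omega))

/-- Three successive refinements of the parameters: the gates at all points, the signs of finitely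
many polynomials in σ, and the number of points below each threshold. They determine the loss
pattern, and `patternBound` is the product of their counts. -/
theorem covers_lossSet {H : ℕ} (hH : ∀ d, d ≤ D → n d ≤ H) (hH1 : 1 ≤ H)
    (Z : Params D n) (v : NoiseIdx D n → ℝ) (γ : ℝ) (z : ι → Point D n) :
    Covers (fun t : ℚ × (StatIdx D → ℚ) => z ⁻¹' lossSet γ t.2 (perturb Z t.1 v)) Set.univ
      (patternBound D H (Fintype.card ι)) := by
  classical
  rw [patternBound]
  refine Covers.bind (f := fun (t : ℚ × (StatIdx D → ℚ)) (i : ι) (e : ℕ) =>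
    if e ≤ D then gates (perturb Z t.1 v) (z i).1 e else 0) ?_ fun g => ?_
  · obtain ⟨F, hF, hFs⟩ := covers_gates (fun d _ h => hH d h) Z v (fun i => (z i).1) le_rfl
    exact ⟨F, hF, fun t _ => hFs t.1 (Set.mem_univ _)⟩
  set s := {t : ℚ × (StatIdx D → ℚ) | t ∈ Set.univ ∧ (fun (i : ι) (e : ℕ) =>
    if e ≤ D then gates (perturb Z t.1 v) (z i).1 e else 0) = g} with hs
  have hg : ∀ t ∈ s, ∀ i, ∀ e < D, gates (perturb Z t.1 v) (z i).1 e = g i e := fun t ht i e he => by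
    rw [← ht.2]; simp [he.le]
  set Q : ι → (j : StatIdx D) → StatRow n j → ℝ[X] := fun i j h =>
    stat (polyWeight Z v) (fun e k => C (g i e k)) (fun k => C ((z i).1 k)) j h with hQ
  set O : ι → Fin (n D) → ℝ[X] := fun i =>
    fwd (polyWeight Z v) (fun e k => C (g i e k)) 0 D *ᵥ fun k => C ((z i).1 k) with hO
  have hQe : ∀ t ∈ s, ∀ i j h, netStat (perturb Z t.1 v) (z i).1 j h = (Q i j h).eval (t.1 : ℝ) :=
    fun t ht i j h => netStat_perturb_eq_eval Z v _ _ (hg t ht i) j h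
  have hOe : ∀ t ∈ s, ∀ i k, netOut (perturb Z t.1 v) (z i).1 k = (O i k).eval (t.1 : ℝ) :=
    fun t ht i k => by
      rw [layerOut_last]; exact preAct_perturb_eq_eval Z v _ _ le_rfl (hg t ht i) k
  -- The first family compares the same statistic across points and components; the second encodes
  -- the margin conditions.
  set P : (Σ j : StatIdx D, (ι × StatRow n j) × (ι × StatRow n j)) ⊕ (ι × Fin (n D)) → ℝ[X] :=
    Sum.elim (fun k => Q k.2.2.1 k.1 k.2.2.2 - Q k.2.1.1 k.1 k.2.1.2)
      (fun p => O p.1 p.2 + C γ - O p.1 (z p.1).2) with hP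
  have hQd : ∀ i j h, (Q i j h).natDegree ≤ 2 * D := fun i j h =>
    natDegree_stat_le (natDegree_polyWeight_le Z v) _ _ _ _
  have hOd : ∀ i k, (O i k).natDegree ≤ 2 * D := fun i k =>
    (natDegree_fwd_mulVec_le (natDegree_polyWeight_le Z v) _ _ _ _).trans (by omega)
  obtain ⟨F, hF, hFs⟩ := covers_signs P (N := 2 * D) fun k => by
    rcases k with k | p
    · exact (natDegree_sub_le _ _).trans (max_le (hQd _ _ _) (hQd _ _ _))
    · exact (natDegree_sub_le _ _).trans (max_le ((natDegree_add_le _ _).trans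
        (max_le (hOd _ _) (by simp))) (hOd _ _))
  have hK : Fintype.card ((Σ j : StatIdx D, (ι × StatRow n j) × (ι × StatRow n j)) ⊕
      (ι × Fin (n D))) ≤ (2 * D + (D + 1) ^ 2) * (Fintype.card ι * H) ^ 2 + Fintype.card ι * H := by
    rw [Fintype.card_sum, Fintype.card_sigma, Fintype.card_prod, Fintype.card_fin]
    refine Nat.add_le_add ?_ (Nat.mul_le_mul_left _ (hH D le_rfl))
    rw [← card_statIdx D, ← card_univ, ← smul_eq_mul]
    refine sum_le_card_nsmul _ _ _ fun j _ => ?_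
    rw [Fintype.card_prod, Fintype.card_prod, sq]
    gcongr <;> exact card_statRow_le hH hH1 j
  refine Covers.bind (f := fun t => {k | 0 < (P k).eval (t.1 : ℝ)})
    ⟨F, hF.trans (by gcongr), fun t _ => hFs t.1 (Set.mem_univ _)⟩ fun q => ?_
  rw [← card_statIdx D]
  refine (covers_threshold_cards
    (fun t j => {i | ∀ h, netStat (perturb Z t.1 v) (z i).1 j h ≤ t.2 j}) _).of_determined
    fun t ht t' ht' h => ?_
  have hsign : ∀ k, 0 < (P k).eval (t.1 : ℝ) ↔ 0 < (P k).eval (t'.1 : ℝ) := fun k => by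
    have h1 := ht.2.trans ht'.2.symm
    exact Set.ext_iff.1 h1 k
  refine preimage_lossSet_eq z (fun j i i' h h' hlt => ?_) (fun i k => ?_) fun j => congrFun h j
  · have h1 := hsign (.inl ⟨j, (i, h), (i', h')⟩)
    simp only [hP, Sum.elim_inl, eval_sub, sub_pos, ← hQe t ht.1, ← hQe t' ht'.1] at h1
    exact h1.1 hlt
  · have h1 : 0 < (O i k + C γ - O i (z i).2).eval (t.1 : ℝ) ↔
        0 < (O i k + C γ - O i (z i).2).eval (t'.1 : ℝ) := hsign (.inr (i, k))
    simpa only [eval_sub, eval_add, eval_C, ← hOe t ht.1, ← hOe t' ht'.1] using h1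

end Patterns

end ReLUNet
end

noncomputable section

namespace ReLUNet

open Finset MeasureTheory UniformDeviation

/-! ### From the loss set of W' to the test error of W -/

section Transfer

variable {D : ℕ} {n : ℕ → ℕ} {m : ℕ}

/-- If the conditional probability of `B` given the second coordinate is at most `r`, then given the
first coordinate it rarely exceeds `a`. -/
lemma measure_lt_section_le {α β : Type*} [MeasurableSpace α] [MeasurableSpace β] (P : Measure α)
    (Q : Measure β) [IsProbabilityMeasure P] [IsProbabilityMeasure Q] {B : Set (α × β)}
    (hB : MeasurableSet B) {r a : ENNReal} (h : ∀ b, P {x | (x, b) ∈ B} ≤ r) (ha : a ≠ 0)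
    (ha' : a ≠ ⊤) : P {x | a < Q {b | (x, b) ∈ B}} ≤ r / a := by
  have h1 : ∫⁻ x, Q {b | (x, b) ∈ B} ∂P ≤ r := by
    have h2 : ∫⁻ x, Q {b | (x, b) ∈ B} ∂P = ∫⁻ b, P {x | (x, b) ∈ B} ∂Q :=
      (Measure.prod_apply hB).symm.trans (Measure.prod_apply_symm hB)
    rw [h2]
    exact (lintegral_mono h).trans (by simp)
  refine (measure_mono (t := {x | a ≤ Q {b | (x, b) ∈ B}}) fun x hx =>
    show a ≤ _ from le_of_lt (show a < _ from hx)).trans ?_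
  refine (meas_ge_le_lintegral_div (measurable_measure_prodMk_left hB).aemeasurable ha ha').trans ?_
  exact ENNReal.div_le_div_right h1 a

/-- An error of W implies ill-behaved noise at the point or membership in the loss set of W'; the
empirical frequency of that set is at most the margin error of W on the sample. -/
lemma testError_le_of_noiseOK (μ : Measure (Point D n)) [IsProbabilityMeasure μ]
    {S : Fin m → Point D n} {W W' : Params D n} {H : ℕ} {γ ε r : ℝ} {θ : StatIdx D → ℚ}
    (hW : ∀ d, 1 ≤ d → d < D → n d = H) (hH : 0 < H)
    (hγ : 0 < γ) (hD : 1 ≤ D) (hβ : ∀ d, 1 ≤ d → d < D → 0 < betaB S W d)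
    (hθ : Separating S W H γ θ)
    (hN : ∀ i, NoiseOK (noiseSize S W H γ) W W' (S i).1)
    (hr : μ.real {p | ¬ NoiseOK (noiseSize S W H γ) W W' p.1} ≤ r)
    (hε : μ.real (lossSet (γ / 2) θ W') - emp (lossSet (γ / 2) θ W') S ≤ ε) :
    testError μ W ≤ trainError S γ W + (r + ε) := by
  have h1 : testError μ W ≤ μ.real ({p | ¬ NoiseOK (noiseSize S W H γ) W W' p.1} ∪
      lossSet (γ / 2) θ W') := measureReal_mono fun p hp => by
    by_cases h : NoiseOK (noiseSize S W H γ) W W' p.1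
    · exact Or.inr (mem_lossSet_of_marginLoss_zero hW hH hγ hD hβ hθ h hp)
    · exact Or.inl h
  have h2 := h1.trans (measureReal_union_le _ _)
  have h3 : emp (lossSet (γ / 2) θ W') S ≤ trainError S γ W := by
    unfold emp trainError
    gcongr with i
    by_cases h : S i ∈ lossSet (γ / 2) θ W'
    · rw [marginLoss_of_mem_lossSet hW hH hγ hD hβ hθ (hN i) h]
      exact ind_le_one _ _
    · rw [ind, Set.indicator_of_notMem h]
      exact marginLoss_nonneg _ _ _
  linarith

/-- Cauchy–Schwarz: the spectral norm of each layer difference is at most its Frobenius norm. -/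
lemma noiseOK_of_distSq_le {W W' : Params D n} {ω : ℝ} (hω : 0 ≤ ω) (h : distSq W W' ≤ ω ^ 2)
    (x : Fin (n 0) → ℝ) : NoiseOK ω W W' x := by
  have key : ∀ e < D, ∀ (a : Fin (n (e + 1)) → ℝ) (v : Fin (n e) → ℝ),
      |a ⬝ᵥ ((weight W' e - weight W e) *ᵥ v)| ≤ ω * (l2Norm a * l2Norm v) := by
    intro e he a v
    have h1 : ∑ i, ∑ j, ((weight W' e - weight W e) i j) ^ 2 ≤ ω ^ 2 := by
      refine le_trans ?_ h
      refine le_trans (le_of_eq ?_) (single_le_sum (f := fun i : Fin D => frobSq (W i - W' i))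
        (fun i _ => sum_nonneg fun _ _ => sum_nonneg fun _ _ => sq_nonneg _) (mem_univ ⟨e, he⟩))
      simp only [frobSq, weight, dif_pos he, Matrix.sub_apply]
      exact sum_congr rfl fun i _ => sum_congr rfl fun j _ => by ring
    have h2 : l2Norm ((weight W' e - weight W e) *ᵥ v) ≤ ω * l2Norm v := by
      refine l2Norm_le_of_forall_sq_le (mul_nonneg hω (l2Norm_nonneg v)) ?_
      rw [mul_pow, l2Norm_sq]
      refine le_trans ?_ (mul_le_mul_of_nonneg_right h1 (sum_nonneg fun _ _ => sq_nonneg _))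
      rw [sum_mul]
      exact sum_le_sum fun i _ => sum_mul_sq_le_sq_mul_sq univ
        (fun j => (weight W' e - weight W e) i j) v
    calc _ ≤ l2Norm a * l2Norm ((weight W' e - weight W e) *ᵥ v) := abs_dotProduct_le _ _
      _ ≤ l2Norm a * (ω * l2Norm v) := by gcongr; exact l2Norm_nonneg _
      _ = _ := by ring
  exact fun e he d _ _ h => ⟨key e he _ _, fun d' _ _ j => key e he _ _⟩

end Transfer

/-! ### Good samples and the existence of good noise -/

section Sample

variable {D : ℕ} {n : ℕ → ℕ} {m : ℕ} (μ : Measure (Point D n)) [IsProbabilityMeasure μ]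

/-- Noise for which some rational scale and some thresholds give a large deviation on `S`. -/
def badNoise (S : Fin m → Point D n) (γ ε : ℝ) (Z : Params D n) : Set (NoiseIdx D n → ℝ) :=
  {v | ∃ t : ℚ × (StatIdx D → ℚ), ε < μ.real (lossSet γ t.2 (perturb Z t.1 v)) -
    emp (lossSet γ t.2 (perturb Z t.1 v)) S}

lemma measurableSet_lossSet_const (γ : ℝ) (θ : StatIdx D → ℚ) (W : Params D n) :
    MeasurableSet (lossSet γ θ W) :=
  measurableSet_lossSet (Ω := Point D n) (Wf := fun _ => W) (xf := Prod.fst) (yf := Prod.snd) γ θ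
    (fun _ _ _ => measurable_const) measurable_fst measurable_snd

lemma measurableSet_badNoise (γ ε : ℝ) (Z : Params D n) :
    MeasurableSet {q : (Fin m → Point D n) × (NoiseIdx D n → ℝ) | q.2 ∈ badNoise μ q.1 γ ε Z} := by
  have h0 : {q : (Fin m → Point D n) × (NoiseIdx D n → ℝ) | q.2 ∈ badNoise μ q.1 γ ε Z} =
      ⋃ t : ℚ × (StatIdx D → ℚ), {q | ε < μ.real (lossSet γ t.2 (perturb Z t.1 q.2)) -
        emp (lossSet γ t.2 (perturb Z t.1 q.2)) q.1} := by
    ext q; simp [badNoise]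
  rw [h0]
  refine .iUnion fun t => measurableSet_lt measurable_const (Measurable.sub ?_ ?_)
  · have h1 : MeasurableSet {q : (NoiseIdx D n → ℝ) × Point D n |
        q.2 ∈ lossSet γ t.2 (perturb Z t.1 q.1)} :=
      measurableSet_lossSet γ t.2 (fun i h j => (measurable_perturb Z t.1 i h j).comp measurable_fst)
        (measurable_fst.comp measurable_snd) (measurable_snd.comp measurable_snd)
    exact ((measurable_measure_prodMk_left (ν := μ) h1).ennreal_toReal).comp measurable_snd
  · refine (Finset.measurable_fun_sum _ fun i _ => ?_).div_const _
    have h1 : MeasurableSet {q : (Fin m → Point D n) × (NoiseIdx D n → ℝ) |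
        q.1 i ∈ lossSet γ t.2 (perturb Z t.1 q.2)} := by
      have h2 : Measurable fun q : (Fin m → Point D n) × (NoiseIdx D n → ℝ) => q.1 i :=
        (measurable_pi_apply i).comp measurable_fst
      exact measurableSet_lossSet γ t.2
        (fun i h j => (measurable_perturb Z t.1 i h j).comp measurable_snd)
        (measurable_fst.comp h2) (measurable_snd.comp h2)
    exact measurable_ind h1

/-- The deviation inequality holds for each fixed v along its line; Fubini and Markov turn this into
a statement about the Gaussian measure of bad v at fixed S. -/
lemma measure_badNoise_gt_le {H : ℕ} (hH : ∀ d, d ≤ D → n d ≤ H) (hH1 : 1 ≤ H) (hm : 0 < m)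
    (γ : ℝ) (Z : Params D n) {ε : ℝ} (hε : 0 ≤ ε) {a : ENNReal} (ha : a ≠ 0) (ha' : a ≠ ⊤) :
    (Measure.pi fun _ : Fin m => μ)
      {S | a < StdGauss.law (NoiseIdx D n) (badNoise μ S γ ε Z)} ≤
      ENNReal.ofReal (patternBound D H (2 * m) * Real.exp (-(m * ε ^ 2 / 2))) / a := by
  refine measure_lt_section_le _ _ (measurableSet_badNoise μ γ ε Z) (fun v => ?_) ha ha'
  refine measure_exists_deviation_le μ
    (A := fun t : ℚ × (StatIdx D → ℚ) => lossSet γ t.2 (perturb Z t.1 v))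
    (fun t => measurableSet_lossSet_const _ _ _) hm (fun z => ?_) hε
  obtain ⟨F, hF, hFs⟩ := covers_lossSet hH hH1 Z v γ z
  refine ⟨F, hF.trans_eq ?_, fun t => hFs t (Set.mem_univ _)⟩
  simp [two_mul]

lemma measure_exists_lossSet_deviation_le (hm : 0 < m) (γ : ℝ) (W : Params D n) {ε : ℝ}
    (hε : 0 ≤ ε) : (Measure.pi fun _ : Fin m => μ)
      {S | ∃ θ : StatIdx D → ℚ, ε < μ.real (lossSet γ θ W) - emp (lossSet γ θ W) S} ≤
      ENNReal.ofReal (((2 * m + 1) ^ (2 * D + (D + 1) ^ 2) : ℕ) * Real.exp (-(m * ε ^ 2 / 2))) := by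
  refine measure_exists_deviation_le μ (A := fun θ : StatIdx D → ℚ => lossSet γ θ W)
    (fun t => measurableSet_lossSet_const _ _ _) hm (fun z => ?_) hε
  obtain ⟨F, hF, hFs⟩ := covers_lossSet_fixed W γ z
  refine ⟨F, hF.trans_eq ?_, fun t => hFs t (Set.mem_univ _)⟩
  rw [card_statIdx]
  simp [two_mul]

lemma perturb_eq_perturb_add (W Z : Params D n) {σ : ℝ} (hσ : σ ≠ 0) (u : NoiseIdx D n → ℝ) :
    perturb W σ u =
      perturb Z σ (u + fun k => (W k.1 k.2.1 k.2.2 - Z k.1 k.2.1 k.2.2) / σ) := by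
  funext i
  ext h j
  simp only [perturb, Matrix.of_apply, Pi.add_apply]
  field_simp
  ring

lemma sum_shift_sq (W Z : Params D n) (σ : ℝ) :
    ∑ k : NoiseIdx D n, ((W k.1 k.2.1 k.2.2 - Z k.1 k.2.1 k.2.2) / σ) ^ 2 =
      distSq W Z / σ ^ 2 := by
  simp only [distSq, frobSq, sum_div, Fintype.sum_sigma, Fintype.sum_prod_type, div_pow,
    Matrix.sub_apply]

/-- There is noise that is well behaved around `W` both on the sample and on most of the
distribution, and is not bad when seen from `Z`. -/
lemma exists_good_noise {H : ℕ} (hH : ∀ d, 1 ≤ d → d ≤ D → n d ≤ H)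
    (S : Fin m → Point D n) (W : Params D n) {σ τ ω p V : ℝ} (hσ : 0 ≤ σ) (hτ : 0 ≤ τ)
    (hω : σ * τ ≤ ω)
    (hp : (D * (D * (H * (1 + D * H))) : ℕ) * (2 * Real.exp (-τ ^ 2 / 2)) ≤ p) (hp0 : 0 < p)
    (hmp : m * p ≤ 1 / 4) {B : Set (NoiseIdx D n → ℝ)} (hB : MeasurableSet B)
    {c : NoiseIdx D n → ℝ} (hc : ∑ k, c k ^ 2 ≤ V)
    (hBV : StdGauss.law (NoiseIdx D n) B ≤ ENNReal.ofReal (Real.exp (-V) / 64)) :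
    ∃ u, u + c ∉ B ∧ μ.real {q | ¬ NoiseOK ω W (perturb W σ u) q.1} ≤ 4 * p ∧
      ∀ i, NoiseOK ω W (perturb W σ u) (S i).1 := by
  set Λ := StdGauss.law (NoiseIdx D n)
  have hnoise : ∀ x, Λ {u | ¬ NoiseOK ω W (perturb W σ u) x} ≤ ENNReal.ofReal p := fun x => by
    refine (measure_not_noiseOK_le hH W hσ hτ hω x).trans ?_
    rw [← ENNReal.ofReal_natCast, ← ENNReal.ofReal_mul (by positivity)]
    exact ENNReal.ofReal_le_ofReal hp
  have h1 : Λ {u | u + c ∈ B} ≤ ENNReal.ofReal (1 / 4) := by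
    refine (StdGauss.measure_translate_le hB hc).trans ?_
    calc _ ≤ ENNReal.ofReal (8 * Real.exp V) * ENNReal.ofReal (Real.exp (-V) / 64) +
          ENNReal.ofReal (1 / 8) := by gcongr
      _ = ENNReal.ofReal (1 / 4) := by
        rw [← ENNReal.ofReal_mul (by positivity), ← ENNReal.ofReal_add (by positivity) (by norm_num)]
        congr 1
        have : Real.exp V * Real.exp (-V) = 1 := by rw [← Real.exp_add]; simp
        linear_combination this / 8
  have h2 : Λ {u | ENNReal.ofReal (4 * p) < μ {q | ¬ NoiseOK ω W (perturb W σ u) q.1}} ≤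
      ENNReal.ofReal (1 / 4) := by
    have hmeas : MeasurableSet {r : (NoiseIdx D n → ℝ) × Point D n |
        ¬ NoiseOK ω W (perturb W σ r.1) r.2.1} :=
      (measurableSet_noiseOK (Wf := fun _ => W) (fun _ _ _ => measurable_const)
        (fun i h j => (measurable_perturb W σ i h j).comp measurable_fst)
        (measurable_fst.comp measurable_snd)).compl
    refine (measure_lt_section_le Λ μ hmeas (fun q => hnoise q.1)
      (by simpa using hp0) ENNReal.ofReal_ne_top).trans (le_of_eq ?_)
    rw [← ENNReal.ofReal_div_of_pos (by positivity)]
    congr 1; field_simp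
  have h3 : Λ (⋃ i, {u | ¬ NoiseOK ω W (perturb W σ u) (S i).1}) ≤ ENNReal.ofReal (1 / 4) := by
    refine (measure_iUnion_fintype_le _ _).trans ((sum_le_sum fun i _ => hnoise _).trans ?_)
    rw [sum_const, card_univ, Fintype.card_fin, nsmul_eq_mul, ← ENNReal.ofReal_natCast,
      ← ENNReal.ofReal_mul (by positivity)]
    exact ENNReal.ofReal_le_ofReal hmp
  by_contra hcon
  push Not at hcon
  have hcover : (Set.univ : Set (NoiseIdx D n → ℝ)) ⊆ {u | u + c ∈ B} ∪
      ({u | ENNReal.ofReal (4 * p) < μ {q | ¬ NoiseOK ω W (perturb W σ u) q.1}} ∪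
        ⋃ i, {u | ¬ NoiseOK ω W (perturb W σ u) (S i).1}) := fun u _ => by
    by_cases hu1 : u + c ∈ B
    · exact Or.inl hu1
    by_cases hu2 : μ {q | ¬ NoiseOK ω W (perturb W σ u) q.1} ≤ ENNReal.ofReal (4 * p)
    · obtain ⟨i, hi⟩ := hcon u hu1 (ENNReal.toReal_le_of_le_ofReal (by positivity) hu2)
      exact Or.inr (Or.inr (Set.mem_iUnion.2 ⟨i, hi⟩))
    · exact Or.inr (Or.inl (not_le.1 hu2))
  -- Three bad events of measure at most 1/4 each cannot cover the space: the translated set B, a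
  -- failure probability above 4p under μ (Markov), and a failure on some sample point.
  have h4 : (1 : ENNReal) ≤ ENNReal.ofReal (3 / 4) := by
    calc (1 : ENNReal) = Λ Set.univ := by simp [Λ]
      _ ≤ _ := measure_mono hcover
      _ ≤ _ := (measure_union_le _ _).trans (add_le_add_right (measure_union_le _ _) _)
      _ ≤ ENNReal.ofReal (1 / 4) + (ENNReal.ofReal (1 / 4) + ENNReal.ofReal (1 / 4)) := by
          gcongr
      _ = _ := by
          rw [← ENNReal.ofReal_add (by norm_num) (by norm_num),
            ← ENNReal.ofReal_add (by norm_num) (by norm_num)]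
          norm_num
  rw [ENNReal.one_le_ofReal] at h4
  norm_num at h4

end Sample

/-! ### Numerical estimates -/

section Numerics

lemma patternBound_pos (D H M : ℕ) : 0 < patternBound D H M := by
  unfold patternBound; positivity

lemma card_statIdx_le {D : ℕ} (hD : 2 ≤ D) : 2 * D + (D + 1) ^ 2 ≤ 4 * D ^ 2 := by nlinarith

lemma patternBound_le {D H m : ℕ} (hD : 2 ≤ D) (hH : 1 ≤ H) (hm : 2 ≤ m) :
    patternBound D H (2 * m) ≤ (D ^ 2 * H ^ 2 * m) ^ (7 * D ^ 2) := by
  -- Since y = (DH√m)², powers of y match the logarithm in the definition of σ⋆.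
  set y := D ^ 2 * H ^ 2 * m with hy
  have h0 : 2 * (m * H * D) ≤ y := by
    calc 2 * (m * H * D) ≤ D * (m * (H * H) * D) := by gcongr; nlinarith
      _ = y := by rw [hy]; ring
  have h4 : 4 * m ≤ y := by
    calc 4 * m = 2 ^ 2 * 1 ^ 2 * m := by ring
      _ ≤ y := by rw [hy]; gcongr
  have h8 : 8 ≤ y := by omega
  have hsq : 8 * y ≤ y ^ 2 := by nlinarith
  have h5 : 512 * y ^ 2 ≤ y ^ 5 := by
    calc 512 * y ^ 2 = 8 ^ 3 * y ^ 2 := by norm_num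
      _ ≤ y ^ 3 * y ^ 2 := by gcongr
      _ = y ^ 5 := by ring
  have ha : 2 * (2 * m * H * D) + 1 ≤ y ^ 2 := by nlinarith
  have hb : 2 * (((2 * D + (D + 1) ^ 2) * (2 * m * H) ^ 2 + 2 * m * H) * (2 * D)) + 1 ≤ y ^ 5 := by
    calc 2 * (((2 * D + (D + 1) ^ 2) * (2 * m * H) ^ 2 + 2 * m * H) * (2 * D)) + 1
        ≤ 2 * ((4 * D ^ 2 * (2 * m * H) ^ 2 + 2 * m * H) * (2 * D)) + 1 := by
          gcongr; exact card_statIdx_le hD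
      _ = 64 * (D * (m * H * D) ^ 2) + 8 * (m * H * D) + 1 := by ring
      _ ≤ 64 * y ^ 2 + 8 * y + 1 := by
          have : D * (m * H * D) ^ 2 ≤ y ^ 2 := by
            calc D * (m * H * D) ^ 2 ≤ D ^ 2 * (m * (H * H) * D) ^ 2 := by
                  gcongr <;> nlinarith
              _ = y ^ 2 := by rw [hy]; ring
          nlinarith
      _ ≤ y ^ 5 := by nlinarith
  calc patternBound D H (2 * m) ≤ (y ^ 2) ^ D * (y ^ 5 * y ^ (4 * D ^ 2)) := by
        unfold patternBound
        refine Nat.mul_le_mul (Nat.pow_le_pow_left ha _) (Nat.mul_le_mul hb ?_)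
        calc (2 * m + 1) ^ (2 * D + (D + 1) ^ 2) ≤ y ^ (2 * D + (D + 1) ^ 2) := by
              gcongr; omega
          _ ≤ _ := Nat.pow_le_pow_right (by omega) (card_statIdx_le hD)
    _ = y ^ (2 * D + 5 + 4 * D ^ 2) := by rw [← pow_mul]; ring
    _ ≤ _ := Nat.pow_le_pow_right (by omega) (by nlinarith)

/-- Absorbs the noise failure term 1/m and the deviation into the final form: the square root costs
at most 6 and 1/m at most 1, within the constant 8. -/
lemma sqrt_add_inv_le {D m A Λ : ℝ} (hD : 1 ≤ D) (hm : 2 ≤ m) (hA : 1 ≤ A)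
    (hΛ : Λ ≤ 14 * (D ^ 2 * A)) :
    1 / m + √(2 * Λ / m) ≤ 8 * (D * √(1 / (m - 1) * A)) := by
  have hm1 : 0 < m - 1 := by linarith
  set s := √(1 / (m - 1) * A) with hs
  have hs0 : 0 ≤ s := Real.sqrt_nonneg _
  have hsq : s ^ 2 = 1 / (m - 1) * A := Real.sq_sqrt (by positivity)
  have hinv : 1 / m ≤ 1 / (m - 1) := one_div_le_one_div_of_le hm1 (by linarith)
  have hm0 : 0 < 1 / m := by positivity
  have hm2 : 1 / m ≤ 1 := by rw [div_le_one (by linarith)]; linarith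
  have h1 : 1 / m ≤ s := Real.le_sqrt_of_sq_le (by nlinarith)
  have h2 : √(2 * Λ / m) ≤ 6 * (D * s) := by
    refine Real.sqrt_le_left (by positivity) |>.2 ?_
    rw [mul_pow, mul_pow, hsq]
    calc 2 * Λ / m ≤ 2 * (14 * (D ^ 2 * A)) / m := by gcongr
      _ = 28 * (D ^ 2 * A) * (1 / m) := by ring
      _ ≤ 28 * (D ^ 2 * A) * (1 / (m - 1)) := by gcongr
      _ ≤ 36 * (D ^ 2 * A) * (1 / (m - 1)) := by gcongr; norm_num
      _ = _ := by ring
  have h3 : s ≤ D * s := le_mul_of_one_le_left hs0 hD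
  linarith

variable {D H m : ℕ}

lemma eight_le_sq (hD : 2 ≤ D) (hH : 1 ≤ H) (hm : 2 ≤ m) : (8 : ℝ) ≤ (D * H * √(m : ℝ)) ^ 2 := by
  rw [mul_pow, mul_pow, Real.sq_sqrt (by positivity)]
  have h1 : (2 : ℝ) ≤ D := by exact_mod_cast hD
  have h2 : (1 : ℝ) ≤ H := by exact_mod_cast hH
  have h3 : (2 : ℝ) ≤ m := by exact_mod_cast hm
  calc (8 : ℝ) = 2 ^ 2 * 1 ^ 2 * 2 := by norm_num
    _ ≤ _ := by gcongr

lemma one_le_log_size (hD : 2 ≤ D) (hH : 1 ≤ H) (hm : 2 ≤ m) :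
    1 ≤ Real.log (D * H * √(m : ℝ)) := by
  have h8 := eight_le_sq hD hH hm
  have hY : 0 ≤ (D : ℝ) * H * √(m : ℝ) := by positivity
  have he := Real.exp_one_lt_d9
  rw [Real.le_log_iff_exp_le (by nlinarith)]
  nlinarith

lemma log_patternBound_le (hD : 2 ≤ D) (hH : 1 ≤ H) (hm : 2 ≤ m) :
    Real.log (patternBound D H (2 * m)) ≤ 14 * D ^ 2 * Real.log (D * H * √(m : ℝ)) := by
  have h1 : (patternBound D H (2 * m) : ℝ) ≤ ((D * H * √(m : ℝ)) ^ 2) ^ (7 * D ^ 2) := by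
    have h2 : (D * H * √(m : ℝ)) ^ 2 = ((D ^ 2 * H ^ 2 * m : ℕ) : ℝ) := by
      rw [mul_pow, mul_pow, Real.sq_sqrt (by positivity)]
      push_cast; ring
    rw [h2]
    exact_mod_cast patternBound_le hD hH hm
  refine (Real.log_le_log (by exact_mod_cast patternBound_pos _ _ _) h1).trans (le_of_eq ?_)
  rw [Real.log_pow, Real.log_pow]
  push_cast; ring

/-- With Y = DH√m, there are at most 2Y³ events of probability 2Y^{-8} each and m ≤ Y², so the
product is at most 4/Y³. -/
lemma failure_mul_le (hD : 2 ≤ D) (hH : 1 ≤ H) (hm : 2 ≤ m) {τ : ℝ}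
    (hτ : τ ^ 2 = 16 * Real.log (D * H * √(m : ℝ))) :
    m * ((D * (D * (H * (1 + D * H))) : ℕ) * (2 * Real.exp (-τ ^ 2 / 2))) ≤ 1 / 4 := by
  set Y := (D : ℝ) * H * √(m : ℝ) with hY
  have h8 : 8 ≤ Y ^ 2 := eight_le_sq hD hH hm
  have hY0 : 0 < Y := by
    have : 0 ≤ Y := by positivity
    nlinarith
  have h1 : (2 : ℝ) ≤ D := by exact_mod_cast hD
  have h2 : (1 : ℝ) ≤ H := by exact_mod_cast hH
  have h3 : (1 : ℝ) ≤ √(m : ℝ) := Real.one_le_sqrt.2 (by exact_mod_cast (by omega : 1 ≤ m))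
  have hDH : (D : ℝ) * H ≤ Y := le_mul_of_one_le_right (by positivity) h3
  have hDH1 : (1 : ℝ) ≤ D * H := by nlinarith
  have hmY : (m : ℝ) ≤ Y ^ 2 := by
    rw [hY, mul_pow, Real.sq_sqrt (by positivity)]
    exact le_mul_of_one_le_left (by positivity) (by nlinarith)
  have hN : ((D * (D * (H * (1 + D * H))) : ℕ) : ℝ) ≤ 2 * Y ^ 3 := by
    push_cast
    calc (D : ℝ) * (D * (H * (1 + D * H))) ≤ (D * H) * (D * H * (D * H + D * H)) := by
          have : (D : ℝ) * (D * (H * (1 + D * H))) ≤ D * (D * (H * (D * H + D * H))) := by gcongr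
          refine this.trans ?_
          have : (D : ℝ) * (D * (H * (D * H + D * H))) ≤
            D * (D * (H * (D * H + D * H))) * H := le_mul_of_one_le_right (by positivity) h2
          linarith
      _ ≤ Y * (Y * (Y + Y)) := by gcongr
      _ = _ := by ring
  have hexp : Real.exp (-τ ^ 2 / 2) = (Y ^ 8)⁻¹ := by
    rw [neg_div, hτ, Real.exp_neg, show 16 * Real.log Y / 2 = ((8 : ℕ) : ℝ) * Real.log Y by
      push_cast; ring, Real.exp_nat_mul, Real.exp_log hY0]
  rw [hexp]
  calc _ ≤ Y ^ 2 * (2 * Y ^ 3 * (2 * (Y ^ 8)⁻¹)) := by gcongr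
    _ = 4 / Y ^ 3 := by field_simp; ring
    _ ≤ 1 / 4 := by
      rw [div_le_div_iff₀ (by positivity) (by norm_num)]
      nlinarith

end Numerics

end ReLUNet
end

noncomputable section

namespace ReLUNet

open Finset MeasureTheory UniformDeviation

/-! ### Assembling the generalization bound -/

section Main

variable {D H m : ℕ} {n : ℕ → ℕ}

/-- Exponent of the deviation inequality for noise of squared length about `k`. -/
def noiseRate (D H m : ℕ) (δ : ℝ) (k : ℕ) : ℝ :=
  Real.log (256 * patternBound D H (2 * m) / δ) + 2 * k

/-- Exponent of the deviation inequality for a fixed network. -/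
def fixedRate (D m : ℕ) (δ : ℝ) : ℝ :=
  Real.log (2 * ((2 * m + 1) ^ (2 * D + (D + 1) ^ 2) : ℕ) / δ)

lemma one_le_patternBound (D H M : ℕ) : (1 : ℝ) ≤ patternBound D H M := by
  exact_mod_cast patternBound_pos D H M

lemma noiseRate_nonneg {δ : ℝ} (hδ : 0 < δ) (hδ1 : δ < 1) (k : ℕ) : 0 ≤ noiseRate D H m δ k := by
  have := one_le_patternBound D H (2 * m)
  refine add_nonneg (Real.log_nonneg ?_) (by positivity)
  rw [le_div_iff₀ hδ]; linarith

lemma fixedRate_nonneg {δ : ℝ} (hδ : 0 < δ) (hδ1 : δ < 1) : 0 ≤ fixedRate D m δ := by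
  have : (1 : ℝ) ≤ ((2 * m + 1) ^ (2 * D + (D + 1) ^ 2) : ℕ) := by
    exact_mod_cast Nat.one_le_pow _ _ (by omega)
  refine Real.log_nonneg ?_
  rw [le_div_iff₀ hδ]; linarith

lemma exp_deviation {m : ℕ} (hm : 0 < m) {Λ : ℝ} (hΛ : 0 ≤ Λ) :
    Real.exp (-(m * √(2 * Λ / m) ^ 2 / 2)) = Real.exp (-Λ) := by
  have : (0 : ℝ) < m := by exact_mod_cast hm
  rw [Real.sq_sqrt (by positivity)]
  congr 1; field_simp

/-- Samples on which the deviations are not controlled are unlikely. -/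
lemma measure_exceptional_le (hH : ∀ d, d ≤ D → n d ≤ H) (hH1 : 1 ≤ H) (hm : 0 < m)
    (μ : Measure (Point D n)) [IsProbabilityMeasure μ] (Z : Params D n) (γ : ℝ) {δ : ℝ}
    (hδ : 0 < δ) (hδ1 : δ < 1) :
    (Measure.pi fun _ : Fin m => μ) ({S | ∃ θ : StatIdx D → ℚ,
        √(2 * fixedRate D m δ / m) < μ.real (lossSet γ θ Z) - emp (lossSet γ θ Z) S} ∪
      ⋃ k : ℕ, {S | ENNReal.ofReal (Real.exp (-k) / 64) < StdGauss.law (NoiseIdx D n)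
        (badNoise μ S γ (√(2 * noiseRate D H m δ k / m)) Z)}) ≤ ENNReal.ofReal δ := by
  have h1 : (Measure.pi fun _ : Fin m => μ) {S | ∃ θ : StatIdx D → ℚ,
      √(2 * fixedRate D m δ / m) < μ.real (lossSet γ θ Z) - emp (lossSet γ θ Z) S} ≤
      ENNReal.ofReal (δ / 2) := by
    refine (measure_exists_lossSet_deviation_le μ hm γ Z (Real.sqrt_nonneg _)).trans
      (ENNReal.ofReal_le_ofReal (le_of_eq ?_))
    have hG : (0 : ℝ) < ((2 * m + 1) ^ (2 * D + (D + 1) ^ 2) : ℕ) := by positivity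
    rw [exp_deviation hm (fixedRate_nonneg hδ hδ1), Real.exp_neg, fixedRate,
      Real.exp_log (by positivity)]
    field_simp
  -- The 2k in `noiseRate` yields exp(-2k); one factor exp(-k) is spent on the Markov level
  -- exp(-k)/64 and the other makes the union bound over k summable, to δ/2 in total.
  have h2 : ∀ k : ℕ, (Measure.pi fun _ : Fin m => μ) {S | ENNReal.ofReal (Real.exp (-k) / 64) <
      StdGauss.law (NoiseIdx D n) (badNoise μ S γ (√(2 * noiseRate D H m δ k / m)) Z)} ≤
      ENNReal.ofReal (δ / 4 * (1 / 2) ^ k) := fun k => by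
    refine (measure_badNoise_gt_le μ hH hH1 hm γ Z (Real.sqrt_nonneg _)
      (by simpa using Real.exp_pos _) ENNReal.ofReal_ne_top).trans ?_
    rw [← ENNReal.ofReal_div_of_pos (by positivity)]
    refine ENNReal.ofReal_le_ofReal ?_
    have hG : (0 : ℝ) < patternBound D H (2 * m) := by exact_mod_cast patternBound_pos _ _ _
    have he : Real.exp (-(k : ℝ)) ≤ (1 / 2) ^ k := by
      rw [show -(k : ℝ) = (k : ℝ) * (-1) by ring, Real.exp_nat_mul]
      refine pow_le_pow_left₀ (Real.exp_pos _).le ?_ k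
      have := Real.exp_one_gt_d9
      rw [Real.exp_neg, one_div]
      exact inv_anti₀ (by norm_num) (by linarith)
    have h3 : Real.exp (-noiseRate D H m δ k) =
        δ / (256 * patternBound D H (2 * m)) * (Real.exp (-k) * Real.exp (-k)) := by
      rw [noiseRate, neg_add, Real.exp_add, Real.exp_neg, Real.exp_log (by positivity), inv_div,
        ← Real.exp_add]
      congr 2; ring
    rw [exp_deviation hm (noiseRate_nonneg hδ hδ1 k), h3]
    calc _ = δ / 4 * Real.exp (-k) := by
          have := Real.exp_pos (-(k : ℝ))
          field_simp; ring
      _ ≤ _ := by gcongr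
  calc _ ≤ ENNReal.ofReal (δ / 2) + ∑' k : ℕ, ENNReal.ofReal (δ / 4 * (1 / 2) ^ k) :=
        (measure_union_le _ _).trans (add_le_add h1
          ((measure_iUnion_le _).trans (ENNReal.tsum_le_tsum h2)))
    _ = ENNReal.ofReal δ := by
      rw [← ENNReal.ofReal_tsum_of_nonneg (fun k => by positivity)
        (summable_geometric_two.mul_left _), tsum_mul_left, tsum_geometric_two,
        ← ENNReal.ofReal_add (by positivity) (by positivity)]
      congr 1; ring

variable {S : Fin m → Point D n} {W Z : Params D n} {γ δ : ℝ}

/-- Fixes c = 512: with ω = 1/(64 √H B), (512/64)² = 64, which is the factor 4τ² = 64 L (L the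
logarithm) lost by a scale σ ≥ ω/(2τ). -/
lemma noiseSize_invSigma (S : Fin m → Point D n) (W : Params D n) (hD : 2 ≤ D) (hH : 1 ≤ H)
    (hm : 2 ≤ m) (hγ : 0 < γ) :
    (512 * invSigma H γ S W) ^ 2 * noiseSize S W H γ ^ 2 =
      64 * Real.log (D * H * √(m : ℝ)) := by
  have hB := maxB_pos S W hH hγ (by omega : 1 ≤ D)
  have hL := one_le_log_size hD hH hm
  have hs : (0 : ℝ) < √(H : ℝ) := Real.sqrt_pos.2 (by exact_mod_cast hH)
  have h1 : invSigma H γ S W =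
      √(H : ℝ) * √(Real.log (D * H * √(m : ℝ))) * maxB S W H γ := rfl
  have h2 : √(Real.log (D * H * √(m : ℝ))) ^ 2 = Real.log (D * H * √(m : ℝ)) :=
    Real.sq_sqrt (by linarith)
  rw [h1, noiseSize]
  field_simp
  rw [h2]
  ring

lemma one_le_log_div (hD : 2 ≤ D) (hm : 2 ≤ m) (hδ : 0 < δ) (hδ1 : δ < 1) :
    1 ≤ Real.log (D * m / δ) := by
  have h1 : (2 : ℝ) ≤ D := by exact_mod_cast hD
  have h3 : (2 : ℝ) ≤ m := by exact_mod_cast hm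
  have he := Real.exp_one_lt_d9
  rw [Real.le_log_iff_exp_le (by positivity), le_div_iff₀ hδ]
  nlinarith [Real.exp_pos 1]

lemma neg_log_le (hD : 2 ≤ D) (hm : 2 ≤ m) (hδ : 0 < δ) :
    Real.log m - Real.log δ ≤ Real.log (D * m / δ) := by
  have h1 : (2 : ℝ) ≤ D := by exact_mod_cast hD
  have h3 : (2 : ℝ) ≤ m := by exact_mod_cast hm
  rw [Real.log_div (by positivity) hδ.ne', Real.log_mul (by positivity) (by positivity)]
  have := Real.log_nonneg (by linarith : (1 : ℝ) ≤ D)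
  linarith

lemma fixedRate_le (hD : 2 ≤ D) (hm : 2 ≤ m) (hδ : 0 < δ) (hδ1 : δ < 1) :
    fixedRate D m δ ≤ 14 * (D ^ 2 * Real.log (D * m / δ)) := by
  have h1 : (2 : ℝ) ≤ D := by exact_mod_cast hD
  have h3 : (2 : ℝ) ≤ m := by exact_mod_cast hm
  have hA := one_le_log_div hD hm hδ hδ1
  have hA' := neg_log_le hD hm hδ
  set A := Real.log (D * m / δ)
  have hlogm : 0 ≤ Real.log m := Real.log_nonneg (by linarith)
  have hlogδ : Real.log δ ≤ 0 := Real.log_nonpos hδ.le hδ1.le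
  have hlog2 := Real.log_two_lt_d9
  have hpow : Real.log ((2 * m + 1) ^ (2 * D + (D + 1) ^ 2) : ℕ) ≤ 12 * D ^ 2 * Real.log m := by
    have h4 : ((2 * m + 1) ^ (2 * D + (D + 1) ^ 2) : ℕ) ≤ (m ^ 3) ^ (4 * D ^ 2) := by
      calc (2 * m + 1) ^ (2 * D + (D + 1) ^ 2) ≤ (m ^ 3) ^ (2 * D + (D + 1) ^ 2) := by
            gcongr
            calc 2 * m + 1 ≤ 4 * m := by omega
              _ = 2 * 2 * m := by ring
              _ ≤ m * m * m := by gcongr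
              _ = m ^ 3 := by ring
        _ ≤ _ := Nat.pow_le_pow_right (by positivity) (card_statIdx_le hD)
    have h5 : (((2 * m + 1) ^ (2 * D + (D + 1) ^ 2) : ℕ) : ℝ) ≤ ((m : ℝ) ^ 3) ^ (4 * D ^ 2) := by
      exact_mod_cast h4
    refine (Real.log_le_log (by positivity) h5).trans (le_of_eq ?_)
    rw [Real.log_pow, Real.log_pow]
    push_cast; ring
  rw [fixedRate, Real.log_div (by positivity) hδ.ne', Real.log_mul (by norm_num) (by positivity)]
  have h6 : 12 * (D : ℝ) ^ 2 * Real.log m ≤ 12 * D ^ 2 * A := by gcongr; linarith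
  have h7 : 4 * A ≤ D ^ 2 * A := by gcongr; nlinarith
  linarith

lemma noiseRate_le (hD : 2 ≤ D) (hH : 1 ≤ H) (hm : 2 ≤ m) (hδ : 0 < δ)
    {A V : ℝ} (hA : 2 * V + Real.log (D * m / δ) ≤ A)
    (hAL : 128 * Real.log (D * H * √(m : ℝ)) ≤ A) {k : ℕ} (hk : (k : ℝ) ≤ V + 1) :
    noiseRate D H m δ k ≤ 14 * (D ^ 2 * A) := by
  have h1 : (2 : ℝ) ≤ D := by exact_mod_cast hD
  have h3 : (2 : ℝ) ≤ m := by exact_mod_cast hm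
  have hA' := neg_log_le hD hm hδ
  have hlogm : 0 ≤ Real.log m := Real.log_nonneg (by linarith)
  have hG := log_patternBound_le hD hH hm
  have hL := one_le_log_size hD hH hm
  set L := Real.log (D * H * √(m : ℝ))
  have hGpos : (0 : ℝ) < patternBound D H (2 * m) := by exact_mod_cast patternBound_pos _ _ _
  have h256 : Real.log 256 ≤ 6 := by
    have hlog2 := Real.log_two_lt_d9
    rw [show (256 : ℝ) = 2 ^ 8 by norm_num, Real.log_pow]
    push_cast; linarith
  rw [noiseRate, Real.log_div (by positivity) hδ.ne', Real.log_mul (by norm_num) hGpos.ne']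
  have h4 : 128 * (D ^ 2 * L) ≤ D ^ 2 * A := by nlinarith
  have h5 : 4 * A ≤ D ^ 2 * A := by gcongr; nlinarith; nlinarith
  linarith

/-- On a good sample the generalization bound holds for all weights. -/
lemma testError_le_of_good (hD : 2 ≤ D) (hm : 2 ≤ m) (hW : ∀ d, 1 ≤ d → d < D → n d = H)
    (hn : ∀ d, d ≤ D → n d ≤ H) (hH : 1 ≤ H) (μ : Measure (Point D n)) [IsProbabilityMeasure μ]
    (hγ : 0 < γ) (hδ : 0 < δ) (hδ1 : δ < 1)
    (hfixed : ∀ θ : StatIdx D → ℚ, μ.real (lossSet (γ / 2) θ Z) - emp (lossSet (γ / 2) θ Z) S ≤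
      √(2 * fixedRate D m δ / m))
    (hnoise : ∀ k : ℕ, StdGauss.law (NoiseIdx D n)
      (badNoise μ S (γ / 2) (√(2 * noiseRate D H m δ k / m)) Z) ≤
        ENNReal.ofReal (Real.exp (-k) / 64))
    (hβ : ∀ d, 1 ≤ d → d < D → 0 < betaB S W d) :
    testError μ W ≤ trainError S γ W + 8 * (D * √(1 / ((m : ℝ) - 1) *
      (2 * distSq W Z * (512 * invSigma H γ S W) ^ 2 + Real.log (D * m / δ)))) := by
  have hD1 : 1 ≤ D := by omega
  have hDr : (1 : ℝ) ≤ D := by exact_mod_cast hD1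
  have hmr : (2 : ℝ) ≤ m := by exact_mod_cast hm
  have hω := noiseSize_pos S W hH hγ hD1
  have hωσ := noiseSize_invSigma S W hD hH hm hγ
  have hL := one_le_log_size hD hH hm
  have hlog := one_le_log_div hD hm hδ hδ1
  have hΔ : 0 ≤ distSq W Z :=
    sum_nonneg fun _ _ => sum_nonneg fun _ _ => sum_nonneg fun _ _ => sq_nonneg _
  obtain ⟨θ, hθ⟩ := exists_separating S W hH hγ hD1 hβ
  set ω := noiseSize S W H γ with hωdef
  set L := Real.log (D * H * √(m : ℝ))
  set I := (512 * invSigma H γ S W) ^ 2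
  have hI : 0 ≤ I := sq_nonneg _
  set A := 2 * distSq W Z * I + Real.log (D * m / δ) with hA
  have hA0 : 0 ≤ 2 * distSq W Z * I := by positivity
  -- Near Z the comparison network is Z itself and `fixedRate` suffices. Far from Z the distance
  -- term exceeds 128 L, enough to pay for the pattern count in `noiseRate`.
  rcases le_or_gt (distSq W Z) (ω ^ 2) with hnear | hfar
  · have hN := fun x => noiseOK_of_distSq_le (n := n) hω.le hnear x
    have h1 := testError_le_of_noiseOK μ (r := 0) hW hH hγ hD1 hβ hθ (fun i => hN _)
      (by simp [← hωdef, hN]) (hfixed θ)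
    have h2 := sqrt_add_inv_le (A := A) hDr hmr (by linarith) ((fixedRate_le hD hm hδ hδ1).trans
      (by gcongr; linarith))
    have h3 : 0 ≤ 1 / (m : ℝ) := by positivity
    linarith
  set τ := 4 * √L with hτ
  have hτsq : τ ^ 2 = 16 * L := by rw [hτ, mul_pow, Real.sq_sqrt (by linarith)]; norm_num
  have hτ0 : 0 < τ := by rw [hτ]; have := Real.sqrt_pos.2 (by linarith : 0 < L); positivity
  -- The scale must be rational to belong to the countable class, hence the factor 2 of room; the
  -- upper end gives στ ≤ ω and the lower end bounds V.
  obtain ⟨σ, hσ1, hσ2⟩ := exists_rat_btwn (show ω / (2 * τ) < ω / τ by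
    gcongr; linarith)
  have hσ0 : (0 : ℝ) < σ := lt_trans (by positivity) hσ1
  have hστ : σ * τ ≤ ω := by rw [lt_div_iff₀ hτ0] at hσ2; exact hσ2.le
  set V := distSq W Z / (σ : ℝ) ^ 2 with hV
  have hV0 : 0 ≤ V := by positivity
  have hIω : I = 64 * L / ω ^ 2 := by rw [eq_div_iff (by positivity), hωσ]
  have hVI : V ≤ distSq W Z * I := by
    rw [hV, hIω, div_eq_mul_inv]
    refine mul_le_mul_of_nonneg_left ?_ hΔ
    rw [show 64 * L / ω ^ 2 = ((ω / (2 * τ)) ^ 2)⁻¹ by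
      rw [div_pow, inv_div, mul_pow, hτsq]; ring]
    exact inv_anti₀ (by positivity) (by gcongr)
  have hLA : 128 * L ≤ A := by
    have h1 : 64 * L ≤ distSq W Z * I := by
      rw [← hωσ, mul_comm]; gcongr
    linarith
  set p : ℝ := (D * (D * (H * (1 + D * H))) : ℕ) * (2 * Real.exp (-τ ^ 2 / 2)) with hp
  have hp0 : 0 < p := by positivity
  have hmp : m * p ≤ 1 / 4 := failure_mul_le hD hH hm hτsq
  have hk : (⌈V⌉₊ : ℝ) ≤ V + 1 := (Nat.ceil_lt_add_one hV0).le
  -- The squared shift V is rounded up to an integer, since the good sample controls bad noise only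
  -- at integer levels k.
  obtain ⟨u, hu1, hu2, hu3⟩ := exists_good_noise μ (fun d _ h => hn d h) S W hσ0.le hτ0.le hστ
    le_rfl hp0 hmp
    (B := badNoise μ S (γ / 2) (√(2 * noiseRate D H m δ ⌈V⌉₊ / m)) Z)
    (measurable_prodMk_left (measurableSet_badNoise μ (γ / 2) _ Z))
    (c := fun k => (W k.1 k.2.1 k.2.2 - Z k.1 k.2.1 k.2.2) / σ) (V := ⌈V⌉₊)
    ((sum_shift_sq W Z σ).trans_le (Nat.le_ceil V)) (hnoise _)
  have h1 : μ.real (lossSet (γ / 2) θ (perturb W σ u)) -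
      emp (lossSet (γ / 2) θ (perturb W σ u)) S ≤ √(2 * noiseRate D H m δ ⌈V⌉₊ / m) := by
    by_contra hcon
    refine hu1 ⟨(σ, θ), ?_⟩
    rw [perturb_eq_perturb_add W Z hσ0.ne' u] at hcon
    exact not_le.1 hcon
  have h2 := testError_le_of_noiseOK μ hW hH hγ hD1 hβ hθ hu3 hu2 h1
  have h3 := sqrt_add_inv_le (A := A) hDr hmr (by linarith)
    (noiseRate_le hD hH hm hδ (by linarith) hLA hk)
  have h4 : 4 * p ≤ 1 / m := by
    rw [le_div_iff₀ (by linarith)]; linarith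
  linarith

end Main

end ReLUNet
end

theorem theorem2 :
    -- absolute constants
    ∃ C c : ℝ, 0 < C ∧ 0 < c ∧
      -- depth, hidden width, sample size; `n d` is the number of units of layer `d`
      ∀ (D H m : ℕ) (n : ℕ → ℕ), 2 ≤ D → 2 ≤ m →
        (∀ d, 1 ≤ d → d < D → n d = H) → n 0 ≤ H → n D ≤ H →
        -- data distribution, initialisation (independent of the sample), margin, confidence
        ∀ (μ : MeasureTheory.Measure (ReLUNet.Point D n)) [MeasureTheory.IsProbabilityMeasure μ]
          (Z : ReLUNet.Params D n) (γ δ : ℝ), 0 < γ → 0 < δ →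
          (MeasureTheory.Measure.pi fun _ : Fin m => μ)
            {S | ¬ ∀ W : ReLUNet.Params D n,
              (∀ d, 1 ≤ d → d < D → 0 < ReLUNet.betaB S W d) →
              ReLUNet.testError μ W ≤ ReLUNet.trainError S γ W +
                C * (D * √(1 / ((m : ℝ) - 1) *
                  (2 * ReLUNet.distSq W Z * (c * ReLUNet.invSigma H γ S W) ^ 2 +
                    Real.log (D * m / δ))))} ≤ ENNReal.ofReal δ := by
  refine ⟨8, 512, by norm_num, by norm_num, fun D H m n hD hm hW hn0 hnD μ _ Z γ δ hγ hδ => ?_⟩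
  rcases le_or_gt 1 δ with hδ1 | hδ1
  · exact MeasureTheory.prob_le_one.trans (ENNReal.one_le_ofReal.2 hδ1)
  have hn : ∀ d, d ≤ D → n d ≤ H := fun d hd => by
    rcases Nat.eq_zero_or_pos d with rfl | h1
    · exact hn0
    rcases hd.lt_or_eq with h2 | rfl
    · exact (hW d h1 h2).le
    · exact hnD
  -- A probability measure forces a label to exist, so 1 ≤ n D ≤ H.
  have hH : 1 ≤ H := by
    by_contra hH0
    obtain ⟨-, y⟩ := MeasureTheory.nonempty_of_isProbabilityMeasure μ
    exact absurd y.2 (by omega)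
  -- The failure set is only included in the exceptional set, so its own measurability is not
  -- required.
  refine (MeasureTheory.measure_mono fun S hS => ?_).trans
    (ReLUNet.measure_exceptional_le hn hH (by omega) μ Z (γ / 2) hδ hδ1)
  by_contra hgood
  simp only [Set.mem_union, Set.mem_iUnion, Set.mem_ofPred_eq, not_or, not_exists, not_lt] at hgood
  exact hS fun W hβ => ReLUNet.testError_le_of_good hD hm hW hn hH μ hγ hδ hδ1 hgood.1 hgood.2 hβ
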